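/- **Setting.** Let $m\ge 2$, $0\le l<m$, $\epsilon\in\{0,1\}$, $k\ge 0$ be integers, and write $J=(0,1]$ if $\epsilon=0$, $J=[-1,0)$ if $\epsilon=1$. Let $G_0(re^{\iota t})=r^{1/m}e^{\iota t/m}$ for $t\in[0,2\pi)$, $G_l=e^{2\pi \iota l/m}G_0$, let $\mathcal D\subset\mathbb C$ be the pre-image of the square $[-1,1]^2$ under $\omega\mapsto\omega^m$, and for $f:\mathcal D\to\mathbb C$ let $$\varphi_{f,l}(s)=\int_{-1}^1\frac{f(G_l(u+\iota s))}{(u^2+s^2)^{(m-1)/m}}\,du,\qquad s\in[-1,0)\cup(0,1].$$ For $j\ge0$, $0\le i\le j\wedge(m-2)$ with $i\not\equiv j-(m-1)\pmod m$, and $0\le L<2m$, put $$\partial^j_i(f)=\sum_{0\le q\le\frac{j-i}{m}}\frac{\binom{j}{i+qm}\binom{\frac{(m-1)-i}{m}-1}{q}}{\binom{\frac{(j-i)-(m-1)}{m}}{q}}\,\frac{\partial^j f}{\partial\omega^{i+qm}\partial\overline\omega^{\,j-i-qm}}(0),$$ $$\mathscr C^j_L(f)=\sum_{\substack{0\le i\le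 j\wedge(m-2)\\ i\not\equiv j-(m-1)\ (\mathrm{mod}\ m)}}e^{\frac{\pi\iota}{m}L(2i-j)}\,\mathfrak B\Big(\tfrac{(m-1)-i}{m},\tfrac{(m-1)-(j-i)}{m}\Big)\partial^j_i(f),$$ where $\mathfrak B(x,y)=\frac{\pi e^{\iota\frac\pi2(y-x)}}{2^{x+y-2}}\frac{\Gamma(x+y-1)}{\Gamma(x)\Gamma(y)}$ with the convention $\Gamma(-q)=(-1)^q/q!$ for integers $q\ge0$. Let $$\mathfrak o(j)=\frac{j-(m-2)}{m},\qquad n=\lceil\mathfrak o(k)\rceil,\qquad b=n-\mathfrak o(k)\in[0,1),$$ and use the convention $\binom{0}{N}=\frac{(-1)^{N-1}}{N}$, $N\ge1$, for the binomial coefficient $\binom{b}{n+1}$ with $b=0$ in (1) below. *Spaces.* $C^{n+P_b}(J)$ is the set of $\varphi\in C^{n+1}(J)$ such that $p=\sup_{s\in J}|s|^{1+b}|D^{n+1}\varphi(s)|<\infty$ and $\lim_{s\to0,\,s\in J}|s|^{1+b}D^{n+1}\varphi(s)$ exists, with the norm $\sum_{i=0}^n\|D^i\varphi\|_{L^1(J)}+p$.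 Let $\eta(x)=-x\log x$ for $0\le x\le e^{-1}$ and $\eta(x)=e^{-1}$ for $x\ge e^{-1}$. For real non-integer $r>0$ (resp. $r=q+\eta$ with an integer $q\ge0$), $C^r(J)$ is the set of $\varphi\in C^{\lfloor r\rfloor}(J)$ whose $\lfloor r\rfloor$-th derivative is Hölder with exponent $r-\lfloor r\rfloor$ (resp. of $\varphi\in C^q(J)$ whose $q$-th derivative has a multiple of $\eta$ as a modulus of continuity), normed by the sum of the $L^1$-norms of the derivatives up to that order and the Hölder (resp. $\eta$-) seminorm of the highest one. Put $v(r)=r$, resp. $v(q+\eta)=q+1$. Let $\mathfrak e(k)=\mathfrak o(k)$ if $\mathfrak o(k)\notin\mathbb Z$ and $\mathfrak e(k)=(\mathfrak o(k)-1)+\eta$ if $\mathfrak o(k)\in\mathbb Z$. **Theorem.** Let $K=k\vee(n+1)$. 1. There is $C>0$, independent of $f$, such that for every $f\in C^{K}(\mathcal D)$ with $\mathscr C^j_{2l+\epsilon}(f)=0$ for all $0\le j<k$ we have $\varphi_{f,l}\in C^{n+P_b}(J)$, $$\lim_{s\to0,\ s\in J}|s|^{b+1}D^{n+1}\varphi_{f,l}(s)=(-1)^{(1-\epsilon)(n+1)}\frac{(n+1)!}{k!}\binom{b}{n+1}\mathscr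 C^k_{2l+\epsilon}(f)$$ and $\|\varphi_{f,l}\|_{C^{n+P_b}(J)}\le C\|f\|_{C^{K}(\mathcal D)}$. 2. If moreover $k\ge m-1$, then there is $C>0$, independent of $f$, such that for every such $f$ we have $\varphi_{f,l}\in C^{\mathfrak e(k)}(J)$ and $\|\varphi_{f,l}\|_{C^{\mathfrak e(k)}(J)}\le C\|f\|_{C^{K}(\mathcal D)}$. 3. Conversely, if $f\in C^{K}(\mathcal D)$ and $\varphi_{f,l}\in C^r(J)$ for some exponent $r$ (a non-integer real, or $q+\eta$) with $0<v(r)\le\mathfrak o(k)$, then $\mathscr C^j_{2l+\epsilon}(f)=0$ for all $j\ge0$ with $\mathfrak o(j)<v(r)$. -/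

import Mathlib

open scoped ENNReal NNReal Topology Nat

namespace SaddleSector

noncomputable section

/-! ### The local model at a saddle of multiplicity `m` -/

/-- The argument of `z`, normalised to lie in `[0, 2π)`. -/
def arg0 (z : ℂ) : ℝ := if 0 ≤ z.arg then z.arg else z.arg + 2 * Real.pi

/-- The principal `n`-th root of unity `e^{2πi/n}`. -/
def rootOfUnity (n : ℕ) : ℂ := Complex.exp (2 * Real.pi * Complex.I / n)

/-- `G_0(r e^{it}) = r^{1/m} e^{it/m}` for `t ∈ [0, 2π)`. -/
def G0 (m : ℕ) (z : ℂ) : ℂ :=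
  ((‖z‖ ^ (1 / (m : ℝ)) : ℝ) : ℂ) * Complex.exp (Complex.I * ((arg0 z / m : ℝ) : ℂ))

/-- The `l`-th branch of the `m`-th root, `G_l = θ^l G_0` with `θ = e^{2πi/m}`. -/
def G (m l : ℕ) (z : ℂ) : ℂ := rootOfUnity m ^ l * G0 m z

/-- The pre-image of the square `[-1,1] × [-1,1]` by `ω ↦ ω ^ m`. -/
def D (m : ℕ) : Set ℂ := {ω | |(ω ^ m).re| ≤ 1 ∧ |(ω ^ m).im| ≤ 1}

/-- `φ_{f,l}(s) = ∫_{-1}^{1} f(G_l(u + i s)) / (u² + s²)^{(m-1)/m} du`. -/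
def phi (m l : ℕ) (f : ℂ → ℂ) (s : ℝ) : ℂ :=
  ∫ u in (-1 : ℝ)..1,
    f (G m l ((u : ℂ) + (s : ℂ) * Complex.I)) /
      (((u ^ 2 + s ^ 2) ^ (((m : ℝ) - 1) / m) : ℝ) : ℂ)

/-- The half-interval `(0, (-1)^ε]`: it is `(0, 1]` for `ε = 0` and `[-1, 0)` for `ε = 1`. -/
def half (ε : Fin 2) : Set ℝ := if ε = 0 then Set.Ioc 0 1 else Set.Ico (-1) 0

/-! ### The functionals `∂^k_j` and `𝒞^k_l` -/

/-- The Wirtinger derivative `∂/∂ω = (∂/∂x - i ∂/∂y) / 2`. -/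
def dz (f : ℂ → ℂ) (w : ℂ) : ℂ :=
  (fderiv ℝ f w 1 - Complex.I * fderiv ℝ f w Complex.I) / 2

/-- The Wirtinger derivative `∂/∂ω̄ = (∂/∂x + i ∂/∂y) / 2`. -/
def dzbar (f : ℂ → ℂ) (w : ℂ) : ℂ :=
  (fderiv ℝ f w 1 + Complex.I * fderiv ℝ f w Complex.I) / 2

/-- `∂^{p+q} f / ∂ω^p ∂ω̄^q` at the origin. -/
def wirtingerAtZero (p q : ℕ) (f : ℂ → ℂ) : ℂ := (dz^[p] (dzbar^[q] f)) 0

/-- The functional `∂^k_j`. -/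
def partialFunctional (m k j : ℕ) (f : ℂ → ℂ) : ℂ :=
  ∑ n ∈ Finset.range ((k - j) / m + 1),
    (((k.choose (j + n * m) : ℝ) * Ring.choose ((((m : ℝ) - 1) - j) / m - 1) n /
        Ring.choose ((((k : ℝ) - j) - ((m : ℝ) - 1)) / m) n : ℝ) : ℂ) *
      wirtingerAtZero (j + n * m) (k - j - n * m) f

/-- The Gamma function, with the convention `Γ(-q) = 1 / ((-1)(-2)⋯(-q)) = (-1)^q / q!` at the
non-positive integers. -/
def extGamma (x : ℝ) : ℝ :=
  open Classical in
  if ∃ q : ℕ, x = -(q : ℝ) then (-1) ^ ⌊-x⌋₊ / (⌊-x⌋₊ ! : ℝ) else Real.Gamma x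

/-- The beta-like function
`𝔅(x,y) = π e^{iπ(y-x)/2} / 2^{x+y-2} · Γ(x+y-1) / (Γ(x) Γ(y))`, which is set to be `0` if `x` or
`y` is a non-positive integer. -/
def betaLike (x y : ℝ) : ℂ :=
  open Classical in
  if (∃ q : ℕ, x = -(q : ℝ)) ∨ (∃ q : ℕ, y = -(q : ℝ)) then 0
  else
    ((Real.pi / (2 : ℝ) ^ (x + y - 2) : ℝ) : ℂ) *
      Complex.exp (Complex.I * ((Real.pi / 2 * (y - x) : ℝ) : ℂ)) *
      ((extGamma (x + y - 1) / (extGamma x * extGamma y) : ℝ) : ℂ)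

/-- The functional `𝒞^k_L`, `0 ≤ L < 2m`. The powers are those of `θ_0 = e^{2πi/(2m)}`. -/
def Cfun (m k L : ℕ) (f : ℂ → ℂ) : ℂ :=
  ∑ j ∈ (Finset.range (min k (m - 2) + 1)).filter
      (fun j : ℕ => ¬ (j : ℤ) ≡ (k : ℤ) - ((m : ℤ) - 1) [ZMOD (m : ℤ)]),
    rootOfUnity (2 * m) ^ ((L : ℤ) * (2 * (j : ℤ) - (k : ℤ))) *
      betaLike ((((m : ℝ) - 1) - j) / m) ((((m : ℝ) - 1) - ((k : ℝ) - j)) / m) *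
      partialFunctional m k j f

/-! ### Orders, exponents -/

/-- The order `𝔬(σ,k) = (k - (m-2)) / m`. -/
def ord (m k : ℕ) : ℝ := ((k : ℝ) - ((m : ℝ) - 2)) / m

/-- `n = ⌈𝔬(σ,k)⌉`, which is non-negative since `𝔬(σ,k) > -1`. -/
def nIdx (m k : ℕ) : ℕ := ⌈ord m k⌉₊

/-- `b = n - 𝔬(σ,k) ∈ [0,1)`. -/
def bIdx (m k : ℕ) : ℝ := nIdx m k - ord m k

/-- `binom(x, N)`, with the convention `binom(0, N) = lim_{x → 0} binom(x, N) / x = (-1)^{N-1} / N`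
(for `N ≥ 1`). -/
def binomConv (x : ℝ) (N : ℕ) : ℝ :=
  open Classical in
  if x = 0 then (-1) ^ (N - 1) / (N : ℝ) else Ring.choose x N

/-- Formal regularity exponents: a real number `r`, or `n + η`. -/
inductive RegExp where
  | holder (r : ℝ)
  | eta (n : ℤ)

/-- The exponents that belong to `ℝ_η = (ℝ_{>-1} ∖ ℤ) ∪ (ℤ_{≥-1} + η)`. -/
def RegExp.InReta : RegExp → Prop
  | .holder r => -1 < r ∧ ∀ z : ℤ, r ≠ z
  | .eta n => -1 ≤ n

/-- `v(r) = r` and `v(n + η) = n + 1`. -/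
def RegExp.v : RegExp → ℝ
  | .holder r => r
  | .eta n => n + 1

/-- The exponent `𝔢(σ,k)`, equal to `(k-(m-2))/m` if this is not an integer, and to
`(k-2(m-1))/m + η` otherwise (the integer division below is then exact). -/
def expo (m k : ℕ) : RegExp :=
  if (m : ℤ) ∣ (k : ℤ) - ((m : ℤ) - 2) then .eta (((k : ℤ) - 2 * ((m : ℤ) - 1)) / (m : ℤ))
  else .holder (ord m k)

/-! ### Function spaces -/

/-- `η(x) = -x log x` on `[0, e⁻¹]` and `η(x) = e⁻¹` for `x ≥ e⁻¹`. -/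
def etaFun (x : ℝ) : ℝ := if x ≤ Real.exp (-1) then -x * Real.log x else Real.exp (-1)

/-- The number of classical derivatives in `C^r` (used for `v(r) > 0` only). -/
def RegExp.order : RegExp → ℕ
  | .holder r => ⌊r⌋₊
  | .eta n => n.toNat

/-- The modulus of continuity of the highest derivative in `C^r`. -/
def RegExp.modulus : RegExp → ℝ → ℝ
  | .holder r => fun t => t ^ Int.fract r
  | .eta _ => etaFun

/-- The sum of the `L¹(J)`-norms of the derivatives of order `0, …, p`. -/
def sumL1 (J : Set ℝ) (p : ℕ) (g : ℝ → ℂ) : ℝ≥0∞ :=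
  ∑ i ∈ Finset.range (p + 1), ∫⁻ s in J, ‖iteratedDerivWithin i g J s‖ₑ

/-- The seminorm `sup { |g(x) - g(y)| / ω(|x - y|) : x, y ∈ J, x ≠ y }`. -/
def modSeminorm (J : Set ℝ) (ω : ℝ → ℝ) (g : ℝ → ℂ) : ℝ≥0∞ :=
  ⨆ x ∈ J, ⨆ y ∈ J, ⨆ _ : x ≠ y, ENNReal.ofReal (‖g x - g y‖ / ω |x - y|)

/-- `g ∈ C^r(J)` for an interval `J` and `v(r) > 0`. -/
def MemCr (J : Set ℝ) (r : RegExp) (g : ℝ → ℂ) : Prop :=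
  ContDiffOn ℝ r.order g J ∧ modSeminorm J r.modulus (iteratedDerivWithin r.order g J) < ∞

/-- The norm of `C^r(J)`. -/
def normCr (J : Set ℝ) (r : RegExp) (g : ℝ → ℂ) : ℝ≥0∞ :=
  sumL1 J r.order g + modSeminorm J r.modulus (iteratedDerivWithin r.order g J)

/-- `sup { |s|^{1+b} |D^{n+1} g(s)| : s ∈ J }`. -/
def pSeminorm (J : Set ℝ) (n : ℕ) (b : ℝ) (g : ℝ → ℂ) : ℝ≥0∞ :=
  ⨆ s ∈ J, ENNReal.ofReal (|s| ^ (1 + b) * ‖iteratedDerivWithin (n + 1) g J s‖)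

/-- `g ∈ C^{n+P_b}(J)`, for a half-interval `J` whose open end is at the origin. -/
def MemCP (J : Set ℝ) (n : ℕ) (b : ℝ) (g : ℝ → ℂ) : Prop :=
  ContDiffOn ℝ (n + 1 : ℕ) g J ∧ pSeminorm J n b g < ∞ ∧
    ∃ c : ℂ, Filter.Tendsto
      (fun s : ℝ => ((|s| ^ (1 + b) : ℝ) : ℂ) * iteratedDerivWithin (n + 1) g J s) (𝓝[J] 0) (𝓝 c)

/-- The norm of `C^{n+P_b}(J)`. -/
def normCP (J : Set ℝ) (n : ℕ) (b : ℝ) (g : ℝ → ℂ) : ℝ≥0∞ :=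
  sumL1 J n g + pSeminorm J n b g

/-- The norm of `C^K(𝒟)`. -/
def normCD (m K : ℕ) (f : ℂ → ℂ) : ℝ≥0∞ :=
  ∑ i ∈ Finset.range (K + 1), ⨆ ω ∈ D m, ‖iteratedFDerivWithin ℝ i f (D m) ω‖ₑ

end

end SaddleSector

open SaddleSector

namespace SaddleSector

/-! ### The domain -/

/-! Rotating by a power of e^{πi/m}, with the substitution u ↦ -u when ε = 1, turns every branch and
both half-intervals into a single integral on (0, 1], namely `phi0`: the integral over u ∈ [-1, 1]
of ω^{1-m} ω̄^{1-m} g(ω), where ω = (u + is)^{1/m} is the principal root (`phi_eq_phi0`). A rotation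
multiplies ∂^p ∂̄^q at 0 by a power of the unimodular factor with exponent p - q, and this absorbs
the index L of the functional (`Cfun_comp_turn`), so only L = 0 has to be studied.

The integrals `Phi m a b R` of ω^a ω̄^b R(ω) are stable under d/ds, and each derivative lowers the
total degree by m (`hasDerivWithinAt_Phi`). Since ω is homogeneous of degree 1/m in (u, s), an
integrand of degree E < -m is integrable over the whole line, and scaling makes its full integral a
multiple of s^{E/m+1}, while the tails |u| ≥ 1 stay bounded. With N = n + 1 derivatives every Taylor
monomial of degree at most k falls in this range. For a monomial, the coefficient of the power of s
is Cauchy's beta integral of (1-iu)^{-x} (1+iu)^{-y}. It is computed by Parseval for two Gamma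
densities and extended by a recurrence (`cauchyBeta_eq`); `leadCoeff_succ` carries the formula
through the derivatives.

The factors 1/Γ(x) and 1/Γ(y) vanish exactly at the residues missing from the functional. Writing p
= i + qm groups the remaining monomials of degree j, and the shift rules of 1/Γ produce the
generalised binomials. The degree-j part of the N-th derivative is thus `gaugeFactor` times the j-th
functional times s^{𝔬(j)-N}, up to O(1) (`sum_leadTerm`, `norm_tay_part_sub_le`). The Taylor
remainder is controlled by the oscillation of the derivatives of order k at 0 alone, so no
derivative of order k + 1 is used (`norm_rem_le`, `jetBound_rem`). Together these give
`norm_iteratedDerivWithin_phi0_sub_le`: if the functionals of order less than k vanish, the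
derivative of order n + 1 is asymptotic to a multiple of s^{-(1+b)}, and `gaugeFactor_eq` identifies
the multiple.

The first assertion follows by integrating this bound down from s = 1 for the L¹ norms. The second
follows by integrating it twice: the primitives are powers when b > 0, and give t log t when b = 0.
For the converse, strong induction on j makes all lower functionals vanish, so the derivative of
order n + 1, with n and b now those of j, has a limit proportional to the j-th functional by a
non-zero factor. A non-zero limit would force first or second differences over [s, 3s] larger than
the modulus of C^r permits, or contradict the boundedness of that derivative
(`limit_eq_zero_of_memCr`). -/

lemma isClosed_D (m : ℕ) : IsClosed (D m) := by
  have h : D m = {ω : ℂ | |(ω ^ m).re| ≤ 1} ∩ {ω : ℂ | |(ω ^ m).im| ≤ 1} := rfl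
  rw [h]
  exact (isClosed_le (by fun_prop) (by fun_prop)).inter (isClosed_le (by fun_prop) (by fun_prop))

lemma norm_le_two_of_mem_D {m : ℕ} (hm : 1 ≤ m) {ω : ℂ} (h : ω ∈ D m) : ‖ω‖ ≤ 2 := by
  by_contra! h2
  have h3 : ‖ω‖ ^ 1 ≤ ‖ω‖ ^ m := pow_le_pow_right₀ (by linarith) hm
  have h4 : ‖ω ^ m‖ ≤ |(ω ^ m).re| + |(ω ^ m).im| := Complex.norm_le_abs_re_add_abs_im _
  rw [norm_pow] at h4
  have := h.1
  have := h.2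
  linarith

lemma isCompact_D {m : ℕ} (hm : 1 ≤ m) : IsCompact (D m) :=
  Metric.isCompact_of_isClosed_isBounded (isClosed_D m)
    ((Metric.isBounded_closedBall (x := (0 : ℂ)) (r := 2)).subset fun ω h => by
      simpa using norm_le_two_of_mem_D hm h)

lemma D_mem_nhds_zero {m : ℕ} (hm : 1 ≤ m) : D m ∈ 𝓝 (0 : ℂ) := by
  have h1 : ContinuousAt (fun ω : ℂ => |(ω ^ m).re|) 0 := by fun_prop
  have h2 : ContinuousAt (fun ω : ℂ => |(ω ^ m).im|) 0 := by fun_prop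
  have hm' : m ≠ 0 := by omega
  have e1 := h1.eventually_lt (continuousAt_const (y := (1 : ℝ))) (by simp [hm'])
  have e2 := h2.eventually_lt (continuousAt_const (y := (1 : ℝ))) (by simp [hm'])
  filter_upwards [e1, e2] with ω w1 w2 using ⟨w1.le, w2.le⟩

lemma zero_mem_D {m : ℕ} (hm : 1 ≤ m) : (0 : ℂ) ∈ D m := mem_of_mem_nhds (D_mem_nhds_zero hm)

lemma smul_mem_D {m : ℕ} {ω : ℂ} (h : ω ∈ D m) {t : ℝ} (h0 : 0 ≤ t) (h1 : t ≤ 1) :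
    (t : ℂ) * ω ∈ D m := by
  have ht : t ^ m ≤ 1 := pow_le_one₀ h0 h1
  have ht0 : 0 ≤ t ^ m := by positivity
  have hr : ((t : ℂ) * ω) ^ m = ((t ^ m : ℝ) : ℂ) * ω ^ m := by push_cast; ring
  constructor
  · rw [hr, Complex.re_ofReal_mul, abs_mul, abs_of_nonneg ht0]
    exact mul_le_one₀ ht (abs_nonneg _) h.1
  · rw [hr, Complex.im_ofReal_mul, abs_mul, abs_of_nonneg ht0]
    exact mul_le_one₀ ht (abs_nonneg _) h.2

/-- The closed square `[-1,1]²`. -/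
def square : Set ℂ := {z | |z.re| ≤ 1 ∧ |z.im| ≤ 1}

lemma square_eq : square = Set.Icc (-1 : ℝ) 1 ×ℂ Set.Icc (-1 : ℝ) 1 := by
  ext z; simp [square, Complex.mem_reProdIm, abs_le]

lemma uniqueDiffOn_square : UniqueDiffOn ℝ square := by
  have hc : Convex ℝ square := by
    rw [square_eq]; exact ((convex_Icc (-1 : ℝ) 1).linear_preimage Complex.reLm).inter
      ((convex_Icc (-1 : ℝ) 1).linear_preimage Complex.imLm)
  refine uniqueDiffOn_convex hc ⟨0, ?_⟩
  rw [square_eq, Complex.interior_reProdIm, interior_Icc]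
  simp [Complex.mem_reProdIm]

/-- Away from 0, a branch of the m-th root centred at ω sends the square into `D m` with surjective
derivative at ω ^ m, so unique differentiability passes from the convex square to `D m`. At 0 the
set is a neighbourhood. -/
lemma uniqueDiffOn_D {m : ℕ} (hm : 1 ≤ m) : UniqueDiffOn ℝ (D m) := by
  have hm' : m ≠ 0 := by omega
  intro ω hω
  by_cases h0 : ω = 0
  · subst h0
    exact uniqueDiffWithinAt_of_mem_nhds (D_mem_nhds_zero hm)
  have hz : ω ^ m ≠ 0 := pow_ne_zero _ h0
  set h : ℂ → ℂ := fun z => ω * (z / ω ^ m) ^ ((m : ℂ)⁻¹) with hh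
  have hval : h (ω ^ m) = ω := by simp [hh, hz]
  have hpow : ∀ z, h z ^ m = z := by
    intro z
    simp only [hh, mul_pow]
    rw [Complex.cpow_nat_inv_pow _ hm']
    field_simp
  have hd : HasDerivAt h (ω * ((m : ℂ)⁻¹ * (1 / ω ^ m))) (ω ^ m) := by
    have h1 : HasDerivAt (fun z : ℂ => z / ω ^ m) (1 / ω ^ m) (ω ^ m) :=
      (hasDerivAt_id _).div_const _
    have h2 := (h1.cpow_const (c := (m : ℂ)⁻¹) (by simp [hz])).const_mul ω
    refine h2.congr_deriv ?_
    simp [hz]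
  have hF := (hd.hasFDerivAt.restrictScalars ℝ).hasFDerivWithinAt (s := square)
  have hu := hF.uniqueDiffWithinAt (uniqueDiffOn_square _ hω) ?_
  · rw [hval] at hu
    refine hu.mono ?_
    rintro _ ⟨z, hz, rfl⟩
    change h z ^ m ∈ square
    rwa [hpow]
  · refine Function.Surjective.denseRange fun w => ?_
    have hne : ω * ((m : ℂ)⁻¹ * (1 / ω ^ m)) ≠ 0 := by
      have : (m : ℂ) ≠ 0 := by exact_mod_cast hm'
      simp [h0, this]
    refine ⟨w / (ω * ((m : ℂ)⁻¹ * (1 / ω ^ m))), ?_⟩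
    simp only [ContinuousLinearMap.coe_restrictScalars',
      ContinuousLinearMap.toSpanSingleton_apply, smul_eq_mul]
    field_simp

/-! ### The branch of the root on the upper half-plane -/

/-- The curve `s ↦ (u + i s)^{1/m}`. -/
noncomputable def om (m : ℕ) (u s : ℝ) : ℂ := ((u : ℂ) + s * Complex.I) ^ ((m : ℂ)⁻¹)

lemma add_mul_I_mem_slitPlane (u : ℝ) {s : ℝ} (hs : 0 < s) :
    (u : ℂ) + s * Complex.I ∈ Complex.slitPlane := by
  right; simp [hs.ne']

lemma add_mul_I_ne_zero (u : ℝ) {s : ℝ} (hs : 0 < s) : (u : ℂ) + s * Complex.I ≠ 0 :=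
  Complex.slitPlane_ne_zero (add_mul_I_mem_slitPlane u hs)

lemma om_pow {m : ℕ} (hm : 1 ≤ m) (u s : ℝ) : om m u s ^ m = (u : ℂ) + s * Complex.I :=
  Complex.cpow_nat_inv_pow _ (by omega)

lemma om_ne_zero {m : ℕ} (u : ℝ) {s : ℝ} (hs : 0 < s) : om m u s ≠ 0 := by
  rw [om, Complex.cpow_def_of_ne_zero (add_mul_I_ne_zero u hs)]
  exact Complex.exp_ne_zero _

lemma om_mem_D {m : ℕ} (hm : 1 ≤ m) {u s : ℝ} (hu : |u| ≤ 1) (hs : |s| ≤ 1) : om m u s ∈ D m := by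
  change om m u s ^ m ∈ square
  rw [om_pow hm]
  simpa [square] using ⟨hu, hs⟩

lemma norm_om (m : ℕ) (u s : ℝ) :
    ‖om m u s‖ = ‖(u : ℂ) + s * Complex.I‖ ^ ((m : ℝ)⁻¹) := by
  have := Complex.norm_cpow_real ((u : ℂ) + s * Complex.I) ((m : ℝ)⁻¹)
  rw [← this, om]; push_cast; rfl

lemma norm_add_mul_I (u s : ℝ) : ‖(u : ℂ) + s * Complex.I‖ = (u ^ 2 + s ^ 2) ^ ((1 : ℝ) / 2) := by
  rw [Complex.norm_add_mul_I, Real.sqrt_eq_rpow]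

/-- Writing the derivative as an integer power of ω keeps all later integrands Laurent monomials in
ω and ω̄. -/
lemma hasDerivAt_om {m : ℕ} (hm : 1 ≤ m) (u : ℝ) {s : ℝ} (hs : 0 < s) :
    HasDerivAt (fun s => om m u s) (Complex.I / m * om m u s ^ (1 - m : ℤ)) s := by
  have hz := add_mul_I_ne_zero u hs
  have hm0 : (m : ℂ) ≠ 0 := by exact_mod_cast (by omega : m ≠ 0)
  have h1 : HasDerivAt (fun s : ℝ => (u : ℂ) + s * Complex.I) (1 * Complex.I) s :=
    ((Complex.ofRealCLM.hasDerivAt (x := s)).mul_const Complex.I).const_add _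
  have h2 := (Complex.hasStrictDerivAt_cpow_const (c := (m : ℂ)⁻¹)
    (add_mul_I_mem_slitPlane u hs)).hasDerivAt
  have h3 := h2.comp s h1
  refine h3.congr_deriv ?_
  have h4 : om m u s ^ (1 - m : ℤ) = om m u s / ((u : ℂ) + s * Complex.I) := by
    rw [zpow_sub₀ (om_ne_zero u hs), zpow_one, zpow_natCast, om_pow hm]
  rw [h4, om, Complex.cpow_sub _ _ hz, Complex.cpow_one]
  field_simp

lemma hasDerivAt_conj_om {m : ℕ} (hm : 1 ≤ m) (u : ℝ) {s : ℝ} (hs : 0 < s) :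
    HasDerivAt (fun s => (starRingEnd ℂ) (om m u s))
      (-Complex.I / m * (starRingEnd ℂ) (om m u s) ^ (1 - m : ℤ)) s := by
  have h := (hasDerivAt_om hm u hs).star
  refine h.congr_deriv ?_
  simp

lemma continuous_om (m : ℕ) {s : ℝ} (hs : 0 < s) : Continuous (fun u => om m u s) := by
  rw [continuous_iff_continuousAt]
  intro u
  have h2 := (Complex.hasStrictDerivAt_cpow_const (c := (m : ℂ)⁻¹)
    (add_mul_I_mem_slitPlane u hs)).hasDerivAt.continuousAt
  exact ContinuousAt.comp (f := fun u : ℝ => (u : ℂ) + s * Complex.I) h2 (by fun_prop)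

/-- Positive scaling does not change the argument, so the principal root is homogeneous of degree
1/m. Every power of s in the estimates comes from here. -/
lemma om_mul (m : ℕ) {s : ℝ} (hs : 0 < s) (u t : ℝ) :
    om m (s * u) (s * t) = ((s ^ ((m : ℝ)⁻¹) : ℝ) : ℂ) * om m u t := by
  have : ((s * u : ℝ) : ℂ) + (s * t : ℝ) * Complex.I = (s : ℂ) * (u + t * Complex.I) := by
    push_cast; ring
  rw [om, this, Complex.ofReal_cpow hs.le, om]
  by_cases hz : (u : ℂ) + t * Complex.I = 0
  · by_cases hm : m = 0
    · simp [hm]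
    · simp [hz, hm]
  · have hs' : (s : ℂ) ≠ 0 := by exact_mod_cast hs.ne'
    rw [Complex.cpow_def_of_ne_zero (mul_ne_zero hs' hz), Complex.log_ofReal_mul hs hz,
      Complex.cpow_def_of_ne_zero hs', Complex.cpow_def_of_ne_zero hz, ← Complex.exp_add,
      Complex.ofReal_log hs.le]
    push_cast
    ring_nf


/-! ### Wirtinger derivatives within the domain -/

/-- The sign of `i` in the two Wirtinger derivatives: `true` stands for `∂/∂ω`, `false` for
`∂/∂ω̄`. -/
def sgn (c : Bool) : ℂ := if c then -1 else 1

/-- The Wirtinger coefficients of a real-linear map. -/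
noncomputable def wc (c : Bool) : (ℂ →L[ℝ] ℂ) →L[ℝ] ℂ :=
  (2⁻¹ : ℂ) • (ContinuousLinearMap.apply ℝ ℂ (1 : ℂ) +
    (sgn c * Complex.I) • ContinuousLinearMap.apply ℝ ℂ Complex.I)

lemma wc_apply (c : Bool) (A : ℂ →L[ℝ] ℂ) :
    wc c A = 2⁻¹ * (A 1 + sgn c * Complex.I * A Complex.I) := by
  simp [wc, mul_add]

lemma norm_sgn (c : Bool) : ‖sgn c‖ = 1 := by cases c <;> simp [sgn]

lemma norm_wc_le (c : Bool) : ‖wc c‖ ≤ 1 := by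
  refine ContinuousLinearMap.opNorm_le_bound _ zero_le_one fun A => ?_
  rw [wc_apply, norm_mul, one_mul]
  have h1 : ‖A 1‖ ≤ ‖A‖ := by simpa using A.le_opNorm 1
  have h2 : ‖A Complex.I‖ ≤ ‖A‖ := by simpa using A.le_opNorm Complex.I
  have h3 := norm_add_le (A 1) (sgn c * Complex.I * A Complex.I)
  have h4 : ‖sgn c * Complex.I * A Complex.I‖ = ‖A Complex.I‖ := by simp [norm_sgn]
  have h5 : ‖(2⁻¹ : ℂ)‖ = 2⁻¹ := by simp
  rw [h5]
  linarith

lemma wc_smul (c : Bool) (a : ℂ) (A : ℂ →L[ℝ] ℂ) : wc c (a • A) = a * wc c A := by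
  simp only [wc_apply, smul_apply, smul_eq_mul]; ring

lemma clm_apply_eq_wc (A : ℂ →L[ℝ] ℂ) (v : ℂ) :
    A v = wc true A * v + wc false A * (starRingEnd ℂ) v := by
  have h : A v = v.re * A 1 + v.im * A Complex.I := by
    conv_lhs => rw [show v = v.re • (1 : ℂ) + v.im • Complex.I by
      simp [Complex.re_add_im]]
    rw [map_add, map_smul, map_smul]
    simp
  rw [h, wc_apply, wc_apply]
  have h2 : (starRingEnd ℂ) v = v.re - v.im * Complex.I := by
    apply Complex.ext <;> simp
  rw [h2]
  have hv := (Complex.re_add_im v).symm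
  have hI := Complex.I_sq
  simp only [sgn, if_true, Bool.false_eq_true, if_false]
  linear_combination (v.im * A Complex.I : ℂ) * hI -
    (2⁻¹ * (A 1 + -1 * Complex.I * A Complex.I)) * hv

lemma norm_clm_le_wc (A : ℂ →L[ℝ] ℂ) : ‖A‖ ≤ ‖wc true A‖ + ‖wc false A‖ := by
  refine ContinuousLinearMap.opNorm_le_bound _ (by positivity) fun v => ?_
  rw [clm_apply_eq_wc]
  refine (norm_add_le _ _).trans (le_of_eq ?_)
  simp [add_mul]

/-- The Wirtinger derivatives within `D m`. -/
noncomputable def dd (m : ℕ) (c : Bool) (h : ℂ → ℂ) (ω : ℂ) : ℂ := wc c (fderivWithin ℝ h (D m) ω)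

/-- Iterated Wirtinger derivatives along a word; the head of the word is applied first. -/
noncomputable def wd (m : ℕ) : List Bool → (ℂ → ℂ) → ℂ → ℂ
  | [], h => h
  | c :: w, h => wd m w (dd m c h)

lemma dd_congr {m : ℕ} {f g : ℂ → ℂ} (h : Set.EqOn f g (D m)) (c : Bool) :
    Set.EqOn (dd m c f) (dd m c g) (D m) := by
  intro ω hω
  simp only [dd]
  rw [fderivWithin_congr h (h hω)]

lemma wd_congr {m : ℕ} {f g : ℂ → ℂ} (h : Set.EqOn f g (D m)) (w : List Bool) :
    Set.EqOn (wd m w f) (wd m w g) (D m) := by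
  induction w generalizing f g with
  | nil => exact h
  | cons c w ih => exact ih (dd_congr h c)

lemma contDiffOn_dd {m : ℕ} (hm : 1 ≤ m) {n : ℕ} {h : ℂ → ℂ}
    (hh : ContDiffOn ℝ (n + 1 : ℕ) h (D m)) (c : Bool) : ContDiffOn ℝ n (dd m c h) (D m) :=
  (wc c).contDiff.comp_contDiffOn
    (hh.fderivWithin (uniqueDiffOn_D hm) (by norm_cast))

lemma contDiffOn_wd {m : ℕ} (hm : 1 ≤ m) (w : List Bool) {n : ℕ} {h : ℂ → ℂ}
    (hh : ContDiffOn ℝ (n + w.length : ℕ) h (D m)) : ContDiffOn ℝ n (wd m w h) (D m) := by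
  induction w generalizing h with
  | nil => exact hh
  | cons c w ih => exact ih (contDiffOn_dd hm (by simpa [add_assoc] using hh) c)

/-- Extracting a Wirtinger coefficient is a contraction on real-linear maps, so each letter of the
word trades one order of derivative without enlarging the bound. -/
lemma norm_wd_le {m : ℕ} (hm : 1 ≤ m) (w : List Bool) {N : ℕ} {h : ℂ → ℂ}
    (hh : ContDiffOn ℝ N h (D m)) {M : ℝ}
    (hM : ∀ i ≤ N, ∀ ω ∈ D m, ‖iteratedFDerivWithin ℝ i h (D m) ω‖ ≤ M) (hw : w.length ≤ N)
    {ω : ℂ} (hω : ω ∈ D m) : ‖wd m w h ω‖ ≤ M := by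
  induction w generalizing h N with
  | nil => simpa [wd] using hM 0 (Nat.zero_le _) ω hω
  | cons c w ih =>
    obtain ⟨N, rfl⟩ : ∃ N', N = N' + 1 := ⟨N - 1, by simp at hw; omega⟩
    have hu := uniqueDiffOn_D hm
    refine ih (contDiffOn_dd hm hh c) (fun i hi z hz => ?_) (by simpa using hw)
    have hf : ContDiffOn ℝ N (fderivWithin ℝ h (D m)) (D m) := hh.fderivWithin hu (by norm_cast)
    have h1 := (wc c).norm_iteratedFDerivWithin_comp_left (hf z hz) hu hz
      (n := i) (by exact_mod_cast hi)
    rw [norm_iteratedFDerivWithin_fderivWithin hu hz] at h1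
    refine (h1.trans ?_).trans (hM (i + 1) (by omega) z hz)
    exact mul_le_of_le_one_left (norm_nonneg _) (norm_wc_le c)

/-- `D m` is star-shaped about 0 but in general not convex, so the mean value inequality is used
only on the segment from 0 to ω. Monotonicity of β bounds the derivative there by its majorant at
the endpoint. -/
lemma norm_sub_le_of_dd {m : ℕ} {h : ℂ → ℂ} (hh : DifferentiableOn ℝ h (D m)) {β : ℝ → ℝ}
    (hβ : MonotoneOn β (Set.Ici 0)) (hb : ∀ c, ∀ ω ∈ D m, ‖dd m c h ω‖ ≤ β ‖ω‖) {ω : ℂ}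
    (hω : ω ∈ D m) : ‖h ω - h 0‖ ≤ 2 * β ‖ω‖ * ‖ω‖ := by
  have hseg : ∀ z ∈ segment ℝ 0 ω, z ∈ D m ∧ ‖z‖ ≤ ‖ω‖ := by
    intro z hz
    rw [segment_eq_image] at hz
    obtain ⟨t, ht, rfl⟩ := hz
    have : (1 - t) • (0 : ℂ) + t • ω = t * ω := by simp
    dsimp only
    rw [this]
    refine ⟨smul_mem_D hω ht.1 ht.2, ?_⟩
    rw [norm_mul, Complex.norm_real, Real.norm_of_nonneg ht.1]
    exact mul_le_of_le_one_left (norm_nonneg _) ht.2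
  have key := (convex_segment (𝕜 := ℝ) 0 ω).norm_image_sub_le_of_norm_hasFDerivWithin_le
    (f := h) (f' := fderivWithin ℝ h (D m)) (C := 2 * β ‖ω‖) ?_ ?_
    (left_mem_segment ℝ 0 ω) (right_mem_segment ℝ 0 ω)
  · simpa using key
  · intro z hz
    exact (hh z (hseg z hz).1).hasFDerivWithinAt.mono fun y hy => (hseg y hy).1
  · intro z hz
    have h1 := norm_clm_le_wc (fderivWithin ℝ h (D m) z)
    have h2 := hb true z (hseg z hz).1
    have h3 := hb false z (hseg z hz).1
    have h4 := hβ (norm_nonneg z) (norm_nonneg ω) (hseg z hz).2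
    simp only [dd] at h2 h3
    linarith

/-! ### Taylor expansion at the origin in Wirtinger derivatives -/

lemma dz_eq_wc (f : ℂ → ℂ) (w : ℂ) : dz f w = wc true (fderiv ℝ f w) := by
  simp only [dz, wc_apply, sgn, if_true]; ring

lemma dzbar_eq_wc (f : ℂ → ℂ) (w : ℂ) : dzbar f w = wc false (fderiv ℝ f w) := by
  simp only [dzbar, wc_apply, sgn]; simp; ring

lemma dz_congr {f g : ℂ → ℂ} {z : ℂ} (h : f =ᶠ[𝓝 z] g) : dz f =ᶠ[𝓝 z] dz g := by
  filter_upwards [h.fderiv (𝕜 := ℝ)] with w hw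
  rw [dz_eq_wc, dz_eq_wc, hw]

lemma dzbar_congr {f g : ℂ → ℂ} {z : ℂ} (h : f =ᶠ[𝓝 z] g) : dzbar f =ᶠ[𝓝 z] dzbar g := by
  filter_upwards [h.fderiv (𝕜 := ℝ)] with w hw
  rw [dzbar_eq_wc, dzbar_eq_wc, hw]

lemma iterate_dz_congr (p : ℕ) {f g : ℂ → ℂ} {z : ℂ} (h : f =ᶠ[𝓝 z] g) :
    dz^[p] f =ᶠ[𝓝 z] dz^[p] g := by
  induction p generalizing f g with
  | zero => exact h
  | succ p ih => exact ih (dz_congr h)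

lemma iterate_dzbar_congr (p : ℕ) {f g : ℂ → ℂ} {z : ℂ} (h : f =ᶠ[𝓝 z] g) :
    dzbar^[p] f =ᶠ[𝓝 z] dzbar^[p] g := by
  induction p generalizing f g with
  | zero => exact h
  | succ p ih => exact ih (dzbar_congr h)

lemma wirtingerAtZero_congr (p q : ℕ) {f g : ℂ → ℂ} (h : f =ᶠ[𝓝 0] g) :
    wirtingerAtZero p q f = wirtingerAtZero p q g :=
  (iterate_dz_congr p (iterate_dzbar_congr q h)).self_of_nhds

lemma contDiffAt_dzbar {n : ℕ} {f : ℂ → ℂ} {z : ℂ} (h : ContDiffAt ℝ (n + 1 : ℕ) f z) :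
    ContDiffAt ℝ n (dzbar f) z := by
  rw [show dzbar f = fun w => wc false (fderiv ℝ f w) from funext (dzbar_eq_wc f)]
  exact (wc false).contDiff.contDiffAt.comp z (h.fderiv_right (by norm_cast))

lemma dz_dzbar_comm {f : ℂ → ℂ} {z : ℂ} (h : ContDiffAt ℝ 2 f z) :
    dz (dzbar f) z = dzbar (dz f) z := by
  have hs : IsSymmSndFDerivAt ℝ f z := h.isSymmSndFDerivAt (by simp)
  have hd : DifferentiableAt ℝ (fderiv ℝ f) z :=
    (h.fderiv_right (m := 1) (by norm_num)).differentiableAt (by norm_num)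
  have h1 : ∀ c, fderiv ℝ (fun w => wc c (fderiv ℝ f w)) z =
      (wc c).comp (fderiv ℝ (fderiv ℝ f) z) := fun c =>
    ((wc c).hasFDerivAt.comp z hd.hasFDerivAt).fderiv
  rw [dz_eq_wc, dzbar_eq_wc, show dzbar f = fun w => wc false (fderiv ℝ f w) from
    funext (dzbar_eq_wc f), show dz f = fun w => wc true (fderiv ℝ f w) from funext (dz_eq_wc f),
    h1, h1]
  simp only [wc_apply, ContinuousLinearMap.comp_apply, sgn, if_true]
  rw [hs.eq Complex.I 1]
  simp
  ring

lemma dz_iterate_dzbar {q : ℕ} {f : ℂ → ℂ} {z : ℂ} (h : ContDiffAt ℝ (q + 1 : ℕ) f z) :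
    dz (dzbar^[q] f) =ᶠ[𝓝 z] dzbar^[q] (dz f) := by
  induction q generalizing f with
  | zero => rfl
  | succ q ih =>
    refine (ih (contDiffAt_dzbar h)).trans (iterate_dzbar_congr q ?_)
    have h2 : ContDiffAt ℝ 2 f z := h.of_le (by norm_cast; omega)
    filter_upwards [h2.eventually (by simp)] with w hw using dz_dzbar_comm hw

lemma dd_eventuallyEq_zero {m : ℕ} (hm : 1 ≤ m) (c : Bool) (h : ℂ → ℂ) :
    dd m c h =ᶠ[𝓝 0] fun w => wc c (fderiv ℝ h w) := by
  filter_upwards [eventually_mem_nhds_iff.2 (D_mem_nhds_zero hm)] with w hw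
  rw [dd, fderivWithin_of_mem_nhds hw]

/-- In `wirtingerAtZero` the ∂̄-derivatives act first, so making a ∂ act first needs symmetry of
second derivatives. The ∂̄ counterpart needs no commutation. -/
lemma wirtingerAtZero_succ_left {m : ℕ} (hm : 1 ≤ m) {p q : ℕ} {h : ℂ → ℂ}
    (hh : ContDiffOn ℝ (q + 1 : ℕ) h (D m)) :
    wirtingerAtZero (p + 1) q h = wirtingerAtZero p q (dd m true h) := by
  have e : dd m true h =ᶠ[𝓝 0] dz h :=
    (dd_eventuallyEq_zero hm true h).trans (Filter.Eventually.of_forall fun w => (dz_eq_wc h w).symm)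
  rw [wirtingerAtZero_congr p q e]
  exact (iterate_dz_congr p
    (dz_iterate_dzbar (hh.contDiffAt (D_mem_nhds_zero hm)))).self_of_nhds

lemma wirtingerAtZero_succ_right {m : ℕ} (hm : 1 ≤ m) {p q : ℕ} (h : ℂ → ℂ) :
    wirtingerAtZero p (q + 1) h = wirtingerAtZero p q (dd m false h) := by
  have e : dd m false h =ᶠ[𝓝 0] dzbar h :=
    (dd_eventuallyEq_zero hm false h).trans
      (Filter.Eventually.of_forall fun w => (dzbar_eq_wc h w).symm)
  rw [wirtingerAtZero_congr p q e]
  rfl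

/-- The homogeneous Taylor polynomial of degree `j` at the origin. -/
noncomputable def tay (j : ℕ) (h : ℂ → ℂ) (ω : ℂ) : ℂ :=
  ∑ p ∈ Finset.HasAntidiagonal.antidiagonal j,
    wirtingerAtZero p.1 p.2 h / (p.1 ! * p.2 !) * (ω ^ p.1 * (starRingEnd ℂ) ω ^ p.2)

/-- The difference of `h` and its Taylor polynomial of degree less than `k`. -/
noncomputable def rem (k : ℕ) (h : ℂ → ℂ) (ω : ℂ) : ℂ := h ω - ∑ j ∈ Finset.range k, tay j h ω

/-- The real-linear map with given Wirtinger coefficients. -/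
noncomputable def wl (a b : ℂ) : ℂ →L[ℝ] ℂ :=
  a • ContinuousLinearMap.id ℝ ℂ + b • (Complex.conjCLE : ℂ →L[ℝ] ℂ)

lemma wc_wl (c : Bool) (a b : ℂ) : wc c (wl a b) = if c then a else b := by
  have := Complex.I_sq
  cases c
  · simp [wc_apply, wl, sgn]
    linear_combination (a - b) / 2 * this
  · simp [wc_apply, wl, sgn]
    linear_combination (b - a) / 2 * this

/-! ### Derivatives of monomials, Taylor polynomials and remainders -/

lemma hasFDerivAt_monomial (p q : ℕ) (ω : ℂ) :
    HasFDerivAt (fun ω : ℂ => ω ^ p * (starRingEnd ℂ) ω ^ q)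
      (wl (p * ω ^ (p - 1) * (starRingEnd ℂ) ω ^ q) (q * ω ^ p * (starRingEnd ℂ) ω ^ (q - 1)))
      ω := by
  have h1 : HasFDerivAt (fun ω : ℂ => ω ^ p) _ ω := (hasFDerivAt_id (𝕜 := ℝ) ω).pow p
  have h2 : HasFDerivAt (fun ω : ℂ => (starRingEnd ℂ) ω ^ q) _ ω :=
    ((Complex.conjCLE : ℂ →L[ℝ] ℂ).hasFDerivAt (x := ω)).pow q
  refine (h1.mul h2).congr_fderiv ?_
  ext v
  simp [wl]
  ring

lemma dd_of_hasFDerivAt {m : ℕ} (hm : 1 ≤ m) {f : ℂ → ℂ} {ω : ℂ} {A : ℂ →L[ℝ] ℂ}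
    (h : HasFDerivAt f A ω) (hω : ω ∈ D m) (c : Bool) : dd m c f ω = wc c A := by
  rw [dd, h.hasFDerivWithinAt.fderivWithin (uniqueDiffOn_D hm ω hω)]

lemma hasFDerivAt_tay (j : ℕ) (h : ℂ → ℂ) (ω : ℂ) :
    HasFDerivAt (tay j h) (∑ p ∈ Finset.HasAntidiagonal.antidiagonal j,
      (wirtingerAtZero p.1 p.2 h / (p.1 ! * p.2 !)) •
        wl (p.1 * ω ^ (p.1 - 1) * (starRingEnd ℂ) ω ^ p.2)
          (p.2 * ω ^ p.1 * (starRingEnd ℂ) ω ^ (p.2 - 1))) ω := by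
  refine HasFDerivAt.fun_sum fun p _ => ?_
  exact (hasFDerivAt_monomial p.1 p.2 ω).const_mul _

lemma dd_tay_zero {m : ℕ} (hm : 1 ≤ m) (h : ℂ → ℂ) {ω : ℂ} (hω : ω ∈ D m) (c : Bool) :
    dd m c (tay 0 h) ω = 0 := by
  rw [dd_of_hasFDerivAt hm (hasFDerivAt_tay 0 h ω) hω]
  simp [wc_smul, wc_wl]

lemma dd_tay_succ {m : ℕ} (hm : 1 ≤ m) {j : ℕ} {h : ℂ → ℂ}
    (hh : ContDiffOn ℝ (j + 1 : ℕ) h (D m)) {ω : ℂ} (hω : ω ∈ D m) (c : Bool) :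
    dd m c (tay (j + 1) h) ω = tay j (dd m c h) ω := by
  rw [dd_of_hasFDerivAt hm (hasFDerivAt_tay _ h ω) hω, map_sum]
  simp only [wc_smul, wc_wl]
  cases c
  · rw [Finset.Nat.sum_antidiagonal_succ']
    simp only [tay]
    simp only [Nat.cast_zero, zero_mul, Bool.false_eq_true, if_false, mul_zero, zero_add]
    refine Finset.sum_congr rfl fun p hp => ?_
    rw [wirtingerAtZero_succ_right hm, Nat.factorial_succ]
    have h1 : (p.2 ! : ℂ) ≠ 0 := by exact_mod_cast Nat.factorial_ne_zero _
    have h2 : (p.1 ! : ℂ) ≠ 0 := by exact_mod_cast Nat.factorial_ne_zero _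
    have h3 : ((p.2 + 1 : ℕ) : ℂ) ≠ 0 := Nat.cast_ne_zero.2 (Nat.succ_ne_zero p.2)
    simp only [add_tsub_cancel_right]
    push_cast at h3 ⊢
    field_simp
  · rw [Finset.Nat.sum_antidiagonal_succ]
    simp only [tay]
    simp only [Nat.cast_zero, zero_mul, if_true, mul_zero, zero_add]
    refine Finset.sum_congr rfl fun p hp => ?_
    have hp' : p.1 + p.2 = j := Finset.HasAntidiagonal.mem_antidiagonal.1 hp
    rw [wirtingerAtZero_succ_left hm (hh.of_le (by norm_cast; omega)), Nat.factorial_succ]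
    have h1 : (p.2 ! : ℂ) ≠ 0 := by exact_mod_cast Nat.factorial_ne_zero _
    have h2 : (p.1 ! : ℂ) ≠ 0 := by exact_mod_cast Nat.factorial_ne_zero _
    have h3 : ((p.1 + 1 : ℕ) : ℂ) ≠ 0 := Nat.cast_ne_zero.2 (Nat.succ_ne_zero p.1)
    simp only [add_tsub_cancel_right]
    push_cast at h3 ⊢
    field_simp

/-- Differentiation lowers the degree of each Taylor part by one and kills the constant term. The
truncated subtraction covers k = 0, where nothing has been subtracted from h. -/
lemma dd_rem {m : ℕ} (hm : 1 ≤ m) {k : ℕ} {h : ℂ → ℂ} (h1 : DifferentiableOn ℝ h (D m))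
    (hh : ContDiffOn ℝ (k - 1 : ℕ) h (D m)) (c : Bool) :
    Set.EqOn (dd m c (rem k h)) (rem (k - 1) (dd m c h)) (D m) := by
  intro ω hω
  have hu := uniqueDiffOn_D hm ω hω
  have hd : ∀ j, DifferentiableWithinAt ℝ (tay j h) (D m) ω := fun j =>
    (hasFDerivAt_tay j h ω).differentiableAt.differentiableWithinAt
  have e : dd m c (rem k h) ω = dd m c h ω - ∑ j ∈ Finset.range k, dd m c (tay j h) ω := by
    simp only [dd]
    have : fderivWithin ℝ (rem k h) (D m) ω = fderivWithin ℝ h (D m) ω -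
        ∑ j ∈ Finset.range k, fderivWithin ℝ (tay j h) (D m) ω := by
      have h2 : HasFDerivWithinAt (fun ω => ∑ j ∈ Finset.range k, tay j h ω)
          (∑ j ∈ Finset.range k, fderivWithin ℝ (tay j h) (D m) ω) (D m) ω :=
        HasFDerivWithinAt.fun_sum fun j _ => (hd j).hasFDerivWithinAt
      exact ((h1 ω hω).hasFDerivWithinAt.sub h2).fderivWithin hu
    rw [this, map_sub, map_sum]
  rw [e, rem]
  congr 1
  cases k with
  | zero => simp
  | succ k =>
    rw [Finset.sum_range_succ', dd_tay_zero hm h hω, add_zero, Nat.add_sub_cancel]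
    refine Finset.sum_congr rfl fun j hj => ?_
    refine dd_tay_succ hm (hh.of_le ?_) hω c
    have := Finset.mem_range.1 hj
    norm_cast

lemma wd_rem {m : ℕ} (hm : 1 ≤ m) (w : List Bool) {k : ℕ} {h : ℂ → ℂ}
    (hh : ContDiffOn ℝ (max (k - 1) w.length : ℕ) h (D m)) :
    Set.EqOn (wd m w (rem k h)) (rem (k - w.length) (wd m w h)) (D m) := by
  induction w generalizing k h with
  | nil => intro ω _; rfl
  | cons c w ih =>
    intro ω hω
    have h1 : ContDiffOn ℝ 1 h (D m) := hh.of_le (by norm_cast; simp)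
    have e := dd_rem hm (k := k) (h1.differentiableOn (by norm_num))
      (hh.of_le (by norm_cast; exact le_max_left _ _)) c
    rw [wd, wd_congr e w hω]
    have h2 : ContDiffOn ℝ (max (k - 1 - 1) w.length : ℕ) (dd m c h) (D m) :=
      contDiffOn_dd hm (hh.of_le (by norm_cast; simp only [List.length_cons]; omega)) c
    rw [ih h2 hω]
    simp only [wd, List.length_cons]
    congr 1
    omega

lemma tay_zero (h : ℂ → ℂ) (ω : ℂ) : tay 0 h ω = h 0 := by
  simp [tay, wirtingerAtZero]

lemma tay_succ_apply_zero (j : ℕ) (h : ℂ → ℂ) : tay (j + 1) h 0 = 0 := by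
  refine Finset.sum_eq_zero fun p hp => ?_
  have hp' : p.1 + p.2 = j + 1 := Finset.HasAntidiagonal.mem_antidiagonal.1 hp
  rcases Nat.eq_zero_or_pos p.1 with h1 | h1
  · have : p.2 ≠ 0 := by omega
    simp [this]
  · simp [h1.ne']

lemma rem_succ_apply_zero (k : ℕ) (h : ℂ → ℂ) : rem (k + 1) h 0 = 0 := by
  rw [rem, Finset.sum_range_succ', tay_zero,
    Finset.sum_eq_zero fun j _ => tay_succ_apply_zero j h]
  simp

lemma contDiff_tay (j : ℕ) (h : ℂ → ℂ) {n : ℕ} : ContDiff ℝ n (tay j h) := by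
  unfold tay
  refine ContDiff.sum fun p _ => contDiff_const.mul ((contDiff_id.pow _).mul ?_)
  exact (Complex.conjCLE : ℂ →L[ℝ] ℂ).contDiff.pow _

lemma contDiffOn_rem {m : ℕ} (k : ℕ) {h : ℂ → ℂ} {n : ℕ} (hh : ContDiffOn ℝ n h (D m)) :
    ContDiffOn ℝ n (rem k h) (D m) :=
  hh.sub (ContDiff.sum fun j _ => contDiff_tay j h).contDiffOn

/-- By induction: a remainder that vanishes at 0 gains a factor 2‖ω‖ from the bound on its two
Wirtinger derivatives. At the bottom only the oscillation of the derivatives of order exactly k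
remains, which is why C^k is enough. -/
lemma norm_rem_le {m : ℕ} (hm : 1 ≤ m) {β : ℝ → ℝ} (hβ : MonotoneOn β (Set.Ici 0))
    (hβ0 : ∀ x, 0 ≤ x → 0 ≤ β x) (k : ℕ) {h : ℂ → ℂ} (hh : ContDiffOn ℝ k h (D m))
    (hb : ∀ w : List Bool, w.length = k → ∀ ω ∈ D m, ‖wd m w h ω - wd m w h 0‖ ≤ β ‖ω‖)
    {ω : ℂ} (hω : ω ∈ D m) : ‖rem (k + 1) h ω‖ ≤ 2 ^ k * β ‖ω‖ * ‖ω‖ ^ k := by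
  induction k generalizing h ω with
  | zero => simpa [rem, tay_zero, wd] using hb [] rfl ω hω
  | succ k ih =>
    have h1 : DifferentiableOn ℝ h (D m) := hh.differentiableOn (by simp)
    have hr : DifferentiableOn ℝ (rem (k + 1 + 1) h) (D m) :=
      (contDiffOn_rem _ hh).differentiableOn (by simp)
    have key := norm_sub_le_of_dd hr (β := fun x => 2 ^ k * β x * x ^ k) ?_ ?_ hω
    · rw [rem_succ_apply_zero, sub_zero] at key
      refine key.trans (le_of_eq ?_)
      ring
    · intro x hx y hy hxy
      have hx' : (0 : ℝ) ≤ x := hx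
      have h2 := hβ hx hy hxy
      have h3 := hβ0 x hx
      have h4 := hβ0 y hy
      dsimp only
      gcongr
    · intro c z hz
      rw [dd_rem hm h1 hh c hz]
      refine ih (contDiffOn_dd hm hh c) (fun w hw => ?_) hz
      exact hb (c :: w) (by simp [hw])

/-- Bounds on the iterated Wirtinger derivatives of order at most `N`, with homogeneous majorants
of degree `κ`. -/
def JetBound (m N : ℕ) (κ : ℤ) (δ M : ℝ) (R : ℂ → ℂ) : Prop :=
  ContDiffOn ℝ N R (D m) ∧ ∀ w : List Bool, w.length ≤ N → ∀ ω ∈ D m, ω ≠ 0 →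
    ‖wd m w R ω‖ ≤ (δ + M * ‖ω‖) * ‖ω‖ ^ (κ - w.length)

lemma JetBound.dd {m N : ℕ} (hm : 1 ≤ m) {κ : ℤ} {δ M : ℝ} {R : ℂ → ℂ}
    (h : JetBound m (N + 1) κ δ M R) (c : Bool) : JetBound m N (κ - 1) δ M (dd m c R) := by
  refine ⟨contDiffOn_dd hm h.1 c, fun w hw ω hω h0 => ?_⟩
  have := h.2 (c :: w) (by simpa using hw) ω hω h0
  rw [wd, List.length_cons] at this
  push_cast at this
  rwa [show κ - 1 - (w.length : ℤ) = κ - (w.length + 1) by ring]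

lemma JetBound.mono {m N N' : ℕ} {κ : ℤ} {δ M : ℝ} {R : ℂ → ℂ}
    (h : JetBound m N κ δ M R) (hN : N' ≤ N) : JetBound m N' κ δ M R :=
  ⟨h.1.of_le (by exact_mod_cast hN), fun w hw => h.2 w (hw.trans hN)⟩

/-- Up to order k a derivative of the remainder is the remainder of a derivative, so `norm_rem_le`
applies. N may exceed k; those orders are covered by the sup bound S. -/
lemma jetBound_rem {m : ℕ} (hm : 1 ≤ m) {k N : ℕ} {h : ℂ → ℂ}
    (hh : ContDiffOn ℝ (max k N : ℕ) h (D m)) {δ M S : ℝ} (hδ : 0 ≤ δ) (hM : 0 ≤ M)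
    (hS : ∀ w : List Bool, w.length ≤ N → ∀ ω ∈ D m, ‖wd m w h ω‖ ≤ S)
    (hb : ∀ w : List Bool, w.length = k → ∀ ω ∈ D m, ‖wd m w h ω - wd m w h 0‖ ≤ δ + M * ‖ω‖) :
    JetBound m N k (2 ^ k * δ) (2 ^ k * M + 2 ^ N * S) (rem (k + 1) h) := by
  have hS0 : 0 ≤ S := (norm_nonneg _).trans (hS [] (by simp) 0 (zero_mem_D hm))
  refine ⟨contDiffOn_rem _ (hh.of_le (by norm_cast; exact le_max_right _ _)), ?_⟩
  intro w hw ω hω h0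
  have hpos : 0 < ‖ω‖ := norm_pos_iff.2 h0
  rw [wd_rem hm w (hh.of_le (by norm_cast; simp only [Nat.add_sub_cancel]; omega)) hω]
  by_cases hwk : w.length ≤ k
  · have e1 : k + 1 - w.length = (k - w.length) + 1 := by omega
    rw [e1]
    have h1 := norm_rem_le hm (β := fun x => δ + M * x) (k := k - w.length) (h := wd m w h)
      (fun x _ y _ hxy => by dsimp only; gcongr) (fun x hx => by positivity)
      (contDiffOn_wd hm w (hh.of_le (by norm_cast; omega))) (fun w' hw' z hz => ?_) hω
    · refine h1.trans ?_
      have e2 : ((k : ℤ) - w.length) = ((k - w.length : ℕ) : ℤ) := by omega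
      rw [e2, zpow_natCast]
      have h2 : (2 : ℝ) ^ (k - w.length) ≤ 2 ^ k :=
        pow_le_pow_right₀ (by norm_num) (by omega)
      gcongr ?_ * _
      have h3 : 0 ≤ 2 ^ N * S * ‖ω‖ := by positivity
      have h4 : 2 ^ (k - w.length) * (δ + M * ‖ω‖) ≤ 2 ^ k * (δ + M * ‖ω‖) := by gcongr
      linarith
    · have : ∀ (w w' : List Bool) (f : ℂ → ℂ), wd m w' (wd m w f) = wd m (w ++ w') f := by
        intro w
        induction w with
        | nil => intro w' f; rfl
        | cons c w ih => intro w' f; exact ih w' _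
      rw [this]
      exact hb _ (by simp [hw']; omega) z hz
  -- Past order k the polynomial has been differentiated away. As ‖ω‖ ≤ 2, the factor ‖ω‖ ^ (k + 1 -
  -- length), whose exponent is now non-positive, is at least 2 ^ (-N), so S is absorbed by the term
  -- linear in ‖ω‖.
  · have e1 : k + 1 - w.length = 0 := by omega
    rw [e1]
    simp only [rem, Finset.range_zero, Finset.sum_empty, sub_zero]
    refine (hS w hw ω hω).trans ?_
    obtain ⟨i, hi⟩ : ∃ i : ℕ, w.length = k + 1 + i := ⟨w.length - (k + 1), by omega⟩
    have e2 : ‖ω‖ ^ ((k : ℤ) - w.length) = ‖ω‖⁻¹ * (‖ω‖ ^ i)⁻¹ := by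
      rw [hi, show (k : ℤ) - ((k + 1 + i : ℕ) : ℤ) = -((i + 1 : ℕ) : ℤ) by push_cast; ring,
        zpow_neg, zpow_natCast, pow_succ, mul_inv, mul_comm]
    rw [e2]
    have h2 : ‖ω‖ ^ i ≤ 2 ^ N :=
      (pow_le_pow_left₀ hpos.le (norm_le_two_of_mem_D hm hω) i).trans
        (pow_le_pow_right₀ (by norm_num) (by omega))
    have h3 : 1 ≤ 2 ^ N * (‖ω‖ ^ i)⁻¹ := by
      rw [← div_eq_mul_inv, one_le_div (by positivity)]; exact h2
    calc S ≤ S * (2 ^ N * (‖ω‖ ^ i)⁻¹) := le_mul_of_one_le_right hS0 h3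
      _ = (2 ^ N * S * ‖ω‖) * (‖ω‖⁻¹ * (‖ω‖ ^ i)⁻¹) := by field_simp
      _ ≤ _ := by
        gcongr
        have : 0 ≤ 2 ^ k * δ + 2 ^ k * M * ‖ω‖ := by positivity
        linarith


/-! ### Parametric integrals on a half-interval -/

lemma exists_bound_of_continuousOn_strip {F : ℝ → ℝ → ℂ}
    (hF : ContinuousOn (Function.uncurry F) (Set.Icc (-1) 1 ×ˢ Set.Ioc 0 1)) {s₀ : ℝ}
    (hs₀ : 0 < s₀) : ∃ B, ∀ u ∈ Set.Icc (-1 : ℝ) 1, ∀ s ∈ Set.Icc s₀ 1, ‖F u s‖ ≤ B := by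
  obtain ⟨B, hB⟩ := ((isCompact_Icc (a := (-1 : ℝ)) (b := 1)).prod
    (isCompact_Icc (a := s₀) (b := 1))).exists_bound_of_continuousOn
      (hF.mono (Set.prod_mono le_rfl fun s hs => ⟨hs₀.trans_le hs.1, hs.2⟩))
  exact ⟨B, fun u hu s hs => hB (u, s) ⟨hu, hs⟩⟩

lemma continuousOn_slice {F : ℝ → ℝ → ℂ}
    (hF : ContinuousOn (Function.uncurry F) (Set.Icc (-1) 1 ×ˢ Set.Ioc 0 1)) {s : ℝ}
    (hs : s ∈ Set.Ioc (0 : ℝ) 1) : ContinuousOn (fun u => F u s) (Set.Icc (-1) 1) :=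
  hF.comp (f := fun u : ℝ => (u, s)) (by fun_prop) fun _ hu => ⟨hu, hs⟩

lemma intervalIntegrable_slice {F : ℝ → ℝ → ℂ}
    (hF : ContinuousOn (Function.uncurry F) (Set.Icc (-1) 1 ×ˢ Set.Ioc 0 1)) {s : ℝ}
    (hs : s ∈ Set.Ioc (0 : ℝ) 1) :
    IntervalIntegrable (fun u => F u s) MeasureTheory.volume (-1) 1 :=
  ContinuousOn.intervalIntegrable (by
    rw [Set.uIcc_of_le (by norm_num)]; exact continuousOn_slice hF hs)

lemma uIoc_subset_Icc : Set.uIoc (-1 : ℝ) 1 ⊆ Set.Icc (-1) 1 := by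
  rw [Set.uIoc_of_le (by norm_num)]; exact Set.Ioc_subset_Icc_self

lemma Icc_half_mem_nhdsWithin {s : ℝ} (hs : 0 < s) :
    Set.Icc (s / 2) 1 ∈ 𝓝[Set.Ioc (0 : ℝ) 1] s := by
  filter_upwards [self_mem_nhdsWithin, nhdsWithin_le_nhds (Ioi_mem_nhds (half_lt_self hs))]
    with t h1 h2 using ⟨le_of_lt h2, h1.2⟩

lemma continuousOn_integral_strip {F : ℝ → ℝ → ℂ}
    (hF : ContinuousOn (Function.uncurry F) (Set.Icc (-1) 1 ×ˢ Set.Ioc 0 1)) :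
    ContinuousOn (fun s => ∫ u in (-1 : ℝ)..1, F u s) (Set.Ioc 0 1) := by
  intro s hs
  obtain ⟨B, hB⟩ := exists_bound_of_continuousOn_strip hF (half_pos hs.1)
  refine intervalIntegral.continuousWithinAt_of_dominated_interval (bound := fun _ => B) ?_ ?_ ?_ ?_
  · filter_upwards [self_mem_nhdsWithin] with t ht
    exact (intervalIntegrable_iff.1 (intervalIntegrable_slice hF ht)).aestronglyMeasurable
  · filter_upwards [Icc_half_mem_nhdsWithin hs.1] with t ht
    exact Filter.Eventually.of_forall fun u hu => hB u (uIoc_subset_Icc hu) t ht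
  · exact intervalIntegrable_const
  · refine Filter.Eventually.of_forall fun u hu => ?_
    exact (hF.comp (f := fun s : ℝ => (u, s)) (by fun_prop)
      (fun t ht => ⟨uIoc_subset_Icc hu, ht⟩)) s hs

/-- The endpoint s = 1 belongs to the interval and has only one-sided neighbourhoods there, so
dominated convergence is applied to the slopes themselves, bounded by the mean value inequality on
[s/2, 1]. -/
lemma hasDerivWithinAt_integral_strip {F F' : ℝ → ℝ → ℂ}
    (hF : ContinuousOn (Function.uncurry F) (Set.Icc (-1) 1 ×ˢ Set.Ioc 0 1))
    (hF' : ContinuousOn (Function.uncurry F') (Set.Icc (-1) 1 ×ˢ Set.Ioc 0 1))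
    (hd : ∀ u ∈ Set.Icc (-1 : ℝ) 1, ∀ s ∈ Set.Ioc (0 : ℝ) 1,
      HasDerivWithinAt (F u) (F' u s) (Set.Ioc 0 1) s) {s : ℝ} (hs : s ∈ Set.Ioc (0 : ℝ) 1) :
    HasDerivWithinAt (fun s => ∫ u in (-1 : ℝ)..1, F u s) (∫ u in (-1 : ℝ)..1, F' u s)
      (Set.Ioc 0 1) s := by
  obtain ⟨B, hB⟩ := exists_bound_of_continuousOn_strip hF' (half_pos hs.1)
  rw [hasDerivWithinAt_iff_tendsto_slope]
  have hsub : 𝓝[Set.Ioc 0 1 \ {s}] s ≤ 𝓝[Set.Ioc 0 1] s := nhdsWithin_mono _ Set.sdiff_subset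
  have hsl : slope (fun s => ∫ u in (-1 : ℝ)..1, F u s) s =ᶠ[𝓝[Set.Ioc 0 1 \ {s}] s]
      fun t => ∫ u in (-1 : ℝ)..1, slope (F u) s t := by
    filter_upwards [self_mem_nhdsWithin] with t ht
    simp only [slope_def_module]
    rw [← intervalIntegral.integral_sub (intervalIntegrable_slice hF ht.1)
      (intervalIntegrable_slice hF hs), intervalIntegral.integral_smul]
  refine Filter.Tendsto.congr' hsl.symm ?_
  refine intervalIntegral.tendsto_integral_filter_of_dominated_convergence (fun _ => B) ?_ ?_ ?_ ?_
  · filter_upwards [self_mem_nhdsWithin] with t ht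
    simp only [slope_def_module]
    exact (intervalIntegrable_iff.1 (((intervalIntegrable_slice hF ht.1).sub
      (intervalIntegrable_slice hF hs)).smul _)).aestronglyMeasurable
  · filter_upwards [self_mem_nhdsWithin, hsub (Icc_half_mem_nhdsWithin hs.1)] with t ht ht2
    refine Filter.Eventually.of_forall fun u hu => ?_
    have hu' := uIoc_subset_Icc hu
    have hne : 0 < ‖t - s‖ := norm_pos_iff.2 (sub_ne_zero.2 ht.2)
    have h1 := (convex_Icc (s / 2) 1).norm_image_sub_le_of_norm_hasDerivWithin_le
      (f := F u) (f' := F' u) (C := B) (x := s) (y := t)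
      (fun x hx => (hd u hu' x ⟨(half_pos hs.1).trans_le hx.1, hx.2⟩).mono
        fun y hy => ⟨(half_pos hs.1).trans_le hy.1, hy.2⟩)
      (fun x hx => hB u hu' x hx) ⟨by linarith [hs.1], hs.2⟩ ht2
    rw [slope_def_module, norm_smul, norm_inv, inv_mul_le_iff₀ hne, mul_comm]
    exact h1
  · exact intervalIntegrable_const
  · refine Filter.Eventually.of_forall fun u hu => ?_
    exact hasDerivWithinAt_iff_tendsto_slope.1 (hd u (uIoc_subset_Icc hu) s hs)

lemma uniqueDiffOn_Ioc01 : UniqueDiffOn ℝ (Set.Ioc (0 : ℝ) 1) := uniqueDiffOn_Ioc 0 1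

/-! ### The weighted integrals `Φ_{a,b}` -/

/-- The integrand `ω^a ω̄^b R(ω)`, `ω = (u + i s)^{1/m}`. -/
noncomputable def integrand (m : ℕ) (a b : ℤ) (R : ℂ → ℂ) (u s : ℝ) : ℂ :=
  om m u s ^ a * (starRingEnd ℂ) (om m u s) ^ b * R (om m u s)

/-- `∫_{-1}^1 ω^a ω̄^b R(ω) du` along `ω = (u + i s)^{1/m}`. -/
noncomputable def Phi (m : ℕ) (a b : ℤ) (R : ℂ → ℂ) (s : ℝ) : ℂ :=
  ∫ u in (-1 : ℝ)..1, integrand m a b R u s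

lemma mem_D_of_strip {m : ℕ} (hm : 1 ≤ m) {u s : ℝ} (hu : u ∈ Set.Icc (-1 : ℝ) 1)
    (hs : s ∈ Set.Ioc (0 : ℝ) 1) : om m u s ∈ D m :=
  om_mem_D hm (abs_le.2 hu) (abs_le.2 ⟨by linarith [hs.1], hs.2⟩)

lemma conj_om_ne_zero {m : ℕ} (u : ℝ) {s : ℝ} (hs : 0 < s) : (starRingEnd ℂ) (om m u s) ≠ 0 :=
  (map_ne_zero _).2 (om_ne_zero u hs)

lemma continuousOn_om_strip (m : ℕ) :
    ContinuousOn (fun p : ℝ × ℝ => om m p.1 p.2) (Set.Icc (-1) 1 ×ˢ Set.Ioc 0 1) := by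
  intro p hp
  have h2 := (Complex.hasStrictDerivAt_cpow_const (c := (m : ℂ)⁻¹)
    (add_mul_I_mem_slitPlane p.1 hp.2.1)).hasDerivAt.continuousAt
  exact (ContinuousAt.comp (f := fun p : ℝ × ℝ => (p.1 : ℂ) + p.2 * Complex.I) h2
    (by fun_prop)).continuousWithinAt

lemma continuousOn_integrand {m : ℕ} (hm : 1 ≤ m) (a b : ℤ) {R : ℂ → ℂ}
    (hR : ContinuousOn R (D m)) :
    ContinuousOn (Function.uncurry (integrand m a b R)) (Set.Icc (-1) 1 ×ˢ Set.Ioc 0 1) := by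
  have h := continuousOn_om_strip m
  refine ContinuousOn.mul (ContinuousOn.mul ?_ ?_) ?_
  · exact h.zpow₀ a fun p hp => Or.inl (om_ne_zero _ hp.2.1)
  · exact (Complex.continuous_conj.comp_continuousOn h).zpow₀ b
      fun p hp => Or.inl (conj_om_ne_zero _ hp.2.1)
  · exact hR.comp h fun p hp => mem_D_of_strip hm hp.1 hp.2

lemma continuousOn_Phi {m : ℕ} (hm : 1 ≤ m) (a b : ℤ) {R : ℂ → ℂ}
    (hR : ContinuousOn R (D m)) : ContinuousOn (Phi m a b R) (Set.Ioc 0 1) :=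
  continuousOn_integral_strip (continuousOn_integrand hm a b hR)

/-- The integrand of the derivative of `Φ_{a,b}`. -/
noncomputable def integrandDeriv (m : ℕ) (a b : ℤ) (R : ℂ → ℂ) (u s : ℝ) : ℂ :=
  Complex.I / m * (a * integrand m (a - m) b R u s + integrand m (a + 1 - m) b (dd m true R) u s -
    b * integrand m a (b - m) R u s - integrand m a (b + 1 - m) (dd m false R) u s)

lemma hasDerivWithinAt_integrand {m : ℕ} (hm : 1 ≤ m) (a b : ℤ) {R : ℂ → ℂ}
    (hR : DifferentiableOn ℝ R (D m)) {u s : ℝ} (hu : u ∈ Set.Icc (-1 : ℝ) 1)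
    (hs : s ∈ Set.Ioc (0 : ℝ) 1) :
    HasDerivWithinAt (integrand m a b R u) (integrandDeriv m a b R u s) (Set.Ioc 0 1) s := by
  have h0 := om_ne_zero (m := m) u hs.1
  have h0' := conj_om_ne_zero (m := m) u hs.1
  have e1 := (hasDerivAt_om hm u hs.1).hasDerivWithinAt (s := Set.Ioc 0 1)
  have e2 := (hasDerivAt_conj_om hm u hs.1).hasDerivWithinAt (s := Set.Ioc 0 1)
  have k1 := (hasDerivAt_zpow a (om m u s) (Or.inl h0)).comp_hasDerivWithinAt s e1
  have k2 := (hasDerivAt_zpow b ((starRingEnd ℂ) (om m u s)) (Or.inl h0')).comp_hasDerivWithinAt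
    s e2
  have k3 := (hR _ (mem_D_of_strip hm hu hs)).hasFDerivWithinAt.comp_hasDerivWithinAt s e1
    (fun t ht => mem_D_of_strip hm hu ht)
  refine ((k1.mul k2).mul k3).congr_deriv ?_
  rw [clm_apply_eq_wc]
  simp only [integrandDeriv, integrand, Function.comp_apply, Pi.mul_apply]
  have q1 : om m u s ^ (a - m) = om m u s ^ (a - 1) * om m u s ^ (1 - m : ℤ) := by
    rw [← zpow_add₀ h0]; congr 1; ring
  have q2 : om m u s ^ (a + 1 - m) = om m u s ^ a * om m u s ^ (1 - m : ℤ) := by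
    rw [← zpow_add₀ h0]; congr 1; ring
  have q3 : (starRingEnd ℂ) (om m u s) ^ (b - m) =
      (starRingEnd ℂ) (om m u s) ^ (b - 1) * (starRingEnd ℂ) (om m u s) ^ (1 - m : ℤ) := by
    rw [← zpow_add₀ h0']; congr 1; ring
  have q4 : (starRingEnd ℂ) (om m u s) ^ (b + 1 - m) =
      (starRingEnd ℂ) (om m u s) ^ b * (starRingEnd ℂ) (om m u s) ^ (1 - m : ℤ) := by
    rw [← zpow_add₀ h0']; congr 1; ring
  have q5 : (starRingEnd ℂ) (Complex.I / m * om m u s ^ (1 - m : ℤ)) =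
      -Complex.I / m * (starRingEnd ℂ) (om m u s) ^ (1 - m : ℤ) := by
    simp
  rw [q1, q2, q3, q4, q5]
  simp only [dd]
  ring

/-- The product rule keeps the family `Phi` closed. If R counts as degree κ and its Wirtinger
derivatives as κ - 1, all four terms have the original total degree lowered by m. -/
lemma hasDerivWithinAt_Phi {m : ℕ} (hm : 1 ≤ m) (a b : ℤ) {R : ℂ → ℂ}
    (hR : ContDiffOn ℝ 1 R (D m)) {s : ℝ} (hs : s ∈ Set.Ioc (0 : ℝ) 1) :
    HasDerivWithinAt (Phi m a b R) (Complex.I / m * (a * Phi m (a - m) b R s +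
      Phi m (a + 1 - m) b (dd m true R) s - b * Phi m a (b - m) R s -
      Phi m a (b + 1 - m) (dd m false R) s)) (Set.Ioc 0 1) s := by
  have hd : ∀ c, ContinuousOn (dd m c R) (D m) := fun c =>
    (contDiffOn_dd hm (n := 0) hR c).continuousOn
  have c0 := fun a b => continuousOn_integrand hm a b hR.continuousOn
  have c1 := fun c a b => continuousOn_integrand hm a b (hd c)
  have hcont : ContinuousOn (Function.uncurry (integrandDeriv m a b R))
      (Set.Icc (-1) 1 ×ˢ Set.Ioc 0 1) := by
    refine continuousOn_const.mul (((((c0 (a - m) b).const_mul (a : ℂ)).add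
      (c1 true (a + 1 - m) b)).sub ((c0 a (b - m)).const_mul (b : ℂ))).sub
      (c1 false a (b + 1 - m)))
  refine (hasDerivWithinAt_integral_strip (c0 a b) hcont (fun u hu s hs =>
    hasDerivWithinAt_integrand hm a b (hR.differentiableOn (by norm_num)) hu hs) hs).congr_deriv ?_
  simp only [integrandDeriv, Phi]
  have i0 := fun a b => intervalIntegrable_slice (c0 a b) hs
  have i1 := fun c a b => intervalIntegrable_slice (c1 c a b) hs
  rw [intervalIntegral.integral_const_mul, intervalIntegral.integral_sub
    ((((i0 _ _).const_mul _).add (i1 _ _ _)).sub ((i0 _ _).const_mul _)) (i1 _ _ _),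
    intervalIntegral.integral_sub (((i0 _ _).const_mul _).add (i1 _ _ _)) ((i0 _ _).const_mul _),
    intervalIntegral.integral_add ((i0 _ _).const_mul _) (i1 _ _ _),
    intervalIntegral.integral_const_mul, intervalIntegral.integral_const_mul]

lemma derivWithin_Phi {m : ℕ} (hm : 1 ≤ m) (a b : ℤ) {R : ℂ → ℂ}
    (hR : ContDiffOn ℝ 1 R (D m)) :
    Set.EqOn (derivWithin (Phi m a b R) (Set.Ioc 0 1)) (fun s =>
      Complex.I / m * (a * Phi m (a - m) b R s +
      Phi m (a + 1 - m) b (dd m true R) s - b * Phi m a (b - m) R s -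
      Phi m a (b + 1 - m) (dd m false R) s)) (Set.Ioc 0 1) := fun s hs =>
  (hasDerivWithinAt_Phi hm a b hR hs).derivWithin (uniqueDiffOn_Ioc01 s hs)

lemma contDiffOn_Phi {m : ℕ} (hm : 1 ≤ m) {N : ℕ} (a b : ℤ) {R : ℂ → ℂ}
    (hR : ContDiffOn ℝ N R (D m)) : ContDiffOn ℝ N (Phi m a b R) (Set.Ioc 0 1) := by
  induction N generalizing a b R with
  | zero => exact contDiffOn_zero.2 (continuousOn_Phi hm a b hR.continuousOn)
  | succ N ih =>
    have h1 : ContDiffOn ℝ 1 R (D m) := hR.of_le (by norm_cast; omega)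
    have h2 : ContDiffOn ℝ N R (D m) := hR.of_le (by norm_cast; omega)
    have h3 := fun c => contDiffOn_dd hm hR c
    push_cast
    rw [contDiffOn_succ_iff_derivWithin uniqueDiffOn_Ioc01]
    refine ⟨fun s hs => (hasDerivWithinAt_Phi hm a b h1 hs).differentiableWithinAt, by simp, ?_⟩
    refine ContDiffOn.congr ?_ (derivWithin_Phi hm a b h1)
    exact contDiffOn_const.mul ((((contDiffOn_const.mul (ih _ _ h2)).add (ih _ _ (h3 true))).sub
      (contDiffOn_const.mul (ih _ _ h2))).sub (ih _ _ (h3 false)))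

lemma iteratedDerivWithin_combination {J : Set ℝ} {s : ℝ} (hs : s ∈ J) (hu : UniqueDiffOn ℝ J)
    {N : ℕ} (c x y : ℂ) {f₁ f₂ f₃ f₄ : ℝ → ℂ} (h₁ : ContDiffWithinAt ℝ N f₁ J s)
    (h₂ : ContDiffWithinAt ℝ N f₂ J s) (h₃ : ContDiffWithinAt ℝ N f₃ J s)
    (h₄ : ContDiffWithinAt ℝ N f₄ J s) :
    iteratedDerivWithin N (fun t => c * (x * f₁ t + f₂ t - y * f₃ t - f₄ t)) J s =
      c * (x * iteratedDerivWithin N f₁ J s + iteratedDerivWithin N f₂ J s -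
        y * iteratedDerivWithin N f₃ J s - iteratedDerivWithin N f₄ J s) := by
  have e : (fun t => c * (x * f₁ t + f₂ t - y * f₃ t - f₄ t)) =
      c • (x • f₁ + f₂ - y • f₃ - f₄) := rfl
  have d1 : ContDiffWithinAt ℝ N (x • f₁) J s := contDiffWithinAt_const.mul h₁
  have d3 : ContDiffWithinAt ℝ N (y • f₃) J s := contDiffWithinAt_const.mul h₃
  have d2 : ContDiffWithinAt ℝ N (x • f₁ + f₂) J s := d1.add h₂
  have d4 : ContDiffWithinAt ℝ N (x • f₁ + f₂ - y • f₃) J s := d2.sub d3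
  rw [e, iteratedDerivWithin_const_smul_field, iteratedDerivWithin_sub hs hu d4 h₄,
    iteratedDerivWithin_sub hs hu d2 d3,
    iteratedDerivWithin_add hs hu d1 h₂, iteratedDerivWithin_const_smul_field,
    iteratedDerivWithin_const_smul_field]
  rfl

lemma iteratedDerivWithin_succ_Phi {m : ℕ} (hm : 1 ≤ m) {N : ℕ} (a b : ℤ) {R : ℂ → ℂ}
    (hR : ContDiffOn ℝ (N + 1 : ℕ) R (D m)) {s : ℝ} (hs : s ∈ Set.Ioc (0 : ℝ) 1) :
    iteratedDerivWithin (N + 1) (Phi m a b R) (Set.Ioc 0 1) s = Complex.I / m *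
      (a * iteratedDerivWithin N (Phi m (a - m) b R) (Set.Ioc 0 1) s +
      iteratedDerivWithin N (Phi m (a + 1 - m) b (dd m true R)) (Set.Ioc 0 1) s -
      b * iteratedDerivWithin N (Phi m a (b - m) R) (Set.Ioc 0 1) s -
      iteratedDerivWithin N (Phi m a (b + 1 - m) (dd m false R)) (Set.Ioc 0 1) s) := by
  have hu := uniqueDiffOn_Ioc01
  have h1 : ContDiffOn ℝ 1 R (D m) := hR.of_le (by norm_cast; omega)
  have h2 : ContDiffOn ℝ N R (D m) := hR.of_le (by norm_cast; omega)
  have h3 := fun c => contDiffOn_dd hm hR c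
  have c0 := fun a b => contDiffOn_Phi hm a b h2 s hs
  have c1 := fun c a b => contDiffOn_Phi hm a b (h3 c) s hs
  rw [iteratedDerivWithin_succ', iteratedDerivWithin_congr (derivWithin_Phi hm a b h1) hs]
  exact iteratedDerivWithin_combination hs hu _ _ _ (c0 _ _) (c1 _ _ _) (c0 _ _) (c1 _ _ _)

/-- The homogeneous majorant of `Φ`. -/
noncomputable def majorant (m : ℕ) (δ M : ℝ) (E : ℤ) (s : ℝ) : ℝ :=
  ∫ u in (-1 : ℝ)..1, (δ + M * ‖om m u s‖) * ‖om m u s‖ ^ E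

lemma intervalIntegrable_norm_om (m : ℕ) (E : ℤ) {s : ℝ} (hs : 0 < s) (x y : ℝ) :
    IntervalIntegrable (fun u => ‖om m u s‖ ^ E) MeasureTheory.volume x y :=
  ((continuous_om m hs).norm.zpow₀ E
    fun u => Or.inl (norm_ne_zero_iff.2 (om_ne_zero u hs))).intervalIntegrable _ _

lemma norm_Phi_le {m : ℕ} (hm : 1 ≤ m) (a b κ : ℤ) {δ M : ℝ} {R : ℂ → ℂ}
    (hb : ∀ ω ∈ D m, ω ≠ 0 → ‖R ω‖ ≤ (δ + M * ‖ω‖) * ‖ω‖ ^ κ) {s : ℝ}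
    (hs : s ∈ Set.Ioc (0 : ℝ) 1) : ‖Phi m a b R s‖ ≤ majorant m δ M (κ + a + b) s := by
  refine intervalIntegral.norm_integral_le_of_norm_le (by norm_num) ?_ ?_
  · refine Filter.Eventually.of_forall fun u hu => ?_
    have h0 := om_ne_zero (m := m) u hs.1
    have h1 : ‖om m u s‖ ≠ 0 := norm_ne_zero_iff.2 h0
    have h2 := hb _ (mem_D_of_strip hm (Set.Ioc_subset_Icc_self hu) hs) h0
    rw [integrand, norm_mul, norm_mul, norm_zpow, norm_zpow, RCLike.norm_conj]
    calc _ ≤ ‖om m u s‖ ^ a * ‖om m u s‖ ^ b * ((δ + M * ‖om m u s‖) * ‖om m u s‖ ^ κ) := by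
          gcongr
      _ = _ := by rw [zpow_add₀ h1, zpow_add₀ h1]; ring
  · have hc := (continuous_om m hs.1).norm
    exact ((continuous_const.add (continuous_const.mul hc)).mul (hc.zpow₀ _
      fun u => Or.inl (norm_ne_zero_iff.2 (om_ne_zero u hs.1)))).intervalIntegrable _ _

/-- The four terms of the derivative formula share one total degree, so a single majorant serves
them all through the induction. The constant does not depend on R, κ, δ or M. -/
lemma norm_iteratedDerivWithin_Phi_le {m : ℕ} (hm : 1 ≤ m) (N : ℕ) (a b : ℤ) :
    ∃ C : ℝ, 0 ≤ C ∧ ∀ (κ : ℤ) (δ M : ℝ) (R : ℂ → ℂ), JetBound m N κ δ M R →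
      ∀ s ∈ Set.Ioc (0 : ℝ) 1, ‖iteratedDerivWithin N (Phi m a b R) (Set.Ioc 0 1) s‖ ≤
        C * majorant m δ M (κ + a + b - m * N) s := by
  induction N generalizing a b with
  | zero =>
    refine ⟨1, zero_le_one, fun κ δ M R hR s hs => ?_⟩
    have := norm_Phi_le hm a b κ (fun ω hω h0 => by simpa [wd] using hR.2 [] (by simp) ω hω h0) hs
    simpa using this
  | succ N ih =>
    obtain ⟨C1, h1, k1⟩ := ih (a - m) b
    obtain ⟨C2, h2, k2⟩ := ih (a + 1 - m) b
    obtain ⟨C3, h3, k3⟩ := ih a (b - m)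
    obtain ⟨C4, h4, k4⟩ := ih a (b + 1 - m)
    refine ⟨|(a : ℝ)| * C1 + C2 + |(b : ℝ)| * C3 + C4, by positivity, fun κ δ M R hR s hs => ?_⟩
    rw [iteratedDerivWithin_succ_Phi hm a b hR.1 hs]
    have g1 := k1 κ δ M R (hR.mono (Nat.le_succ _)) s hs
    have g2 := k2 (κ - 1) δ M _ (hR.dd hm true) s hs
    have g3 := k3 κ δ M R (hR.mono (Nat.le_succ _)) s hs
    have g4 := k4 (κ - 1) δ M _ (hR.dd hm false) s hs
    have e1 : κ + (a - m) + b - m * N = κ + a + b - m * (N + 1 : ℕ) := by push_cast; ring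
    have e2 : κ - 1 + (a + 1 - m) + b - m * N = κ + a + b - m * (N + 1 : ℕ) := by push_cast; ring
    have e3 : κ + a + (b - m) - m * N = κ + a + b - m * (N + 1 : ℕ) := by push_cast; ring
    have e4 : κ - 1 + a + (b + 1 - m) - m * N = κ + a + b - m * (N + 1 : ℕ) := by push_cast; ring
    rw [e1] at g1; rw [e2] at g2; rw [e3] at g3; rw [e4] at g4
    set Q := majorant m δ M (κ + a + b - m * (N + 1 : ℕ)) s
    have hI : ‖Complex.I / (m : ℂ)‖ ≤ 1 := by
      rw [norm_div, Complex.norm_I, Complex.norm_natCast]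
      exact div_le_one_of_le₀ (by exact_mod_cast hm) (by positivity)
    rw [norm_mul]
    refine (mul_le_of_le_one_left (norm_nonneg _) hI).trans ?_
    refine (norm_sub_le _ _).trans ?_
    refine (add_le_add_left (norm_sub_le _ _) _).trans ?_
    refine (add_le_add_left (add_le_add_left (norm_add_le _ _) _) _).trans ?_
    rw [norm_mul, norm_mul, Complex.norm_intCast, Complex.norm_intCast]
    have := mul_le_mul_of_nonneg_left g1 (abs_nonneg (a : ℝ))
    have := mul_le_mul_of_nonneg_left g3 (abs_nonneg (b : ℝ))
    linarith

/-! ### Scaling -/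

lemma om_eq_scale (m : ℕ) {s : ℝ} (hs : 0 < s) (u : ℝ) :
    om m u s = ((s ^ ((m : ℝ)⁻¹) : ℝ) : ℂ) * om m (u / s) 1 := by
  rw [← om_mul m hs, mul_one, mul_div_cancel₀ _ hs.ne']

lemma norm_om_zpow (m : ℕ) (E : ℤ) (u s : ℝ) :
    ‖om m u s‖ ^ E = (u ^ 2 + s ^ 2) ^ ((E : ℝ) / m / 2) := by
  have h0 : 0 ≤ u ^ 2 + s ^ 2 := by positivity
  rw [norm_om, norm_add_mul_I, ← Real.rpow_intCast, ← Real.rpow_mul h0, ← Real.rpow_mul h0]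
  congr 1; ring

/-- The integrand is (1 + u²)^{E/(2m)}, which decays like |u|^{E/m}; hence the threshold E = -m. -/
lemma integrable_norm_om_one {m : ℕ} (hm : 1 ≤ m) {E : ℤ} (hE : E < -m) :
    MeasureTheory.Integrable (fun u => ‖om m u 1‖ ^ E) := by
  have hm' : (0 : ℝ) < m := by exact_mod_cast hm
  have h := integrable_rpow_neg_one_add_norm_sq (E := ℝ) (μ := MeasureTheory.volume)
    (r := -(E : ℝ) / m) (by
      simp only [Module.finrank_self, Nat.cast_one]
      rw [lt_div_iff₀ hm', one_mul]
      have : (E : ℝ) < -m := by exact_mod_cast hE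
      linarith)
  refine h.congr (Filter.Eventually.of_forall fun u => ?_)
  dsimp only
  rw [norm_om_zpow, Real.norm_eq_abs, sq_abs]
  congr 1 <;> ring

lemma norm_om_zpow_scale (m : ℕ) (E : ℤ) {s : ℝ} (hs : 0 < s) (u : ℝ) :
    ‖om m u s‖ ^ E = s ^ ((E : ℝ) / m) * ‖om m (u / s) 1‖ ^ E := by
  rw [om_eq_scale m hs, norm_mul, Complex.norm_real, mul_zpow,
    Real.norm_of_nonneg (Real.rpow_nonneg hs.le _), ← Real.rpow_intCast, ← Real.rpow_mul hs.le]
  congr 2; ring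

/-- Substituting u = sv gives s^{E/m} from homogeneity and s from du; the remaining integral is
extended to the whole line. -/
lemma integral_norm_om_le {m : ℕ} (hm : 1 ≤ m) {E : ℤ} (hE : E < -m) :
    ∃ C : ℝ, 0 ≤ C ∧ ∀ s : ℝ, 0 < s →
      ∫ u in (-1 : ℝ)..1, ‖om m u s‖ ^ E ≤ C * s ^ ((E : ℝ) / m + 1) := by
  have hi := integrable_norm_om_one hm hE
  refine ⟨∫ u, ‖om m u 1‖ ^ E, MeasureTheory.integral_nonneg fun u => by positivity,
    fun s hs => ?_⟩
  simp_rw [norm_om_zpow_scale m E hs]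
  rw [intervalIntegral.integral_of_le (by norm_num)]
  have hi2 : MeasureTheory.Integrable (fun u : ℝ => s ^ ((E : ℝ) / m) * ‖om m (u / s) 1‖ ^ E) :=
    (hi.comp_div hs.ne').const_mul _
  refine (MeasureTheory.setIntegral_le_integral hi2
    (Filter.Eventually.of_forall fun u => by positivity)).trans (le_of_eq ?_)
  rw [MeasureTheory.integral_const_mul,
    MeasureTheory.Measure.integral_comp_div (fun u => ‖om m u 1‖ ^ E), Real.rpow_add hs,
    Real.rpow_one, abs_of_pos hs, smul_eq_mul]
  ring

/-- The M-term carries one more power of ‖ω‖, so its degree E + 1 must also lie below -m; in return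
it gains a factor s^{1/m}. -/
lemma majorant_le {m : ℕ} (hm : 1 ≤ m) {E : ℤ} (hE : E + 1 < -m) :
    ∃ C : ℝ, 0 ≤ C ∧ ∀ δ M s : ℝ, 0 ≤ δ → 0 ≤ M → 0 < s →
      majorant m δ M E s ≤ C * (δ * s ^ ((E : ℝ) / m + 1) + M * s ^ (((E : ℝ) + 1) / m + 1)) := by
  obtain ⟨C1, h1, k1⟩ := integral_norm_om_le hm (show E < -m by omega)
  obtain ⟨C2, h2, k2⟩ := integral_norm_om_le hm hE
  refine ⟨C1 + C2, by positivity, fun δ M s hδ hM hs => ?_⟩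
  have e : ∀ u, (δ + M * ‖om m u s‖) * ‖om m u s‖ ^ E =
      δ * ‖om m u s‖ ^ E + M * ‖om m u s‖ ^ (E + 1) := fun u => by
    rw [zpow_add_one₀ (norm_ne_zero_iff.2 (om_ne_zero u hs))]; ring
  simp only [majorant, e]
  rw [intervalIntegral.integral_add ((intervalIntegrable_norm_om m _ hs _ _).const_mul _)
    ((intervalIntegrable_norm_om m _ hs _ _).const_mul _), intervalIntegral.integral_const_mul,
    intervalIntegral.integral_const_mul]
  have g1 := mul_le_mul_of_nonneg_left (k1 s hs) hδ
  have g2 := mul_le_mul_of_nonneg_left (k2 s hs) hM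
  push_cast at g2
  have p1 : 0 ≤ s ^ ((E : ℝ) / m + 1) := Real.rpow_nonneg hs.le _
  have p2 : 0 ≤ s ^ (((E : ℝ) + 1) / m + 1) := Real.rpow_nonneg hs.le _
  have := mul_nonneg (mul_nonneg h2 hδ) p1
  have := mul_nonneg (mul_nonneg h1 hM) p2
  linarith


open MeasureTheory Filter

/-! ### The Gamma integral along a complex ray -/

lemma one_add_mul_I_mem_slitPlane (v : ℝ) : 1 + v * Complex.I ∈ Complex.slitPlane := by
  left; simp

lemma one_add_mul_I_ne_zero (v : ℝ) : 1 + v * Complex.I ≠ 0 :=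
  Complex.slitPlane_ne_zero (one_add_mul_I_mem_slitPlane v)

lemma integrableOn_rpow_mul_exp_neg {a : ℝ} (ha : 0 < a) :
    IntegrableOn (fun t : ℝ => t ^ (a - 1) * Real.exp (-t)) (Set.Ioi 0) := by
  simpa [mul_comm] using Real.GammaIntegral_convergent ha

/-- The integrand `t^{a-1} e^{-(1+iv)t}`. -/
noncomputable def gammaIntegrand (a v t : ℝ) : ℂ :=
  ((t ^ (a - 1) * Real.exp (-t) : ℝ) : ℂ) * Complex.exp (-(v * t : ℝ) * Complex.I)

lemma norm_gammaIntegrand (a v t : ℝ) :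
    ‖gammaIntegrand a v t‖ = ‖t ^ (a - 1) * Real.exp (-t)‖ := by
  rw [gammaIntegrand, norm_mul, Complex.norm_real, ← Complex.ofReal_neg,
    Complex.norm_exp_ofReal_mul_I, mul_one]

lemma integrableOn_gammaIntegrand {a : ℝ} (ha : 0 < a) (v : ℝ) :
    IntegrableOn (gammaIntegrand a v) (Set.Ioi 0) := by
  have h := integrableOn_rpow_mul_exp_neg ha
  refine Integrable.mono h ?_ (Eventually.of_forall fun t => (norm_gammaIntegrand a v t).le)
  exact (Complex.continuous_ofReal.comp_aestronglyMeasurable h.1).mul (Continuous.aestronglyMeasurable (by fun_prop))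

lemma mul_gammaIntegrand (a v : ℝ) {t : ℝ} (ht : 0 < t) :
    (t : ℂ) * gammaIntegrand a v t = gammaIntegrand (a + 1) v t := by
  have : t ^ (a + 1 - 1) = t * t ^ (a - 1) := by
    rw [add_sub_cancel_right, Real.rpow_sub_one ht.ne', mul_div_cancel₀ _ ht.ne']
  rw [gammaIntegrand, gammaIntegrand, this]
  push_cast; ring

/-- Integration by parts: the total derivative of t^a e^{-(1+iv)t} integrates to zero on the
half-line. -/
lemma integral_gammaIntegrand_succ {a : ℝ} (ha : 0 < a) (v : ℝ) :
    (1 + v * Complex.I) * ∫ t in Set.Ioi 0, gammaIntegrand (a + 1) v t =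
      a * ∫ t in Set.Ioi 0, gammaIntegrand a v t := by
  have hd : ∀ t ∈ Set.Ioi (0 : ℝ), HasDerivAt (gammaIntegrand (a + 1) v)
      (a * gammaIntegrand a v t - (1 + v * Complex.I) * gammaIntegrand (a + 1) v t) t := by
    intro t ht
    have ht' : 0 < t := ht
    have h1 : HasDerivAt (fun t : ℝ => t ^ (a + 1 - 1) * Real.exp (-t))
        ((a + 1 - 1) * t ^ (a + 1 - 1 - 1) * Real.exp (-t) +
          t ^ (a + 1 - 1) * (Real.exp (-t) * -1)) t :=
      (Real.hasDerivAt_rpow_const (Or.inl ht'.ne')).mul (hasDerivAt_neg t).exp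
    have h2 : HasDerivAt (fun t : ℝ => Complex.exp (-(v * t : ℝ) * Complex.I))
        (Complex.exp (-(v * t : ℝ) * Complex.I) * (-(v : ℂ) * Complex.I)) t := by
      refine HasDerivAt.cexp ?_
      have := ((Complex.ofRealCLM.hasDerivAt (x := t)).const_mul (-(v : ℂ))).mul_const Complex.I
      refine (this.congr_deriv ?_).congr_of_eventuallyEq (Eventually.of_forall fun t => ?_)
      · simp
      · simp
    refine (h1.ofReal_comp.mul h2).congr_deriv ?_
    simp only [gammaIntegrand, add_sub_cancel_right]
    push_cast
    ring
  have h0 : ContinuousWithinAt (gammaIntegrand (a + 1) v) (Set.Ici 0) 0 := by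
    unfold gammaIntegrand
    have : ContinuousAt (fun t : ℝ => t ^ (a + 1 - 1)) 0 :=
      Real.continuousAt_rpow_const _ _ (Or.inr (by linarith))
    refine ContinuousAt.continuousWithinAt ?_
    refine ContinuousAt.mul ?_ (by fun_prop)
    exact Complex.continuous_ofReal.continuousAt.comp (this.mul (by fun_prop))
  have hlim : Tendsto (gammaIntegrand (a + 1) v) atTop (𝓝 0) := by
    rw [tendsto_zero_iff_norm_tendsto_zero]
    simp_rw [norm_gammaIntegrand]
    have := tendsto_rpow_mul_exp_neg_mul_atTop_nhds_zero (a + 1 - 1) 1 one_pos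
    simpa using this.norm
  have i1 := integrableOn_gammaIntegrand ha v
  have i2 := integrableOn_gammaIntegrand (a := a + 1) (by linarith) v
  have key := integral_Ioi_of_hasDerivAt_of_tendsto h0 hd
    ((i1.const_mul (a : ℂ)).sub (i2.const_mul (1 + v * Complex.I))) hlim
  rw [integral_sub (i1.const_mul _) (i2.const_mul _), integral_const_mul, integral_const_mul]
    at key
  have hz : gammaIntegrand (a + 1) v 0 = 0 := by
    simp [gammaIntegrand, Real.zero_rpow ha.ne']
  rw [hz] at key
  linear_combination -key

lemma hasDerivAt_integral_gammaIntegrand {a : ℝ} (ha : 0 < a) (v : ℝ) :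
    HasDerivAt (fun v => ∫ t in Set.Ioi 0, gammaIntegrand a v t)
      (-Complex.I * ∫ t in Set.Ioi 0, gammaIntegrand (a + 1) v t) v := by
  have key := hasDerivAt_integral_of_dominated_loc_of_deriv_le (𝕜 := ℝ)
    (μ := volume.restrict (Set.Ioi (0 : ℝ))) (F := fun v t => gammaIntegrand a v t)
    (F' := fun v t => -Complex.I * gammaIntegrand (a + 1) v t) (x₀ := v) (s := Set.univ)
    (bound := fun t => ‖t ^ (a + 1 - 1) * Real.exp (-t)‖) univ_mem
    (Eventually.of_forall fun v => (integrableOn_gammaIntegrand ha v).1)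
    (integrableOn_gammaIntegrand ha v)
    ((integrableOn_gammaIntegrand (a := a + 1) (by linarith) v).const_mul _).1
    (Eventually.of_forall fun t v _ => by simp [norm_gammaIntegrand])
    (integrableOn_rpow_mul_exp_neg (a := a + 1) (by linarith)).norm ?_
  · rw [← integral_const_mul]; exact key.2
  · filter_upwards [ae_restrict_mem measurableSet_Ioi] with t ht v _
    rw [← mul_gammaIntegrand a v ht]
    have := (((Complex.ofRealCLM.hasDerivAt (x := v)).const_mul (-(t : ℂ))).mul_const
      Complex.I).cexp.const_mul ((t ^ (a - 1) * Real.exp (-t) : ℝ) : ℂ)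
    refine (this.congr_deriv ?_).congr_of_eventuallyEq (Eventually.of_forall fun v => ?_)
    · simp only [gammaIntegrand, Complex.ofRealCLM_apply]
      push_cast
      ring_nf
    · simp only [gammaIntegrand, Complex.ofRealCLM_apply]
      push_cast
      ring_nf

/-- The product of the integral with (1 + iv)^a has zero derivative in v: differentiating under the
integral raises a by one, and integration by parts undoes this. The value at v = 0 is Γ(a). -/
lemma integral_gammaIntegrand {a : ℝ} (ha : 0 < a) (v : ℝ) :
    ∫ t in Set.Ioi 0, gammaIntegrand a v t =
      Real.Gamma a * (1 + v * Complex.I) ^ (-(a : ℂ)) := by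
  set E : ℝ → ℂ := fun v => ∫ t in Set.Ioi 0, gammaIntegrand a v t with hE
  have hd : ∀ v, HasDerivAt (fun v : ℝ => (1 + v * Complex.I) ^ (a : ℂ) * E v) 0 v := by
    intro v
    have h1 : HasDerivAt (fun v : ℝ => 1 + (v : ℂ) * Complex.I) Complex.I v := by
      simpa using ((Complex.ofRealCLM.hasDerivAt (x := v)).mul_const Complex.I).const_add 1
    have h2 := ((Complex.hasStrictDerivAt_cpow_const (c := (a : ℂ))
      (one_add_mul_I_mem_slitPlane v)).hasDerivAt.comp v h1).mul
      (hasDerivAt_integral_gammaIntegrand ha v)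
    refine h2.congr_deriv ?_
    have h3 := integral_gammaIntegrand_succ ha v
    have hz := one_add_mul_I_ne_zero v
    have h4 : (1 + v * Complex.I) ^ (a : ℂ) = (1 + v * Complex.I) ^ ((a : ℂ) - 1) *
        (1 + v * Complex.I) := by
      rw [Complex.cpow_sub _ _ hz, Complex.cpow_one, div_mul_cancel₀ _ hz]
    simp only [Function.comp_apply]
    rw [h4]
    linear_combination (-Complex.I * (1 + v * Complex.I) ^ ((a : ℂ) - 1)) * h3
  have hc := is_const_of_deriv_eq_zero (fun v => (hd v).differentiableAt)
    (fun v => (hd v).deriv) v 0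
  have h0 : E 0 = Real.Gamma a := by
    rw [hE, Real.Gamma_eq_integral ha, ← integral_complex_ofReal]
    refine integral_congr_ae (Eventually.of_forall fun t => ?_)
    simp only [gammaIntegrand, zero_mul, Complex.ofReal_zero, neg_zero, Complex.exp_zero, mul_one]
    rw [mul_comm]
  have hz := one_add_mul_I_ne_zero v
  change E v = _
  simp only [h0, Complex.ofReal_zero, zero_mul, add_zero, Complex.one_cpow, one_mul] at hc
  rw [Complex.cpow_neg, ← hc]
  have : (1 + v * Complex.I) ^ (a : ℂ) ≠ 0 := by
    rw [Complex.cpow_def_of_ne_zero hz]; exact Complex.exp_ne_zero _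
  field_simp

/-! ### Cauchy's beta integral -/

/-- The integrand of Cauchy's beta integral. -/
noncomputable def cauchyIntegrand (x y u : ℝ) : ℂ :=
  (1 - u * Complex.I) ^ (-(x : ℂ)) * (1 + u * Complex.I) ^ (-(y : ℂ))

/-- Cauchy's beta integral. -/
noncomputable def cauchyBeta (x y : ℝ) : ℂ := ∫ u, cauchyIntegrand x y u

lemma one_sub_mul_I_eq (u : ℝ) : 1 - (u : ℂ) * Complex.I = 1 + (-u : ℝ) * Complex.I := by
  push_cast; ring

lemma norm_one_add_mul_I_cpow (u x : ℝ) :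
    ‖(1 + u * Complex.I) ^ (-(x : ℂ))‖ = (1 + u ^ 2) ^ (-x / 2) := by
  rw [← Complex.ofReal_neg, Complex.norm_cpow_real]
  have := Complex.norm_add_mul_I 1 u
  rw [Complex.ofReal_one] at this
  rw [this, Real.sqrt_eq_rpow, ← Real.rpow_mul (by positivity)]
  congr 1 <;> ring

lemma norm_cauchyIntegrand (x y u : ℝ) :
    ‖cauchyIntegrand x y u‖ = (1 + u ^ 2) ^ (-(x + y) / 2) := by
  rw [cauchyIntegrand, norm_mul, one_sub_mul_I_eq, norm_one_add_mul_I_cpow,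
    norm_one_add_mul_I_cpow, neg_sq, ← Real.rpow_add (by positivity)]
  congr 1; ring

lemma continuous_one_add_mul_I_cpow (x : ℝ) :
    Continuous fun u : ℝ => (1 + u * Complex.I) ^ (-(x : ℂ)) :=
  Continuous.cpow (by fun_prop) continuous_const fun u => one_add_mul_I_mem_slitPlane u

lemma continuous_cauchyIntegrand (x y : ℝ) : Continuous (cauchyIntegrand x y) := by
  unfold cauchyIntegrand
  simp_rw [one_sub_mul_I_eq]
  exact ((continuous_one_add_mul_I_cpow x).comp continuous_neg).mul
    (continuous_one_add_mul_I_cpow y)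

lemma integrable_cauchyIntegrand {x y : ℝ} (h : 1 < x + y) : Integrable (cauchyIntegrand x y) := by
  have h1 := integrable_rpow_neg_one_add_norm_sq (E := ℝ) (μ := volume) (r := x + y) (by simpa)
  refine h1.mono (continuous_cauchyIntegrand x y).aestronglyMeasurable
    (Eventually.of_forall fun u => ?_)
  rw [norm_cauchyIntegrand, Real.norm_of_nonneg (by positivity), Real.norm_eq_abs, sq_abs]

lemma tendsto_cauchyIntegrand {x y : ℝ} (h : 0 < x + y) {l : Filter ℝ}
    (hl : Tendsto (fun u : ℝ => |u|) l atTop) : Tendsto (cauchyIntegrand x y) l (𝓝 0) := by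
  rw [tendsto_zero_iff_norm_tendsto_zero]
  simp_rw [norm_cauchyIntegrand]
  have h1 : Tendsto (fun u : ℝ => 1 + u ^ 2) l atTop := by
    refine tendsto_atTop_add_const_left _ _ ?_
    have := (tendsto_pow_atTop (α := ℝ) two_ne_zero).comp hl
    simpa [Function.comp_def] using this
  have h2 := (tendsto_rpow_neg_atTop (y := (x + y) / 2) (by linarith)).comp h1
  refine h2.congr fun u => ?_
  simp only [Function.comp_apply]
  congr 1; ring

lemma cpow_neg_add_one {z : ℂ} (hz : z ≠ 0) (x : ℝ) :
    z ^ (-((x + 1 : ℝ) : ℂ)) * z = z ^ (-(x : ℂ)) := by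
  rw [show -(x : ℂ) = -((x + 1 : ℝ) : ℂ) + 1 by push_cast; ring, Complex.cpow_add _ _ hz,
    Complex.cpow_one]

/-- Integrate the derivative of (1-iu)^{-x} (1+iu)^{1-y}, which tends to 0 at both ends because x +
y > 1, and write 1 + iu = 2 - (1 - iu). -/
lemma cauchyBeta_succ_left {x y : ℝ} (h : 1 < x + y) :
    ((x + y - 1 : ℝ) : ℂ) * cauchyBeta x y = 2 * x * cauchyBeta (x + 1) y := by
  have hd : ∀ u, HasDerivAt (cauchyIntegrand x (y - 1)) (Complex.I *
      (2 * x * cauchyIntegrand (x + 1) y u - ((x + y - 1 : ℝ) : ℂ) * cauchyIntegrand x y u)) u := by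
    intro u
    have hz2 := one_add_mul_I_ne_zero u
    have hz1 : 1 - (u : ℂ) * Complex.I ≠ 0 := by
      rw [one_sub_mul_I_eq]; exact one_add_mul_I_ne_zero _
    have hs1 : 1 - (u : ℂ) * Complex.I ∈ Complex.slitPlane := by
      rw [one_sub_mul_I_eq]; exact one_add_mul_I_mem_slitPlane _
    have h2 : HasDerivAt (fun v : ℝ => 1 + (v : ℂ) * Complex.I) Complex.I u := by
      simpa using ((Complex.ofRealCLM.hasDerivAt (x := u)).mul_const Complex.I).const_add 1
    have h1 : HasDerivAt (fun v : ℝ => 1 - (v : ℂ) * Complex.I) (-Complex.I) u := by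
      simpa using ((Complex.ofRealCLM.hasDerivAt (x := u)).mul_const Complex.I).const_sub 1
    have d1 := (Complex.hasStrictDerivAt_cpow_const (c := -(x : ℂ)) hs1).hasDerivAt.comp u h1
    have d2 := (Complex.hasStrictDerivAt_cpow_const (c := -((y - 1 : ℝ) : ℂ))
      (one_add_mul_I_mem_slitPlane u)).hasDerivAt.comp u h2
    refine (d1.mul d2).congr_deriv ?_
    simp only [Function.comp_apply, cauchyIntegrand]
    have e1 := cpow_neg_add_one hz1 x
    have e2 := cpow_neg_add_one hz2 (y - 1)
    rw [sub_add_cancel] at e2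
    have e3 : -(x : ℂ) - 1 = -((x + 1 : ℝ) : ℂ) := by push_cast; ring
    have e4 : -((y - 1 : ℝ) : ℂ) - 1 = -(y : ℂ) := by push_cast; ring
    rw [e3, e4, ← e2, ← e1]
    push_cast
    ring
  have i1 := integrable_cauchyIntegrand h
  have i2 := integrable_cauchyIntegrand (x := x + 1) (y := y) (by linarith)
  have key := integral_of_hasDerivAt_of_tendsto hd
    (((i2.const_mul (2 * (x : ℂ))).sub (i1.const_mul ((x + y - 1 : ℝ) : ℂ))).const_mul Complex.I)
    (tendsto_cauchyIntegrand (by linarith) tendsto_abs_atBot_atTop)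
    (tendsto_cauchyIntegrand (by linarith) tendsto_abs_atTop_atTop)
  rw [integral_const_mul, integral_sub (i2.const_mul _) (i1.const_mul _), integral_const_mul,
    integral_const_mul, sub_zero, mul_eq_zero, or_iff_right Complex.I_ne_zero, sub_eq_zero] at key
  exact key.symm

lemma cauchyBeta_symm (x y : ℝ) : cauchyBeta x y = cauchyBeta y x := by
  rw [cauchyBeta, ← integral_neg_eq_self]
  refine integral_congr_ae (Eventually.of_forall fun u => ?_)
  simp only [cauchyIntegrand]
  push_cast
  rw [mul_comm, neg_mul, sub_neg_eq_add, ← sub_eq_add_neg]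

/-- The density `t^{a-1} e^{-t}` on the positive half-line. -/
noncomputable def gammaDensity (a : ℝ) : ℝ → ℂ :=
  (Set.Ioi 0).indicator fun t => ((t ^ (a - 1) * Real.exp (-t) : ℝ) : ℂ)

lemma integrable_gammaDensity {a : ℝ} (ha : 0 < a) : Integrable (gammaDensity a) :=
  (integrable_indicator_iff measurableSet_Ioi).2 (integrableOn_rpow_mul_exp_neg ha).ofReal

open scoped FourierTransform in
lemma fourier_gammaDensity {a : ℝ} (ha : 0 < a) (w : ℝ) :
    𝓕 (gammaDensity a) w =
      Real.Gamma a * (1 + (2 * Real.pi * w : ℝ) * Complex.I) ^ (-(a : ℂ)) := by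
  rw [Real.fourier_real_eq_integral_exp_smul, ← integral_gammaIntegrand ha,
    ← integral_indicator measurableSet_Ioi]
  refine integral_congr_ae (Eventually.of_forall fun t => ?_)
  simp only [gammaDensity, Set.indicator_apply]
  split_ifs
  · simp only [gammaIntegrand, smul_eq_mul]
    rw [mul_comm]
    congr 2
    push_cast
    ring
  · simp

-- Parseval for two Gamma densities. On the frequency side, reflecting the first transform gives the
-- factor (1-iu)^{-x}; on the other side the product of densities integrates to 2^{1-x-y} Γ(x+y-1).
-- Here x > 1 makes the first transform integrable, so Fourier inversion recovers its density at
-- every t > 0.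
open scoped FourierTransform in
lemma cauchyBeta_of_one_lt {x y : ℝ} (hx : 1 < x) (hy : 0 < y) :
    Real.Gamma x * Real.Gamma y * cauchyBeta x y =
      2 * Real.pi * (2 ^ (1 - x - y) * Real.Gamma (x + y - 1) : ℝ) := by
  have hx0 : 0 < x := by linarith
  have hpi := Real.pi_pos
  set h : ℝ → ℂ := fun w => 𝓕 (gammaDensity x) (-w) with hh
  have hF : Integrable (𝓕 (gammaDensity x)) := by
    rw [show 𝓕 (gammaDensity x) = _ from funext (fourier_gammaDensity hx0)]
    have h0 := integrable_rpow_neg_one_add_norm_sq (E := ℝ) (μ := volume) (r := x) (by simpa)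
    have h1 : Integrable fun u : ℝ => (1 + (u : ℂ) * Complex.I) ^ (-(x : ℂ)) := by
      refine h0.mono (continuous_one_add_mul_I_cpow x).aestronglyMeasurable
        (Eventually.of_forall fun u => ?_)
      rw [norm_one_add_mul_I_cpow, Real.norm_of_nonneg (by positivity), Real.norm_eq_abs, sq_abs]
    exact (h1.comp_mul_left' (R := 2 * Real.pi) (by positivity)).const_mul _
  have hh_int : Integrable h := hF.comp_neg
  have flip := VectorFourier.integral_fourierIntegral_smul_eq_flip (L := innerₗ ℝ)
    Real.continuous_fourierChar continuous_inner hh_int (integrable_gammaDensity hy)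
  have e1 : ∀ t, VectorFourier.fourierIntegral Real.fourierChar volume (innerₗ ℝ) h t =
      𝓕⁻ (𝓕 (gammaDensity x)) t := fun t => by
    rw [Real.fourierInv_eq_fourier_comp_neg]; rfl
  have e2 : ∀ w, VectorFourier.fourierIntegral Real.fourierChar volume (innerₗ ℝ).flip
      (gammaDensity y) w = 𝓕 (gammaDensity y) w := fun w => by
    simp; rfl
  have lhs : ∫ t, VectorFourier.fourierIntegral Real.fourierChar volume (innerₗ ℝ) h t •
      gammaDensity y t = (2 ^ (1 - x - y) * Real.Gamma (x + y - 1) : ℝ) := by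
    have e3 : ∀ t, VectorFourier.fourierIntegral Real.fourierChar volume (innerₗ ℝ) h t •
        gammaDensity y t = (Set.Ioi 0).indicator
          (fun t : ℝ => ((t ^ (x + y - 1 - 1) * Real.exp (-(2 * t)) : ℝ) : ℂ)) t := by
      intro t
      by_cases ht : t ∈ Set.Ioi (0 : ℝ)
      · have ht' : 0 < t := ht
        rw [e1, (integrable_gammaDensity hx0).fourierInv_fourier_eq hF]
        · simp only [gammaDensity, Set.indicator_of_mem ht, smul_eq_mul]
          norm_cast
          rw [show x + y - 1 - 1 = (x - 1) + (y - 1) by ring, Real.rpow_add ht',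
            show -(2 * t) = -t + -t by ring, Real.exp_add]
          ring
        · have : gammaDensity x =ᶠ[𝓝 t] fun t => ((t ^ (x - 1) * Real.exp (-t) : ℝ) : ℂ) := by
            filter_upwards [Ioi_mem_nhds ht'] with z hz
            exact Set.indicator_of_mem hz _
          rw [continuousAt_congr this]
          refine Complex.continuous_ofReal.continuousAt.comp (ContinuousAt.mul ?_ (by fun_prop))
          exact Real.continuousAt_rpow_const _ _ (Or.inl ht'.ne')
      · simp [gammaDensity, ht]
    rw [integral_congr_ae (Eventually.of_forall e3), integral_indicator measurableSet_Ioi,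
      integral_complex_ofReal, Real.integral_rpow_mul_exp_neg_mul_Ioi (by linarith) two_pos,
      one_div, Real.inv_rpow two_pos.le, ← Real.rpow_neg two_pos.le]
    congr 3; ring
  rw [lhs] at flip
  have rhs : ∀ w, h w • VectorFourier.fourierIntegral Real.fourierChar volume (innerₗ ℝ).flip
      (gammaDensity y) w = Real.Gamma x * Real.Gamma y * cauchyIntegrand x y (2 * Real.pi * w) := by
    intro w
    rw [e2, hh]
    simp only [smul_eq_mul]
    rw [fourier_gammaDensity hx0, fourier_gammaDensity hy, cauchyIntegrand, one_sub_mul_I_eq]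
    rw [mul_neg]
    ring
  rw [integral_congr_ae (Eventually.of_forall rhs), integral_const_mul,
    Measure.integral_comp_mul_left (cauchyIntegrand x y)] at flip
  rw [flip, cauchyBeta, abs_of_pos (by positivity), Complex.real_smul]
  have : (Real.pi : ℂ) ≠ 0 := by exact_mod_cast hpi.ne'
  push_cast
  field_simp

/-- Since Γ takes the value 0 at its poles, `(Real.Gamma x)⁻¹` is the entire function 1/Γ there too,
and the functional equation has no exceptions. -/
lemma Gamma_inv_succ (x : ℝ) : (Real.Gamma x)⁻¹ = x * (Real.Gamma (x + 1))⁻¹ := by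
  by_cases hx : x = 0
  · simp [hx]
  · rw [Real.Gamma_add_one hx]
    field_simp

/-- The value of Cauchy's beta integral. -/
noncomputable def cauchyValue (x y : ℝ) : ℝ :=
  2 * Real.pi * 2 ^ (1 - x - y) * Real.Gamma (x + y - 1) * (Real.Gamma x)⁻¹ * (Real.Gamma y)⁻¹

lemma cauchyValue_succ_left {x y : ℝ} (h : 1 < x + y) :
    (x + y - 1) * cauchyValue x y = 2 * x * cauchyValue (x + 1) y := by
  have h1 : Real.Gamma (x + 1 + y - 1) = (x + y - 1) * Real.Gamma (x + y - 1) := by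
    rw [← Real.Gamma_add_one (by linarith)]; congr 1; ring
  have h2 : (2 : ℝ) ^ (1 - x - y) = 2 * 2 ^ (1 - (x + 1) - y) := by
    rw [show 1 - x - y = 1 + (1 - (x + 1) - y) by ring, Real.rpow_add two_pos, Real.rpow_one]
  rw [cauchyValue, cauchyValue, h1, h2, Gamma_inv_succ x]
  ring

lemma cauchyValue_symm (x y : ℝ) : cauchyValue x y = cauchyValue y x := by
  simp only [cauchyValue]
  rw [show x + y - 1 = y + x - 1 by ring, show 1 - x - y = 1 - y - x by ring]
  ring

lemma cauchyBeta_eq_of_add_nat {x y : ℝ} (h : 1 < x + y) (n : ℕ)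
    (hn : cauchyBeta (x + n) y = cauchyValue (x + n) y) : cauchyBeta x y = cauchyValue x y := by
  induction n with
  | zero => simpa using hn
  | succ n ih =>
    refine ih ?_
    have h' : 1 < x + n + y := by
      have : (0 : ℝ) ≤ n := n.cast_nonneg
      linarith
    have e1 := cauchyBeta_succ_left h'
    have e2 := cauchyValue_succ_left h'
    have e2' : ((x + n + y - 1 : ℝ) : ℂ) * (cauchyValue (x + n) y : ℂ) =
        2 * (x + n : ℝ) * (cauchyValue (x + n + 1) y : ℂ) := by exact_mod_cast e2
    have e3 : x + ((n + 1 : ℕ) : ℝ) = x + n + 1 := by push_cast; ring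
    rw [e3] at hn
    rw [hn, ← e2'] at e1
    have h0 : ((x + n + y - 1 : ℝ) : ℂ) ≠ 0 := by
      exact_mod_cast (by linarith : (0 : ℝ) < x + n + y - 1).ne'
    exact mul_left_cancel₀ h0 e1

/-- Both sides obey the same recurrence in each variable, with the factor x + y - 1 non-zero while x
+ y > 1. This brings both parameters above 1, where Parseval applies; x or y alone may be negative.
-/
lemma cauchyBeta_eq {x y : ℝ} (h : 1 < x + y) : cauchyBeta x y = cauchyValue x y := by
  obtain ⟨p, hp⟩ := exists_nat_gt (1 - x)
  obtain ⟨q, hq⟩ := exists_nat_gt (1 - y)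
  have hp0 : (0 : ℝ) ≤ p := p.cast_nonneg
  refine cauchyBeta_eq_of_add_nat h p ?_
  rw [cauchyBeta_symm, cauchyValue_symm]
  refine cauchyBeta_eq_of_add_nat (by linarith) q ?_
  have hx : 1 < y + q := by linarith
  have hy : 1 < x + p := by linarith
  have key := cauchyBeta_of_one_lt hx (by linarith : 0 < x + p)
  have g1 : (Real.Gamma (y + q) : ℂ) ≠ 0 := by
    exact_mod_cast (Real.Gamma_pos_of_pos (by linarith)).ne'
  have g2 : (Real.Gamma (x + p) : ℂ) ≠ 0 := by
    exact_mod_cast (Real.Gamma_pos_of_pos (by linarith)).ne'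
  rw [cauchyValue]
  push_cast at key ⊢
  field_simp
  linear_combination key


/-! ### Monomials -/

/-- Factor u + i = i(1 - iu). As 1 - iu has positive real part, the two arguments add up without
crossing the cut of the logarithm. -/
lemma om_one_zpow {m : ℕ} (a : ℤ) (u : ℝ) :
    om m u 1 ^ a = Complex.exp (Complex.I * ((Real.pi / 2 * ((a : ℝ) / m) : ℝ) : ℂ)) *
      (1 - u * Complex.I) ^ (-((-(a : ℝ) / m : ℝ) : ℂ)) := by
  have hz : 1 - (u : ℂ) * Complex.I ≠ 0 := by
    rw [one_sub_mul_I_eq]; exact one_add_mul_I_ne_zero _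
  have hz2 : (u : ℂ) + (1 : ℝ) * Complex.I ≠ 0 := add_mul_I_ne_zero u one_pos
  have e0 : (u : ℂ) + (1 : ℝ) * Complex.I = Complex.I * (1 - u * Complex.I) := by
    push_cast; linear_combination (u : ℂ) * Complex.I_sq
  have hre : 0 < (1 - (u : ℂ) * Complex.I).re := by simp
  have harg := abs_lt.1 (Complex.abs_arg_lt_pi_div_two_iff.2 (Or.inl hre))
  have hlog : Complex.log (Complex.I * (1 - u * Complex.I)) =
      Complex.log Complex.I + Complex.log (1 - u * Complex.I) := by
    refine Complex.log_mul Complex.I_ne_zero hz ?_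
    rw [Complex.arg_I]
    constructor <;> linarith [Real.pi_pos, harg.1, harg.2]
  rw [om, ← Complex.cpow_mul_int, e0, Complex.cpow_def_of_ne_zero (e0 ▸ hz2), hlog,
    Complex.log_I, Complex.cpow_def_of_ne_zero hz, ← Complex.exp_add]
  congr 1
  push_cast
  ring

lemma conj_om_one_zpow {m : ℕ} (b : ℤ) (u : ℝ) :
    (starRingEnd ℂ) (om m u 1) ^ b =
      Complex.exp (-Complex.I * ((Real.pi / 2 * ((b : ℝ) / m) : ℝ) : ℂ)) *
      (1 + u * Complex.I) ^ (-((-(b : ℝ) / m : ℝ) : ℂ)) := by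
  rw [← map_zpow₀, om_one_zpow, map_mul, ← Complex.exp_conj]
  congr 1
  · rw [map_mul, Complex.conj_I, Complex.conj_ofReal]
  · have : (1 + (u : ℂ) * Complex.I) = (starRingEnd ℂ) (1 - u * Complex.I) := by
      simp
    rw [this, Complex.conj_cpow _ _ ?_]
    · rw [map_neg, Complex.conj_ofReal]
    · rw [one_sub_mul_I_eq]
      exact Complex.slitPlane_arg_ne_pi (one_add_mul_I_mem_slitPlane _)

/-- The phase `e^{iπ(y-x)/2}` with `x = -a/m`, `y = -b/m`. -/
noncomputable def phase (m : ℕ) (a b : ℤ) : ℂ :=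
  Complex.exp (Complex.I * ((Real.pi / 2 * (-(b : ℝ) / m - -(a : ℝ) / m) : ℝ) : ℂ))

/-- The coefficient of the leading singularity of the `N`-th derivative of `Φ_{a,b}(1)`. -/
noncomputable def leadCoeff (m N : ℕ) (a b : ℤ) : ℂ :=
  phase m a b * (((-1) ^ N * (2 * Real.pi * 2 ^ (1 - -(a : ℝ) / m - -(b : ℝ) / m) *
    Real.Gamma (-(a : ℝ) / m + -(b : ℝ) / m - 1 + N) * (Real.Gamma (-(a : ℝ) / m))⁻¹ *
      (Real.Gamma (-(b : ℝ) / m))⁻¹) : ℝ) : ℂ)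

lemma integral_om_one {m : ℕ} (hm : 1 ≤ m) {a b : ℤ} (hab : a + b < -m) :
    ∫ u, om m u 1 ^ a * (starRingEnd ℂ) (om m u 1) ^ b = leadCoeff m 0 a b := by
  have hm' : (0 : ℝ) < m := by exact_mod_cast hm
  have hxy : 1 < -(a : ℝ) / m + -(b : ℝ) / m := by
    rw [← add_div, lt_div_iff₀ hm', one_mul]
    have : (a + b : ℝ) < -m := by exact_mod_cast hab
    linarith
  have e : ∀ u : ℝ, om m u 1 ^ a * (starRingEnd ℂ) (om m u 1) ^ b =
      phase m a b * cauchyIntegrand (-(a : ℝ) / m) (-(b : ℝ) / m) u := by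
    intro u
    rw [om_one_zpow, conj_om_one_zpow, cauchyIntegrand, phase, mul_mul_mul_comm, ← Complex.exp_add]
    congr 2
    push_cast
    ring
  simp_rw [e]
  rw [integral_const_mul]
  have := cauchyBeta_eq hxy
  rw [cauchyBeta] at this
  rw [this, leadCoeff, cauchyValue]
  push_cast
  ring_nf

lemma phase_sub_left {m : ℕ} (hm : 1 ≤ m) (a b : ℤ) :
    phase m (a - m) b = -Complex.I * phase m a b := by
  have hm' : (m : ℂ) ≠ 0 := by exact_mod_cast (by omega : m ≠ 0)
  rw [phase, phase, ← Complex.exp_neg_pi_div_two_mul_I, ← Complex.exp_add]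
  congr 1
  push_cast
  field_simp
  ring

lemma phase_sub_right {m : ℕ} (hm : 1 ≤ m) (a b : ℤ) :
    phase m a (b - m) = Complex.I * phase m a b := by
  have hm' : (m : ℂ) ≠ 0 := by exact_mod_cast (by omega : m ≠ 0)
  rw [phase, phase]
  nth_rewrite 2 [← Complex.exp_pi_div_two_mul_I]
  rw [← Complex.exp_add]
  congr 1
  push_cast
  field_simp
  ring

/-- This mirrors `iteratedDerivWithin_succ_Phi_one`. Lowering a or b by m raises x or y by one and
multiplies the phase by -i or i. After `Gamma_inv_succ` the two terms coincide, and the resulting 2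
is absorbed in the power of two. The formula thus makes sense also where the undifferentiated full
integral diverges. -/
lemma leadCoeff_succ {m : ℕ} (hm : 1 ≤ m) (N : ℕ) (a b : ℤ) :
    leadCoeff m (N + 1) a b =
      Complex.I / m * (a * leadCoeff m N (a - m) b - b * leadCoeff m N a (b - m)) := by
  have hm' : (m : ℝ) ≠ 0 := by exact_mod_cast (by omega : m ≠ 0)
  have hmc : (m : ℂ) ≠ 0 := by exact_mod_cast (by omega : m ≠ 0)
  set x : ℝ := -(a : ℝ) / m with hx
  set y : ℝ := -(b : ℝ) / m with hy
  have hx' : -((a - m : ℤ) : ℝ) / m = x + 1 := by rw [hx]; push_cast; field_simp; ring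
  have hy' : -((b - m : ℤ) : ℝ) / m = y + 1 := by rw [hy]; push_cast; field_simp; ring
  have ha : (a : ℂ) = -(x : ℂ) * m := by rw [hx]; push_cast; field_simp
  have hb : (b : ℂ) = -(y : ℂ) * m := by rw [hy]; push_cast; field_simp
  simp only [leadCoeff]
  rw [phase_sub_left hm, phase_sub_right hm, hx', hy', ← hx, ← hy]
  have h2 : (2 : ℝ) ^ (1 - x - y) = 2 * 2 ^ (1 - (x + 1) - y) := by
    rw [show 1 - x - y = 1 + (1 - (x + 1) - y) by ring, Real.rpow_add two_pos, Real.rpow_one]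
  rw [show 1 - x - (y + 1) = 1 - (x + 1) - y by ring, h2,
    show x + (y + 1) - 1 + (N : ℝ) = x + y - 1 + ((N + 1 : ℕ) : ℝ) by push_cast; ring,
    show x + 1 + y - 1 + (N : ℝ) = x + y - 1 + ((N + 1 : ℕ) : ℝ) by push_cast; ring]
  have gx := Gamma_inv_succ x
  have gy := Gamma_inv_succ y
  have key : (-1 : ℝ) ^ (N + 1) * (2 * Real.pi * (2 * 2 ^ (1 - (x + 1) - y)) *
      Real.Gamma (x + y - 1 + ((N + 1 : ℕ) : ℝ)) * (Real.Gamma x)⁻¹ * (Real.Gamma y)⁻¹) =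
      -x * ((-1) ^ N * (2 * Real.pi * 2 ^ (1 - (x + 1) - y) *
        Real.Gamma (x + y - 1 + ((N + 1 : ℕ) : ℝ)) * (Real.Gamma (x + 1))⁻¹ * (Real.Gamma y)⁻¹)) +
      -y * ((-1) ^ N * (2 * Real.pi * 2 ^ (1 - (x + 1) - y) *
        Real.Gamma (x + y - 1 + ((N + 1 : ℕ) : ℝ)) * (Real.Gamma x)⁻¹ *
          (Real.Gamma (y + 1))⁻¹)) := by
    have h3 : -x * ((-1) ^ N * (2 * Real.pi * 2 ^ (1 - (x + 1) - y) *
        Real.Gamma (x + y - 1 + ((N + 1 : ℕ) : ℝ)) * (Real.Gamma (x + 1))⁻¹ * (Real.Gamma y)⁻¹)) =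
        -((-1) ^ N * (2 * Real.pi * 2 ^ (1 - (x + 1) - y) *
        Real.Gamma (x + y - 1 + ((N + 1 : ℕ) : ℝ)) * (x * (Real.Gamma (x + 1))⁻¹) *
          (Real.Gamma y)⁻¹)) := by ring
    have h4 : -y * ((-1) ^ N * (2 * Real.pi * 2 ^ (1 - (x + 1) - y) *
        Real.Gamma (x + y - 1 + ((N + 1 : ℕ) : ℝ)) * (Real.Gamma x)⁻¹ * (Real.Gamma (y + 1))⁻¹)) =
        -((-1) ^ N * (2 * Real.pi * 2 ^ (1 - (x + 1) - y) *
        Real.Gamma (x + y - 1 + ((N + 1 : ℕ) : ℝ)) * (Real.Gamma x)⁻¹ *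
          (y * (Real.Gamma (y + 1))⁻¹))) := by ring
    rw [h3, h4, ← gx, ← gy]
    ring
  rw [key, ha, hb]
  generalize (-1 : ℝ) ^ N * (2 * Real.pi * 2 ^ (1 - (x + 1) - y) *
    Real.Gamma (x + y - 1 + ((N + 1 : ℕ) : ℝ)) * (Real.Gamma (x + 1))⁻¹ * (Real.Gamma y)⁻¹) = A
  generalize (-1 : ℝ) ^ N * (2 * Real.pi * 2 ^ (1 - (x + 1) - y) *
    Real.Gamma (x + y - 1 + ((N + 1 : ℕ) : ℝ)) * (Real.Gamma x)⁻¹ * (Real.Gamma (y + 1))⁻¹) = B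
  push_cast
  field_simp
  linear_combination (-(phase m a b * (x * A + y * B))) * Complex.I_sq

lemma Phi_monomial {m : ℕ} (a b : ℤ) (p q : ℕ) {s : ℝ} (hs : 0 < s) :
    Phi m a b (fun ω => ω ^ p * (starRingEnd ℂ) ω ^ q) s =
      Phi m (a + p) (b + q) (fun _ => 1) s := by
  refine intervalIntegral.integral_congr fun u _ => ?_
  simp only [integrand]
  rw [zpow_add₀ (om_ne_zero u hs), zpow_add₀ (conj_om_ne_zero u hs), zpow_natCast, zpow_natCast]
  ring

lemma iteratedDerivWithin_succ_Phi_one {m : ℕ} (hm : 1 ≤ m) (N : ℕ) (a b : ℤ) {s : ℝ}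
    (hs : s ∈ Set.Ioc (0 : ℝ) 1) :
    iteratedDerivWithin (N + 1) (Phi m a b fun _ => 1) (Set.Ioc 0 1) s = Complex.I / m *
      (a * iteratedDerivWithin N (Phi m (a - m) b fun _ => 1) (Set.Ioc 0 1) s -
      b * iteratedDerivWithin N (Phi m a (b - m) fun _ => 1) (Set.Ioc 0 1) s) := by
  have h0 : ∀ c, dd m c (fun _ => 1) = fun _ => 0 := fun c => by
    funext ω; simp [dd]
  have h1 : ∀ a b, iteratedDerivWithin N (Phi m a b fun _ => 0) (Set.Ioc 0 1) s = 0 := by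
    intro a b
    have : Phi m a b (fun _ => 0) = fun _ => 0 := by
      funext s; simp [Phi, integrand]
    rw [this]; simp
  rw [iteratedDerivWithin_succ_Phi hm a b contDiffOn_const hs, h0, h0, h1, h1, add_zero, sub_zero]

/-- For |u| ≥ 1 one has u² + 1 ≤ 2(u² + s²), so the tails are dominated uniformly in s by an
integrable function. -/
lemma norm_om_tail_le {m : ℕ} {E : ℤ} (hE : E ≤ 0) {u s : ℝ} (hu : 1 ≤ |u|) :
    ‖om m u s‖ ^ E ≤ 2 ^ (-((E : ℝ) / m / 2)) * ‖om m u 1‖ ^ E := by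
  have hu2 : 1 ≤ u ^ 2 := by rw [← sq_abs]; nlinarith
  rw [norm_om_zpow, norm_om_zpow, Real.rpow_neg two_pos.le, ← Real.inv_rpow two_pos.le,
    ← Real.mul_rpow (by norm_num) (by positivity)]
  refine Real.rpow_le_rpow_of_nonpos (by positivity) (by nlinarith [sq_nonneg s]) ?_
  have : (E : ℝ) ≤ 0 := by exact_mod_cast hE
  exact div_nonpos_of_nonpos_of_nonneg (div_nonpos_of_nonpos_of_nonneg this (by positivity))
    (by norm_num)

/-- Completing [-1, 1] to the whole line gives an exactly homogeneous function of s; the error is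
the integral over the complement, bounded uniformly in s. -/
lemma norm_Phi_one_sub_le {m : ℕ} (hm : 1 ≤ m) {a b : ℤ} (hab : a + b < -m) :
    ∃ C : ℝ, 0 ≤ C ∧ ∀ s ∈ Set.Ioc (0 : ℝ) 1,
      ‖Phi m a b (fun _ => 1) s - ((s ^ (((a + b : ℤ) : ℝ) / m + 1) : ℝ) : ℂ) *
        leadCoeff m 0 a b‖ ≤ C := by
  have hi := integrable_norm_om_one hm hab
  set E := a + b
  refine ⟨2 ^ (-((E : ℝ) / m / 2)) * ∫ u, ‖om m u 1‖ ^ E,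
    mul_nonneg (by positivity) (integral_nonneg fun u => by positivity), fun s hs => ?_⟩
  set G : ℝ → ℝ → ℂ := fun s u => om m u s ^ a * (starRingEnd ℂ) (om m u s) ^ b with hG
  have hGn : ∀ s u, 0 < s → ‖G s u‖ = ‖om m u s‖ ^ E := fun s u hs => by
    simp only [hG]
    rw [norm_mul, norm_zpow, norm_zpow, RCLike.norm_conj,
      ← zpow_add₀ (norm_ne_zero_iff.2 (om_ne_zero u hs))]
  have hGc : ∀ s, 0 < s → Continuous (G s) := fun s hs =>
    ((continuous_om m hs).zpow₀ a fun u => Or.inl (om_ne_zero u hs)).mul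
      ((Complex.continuous_conj.comp (continuous_om m hs)).zpow₀ b
        fun u => Or.inl (conj_om_ne_zero u hs))
  have hscale : ∀ u, G s u = ((s ^ ((E : ℝ) / m) : ℝ) : ℂ) * G 1 (u / s) := by
    intro u
    have h1 : ((s ^ ((E : ℝ) / m) : ℝ) : ℂ) = ((s ^ ((m : ℝ)⁻¹) : ℝ) : ℂ) ^ a *
        ((s ^ ((m : ℝ)⁻¹) : ℝ) : ℂ) ^ b := by
      have h2 : ((s ^ ((m : ℝ)⁻¹) : ℝ) : ℂ) ≠ 0 := by
        exact_mod_cast (Real.rpow_pos_of_pos hs.1 _).ne'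
      rw [← zpow_add₀ h2, ← Complex.ofReal_zpow, ← Real.rpow_intCast, ← Real.rpow_mul hs.1.le]
      change ((s ^ ((E : ℝ) / m) : ℝ) : ℂ) = ((s ^ ((m : ℝ)⁻¹ * (E : ℝ)) : ℝ) : ℂ)
      rw [mul_comm, div_eq_mul_inv]
    simp only [hG]
    rw [om_eq_scale m hs.1, map_mul, Complex.conj_ofReal, mul_zpow, mul_zpow, h1]
    ring
  have hi1 : Integrable (G 1) := hi.mono (hGc 1 one_pos).aestronglyMeasurable
    (Eventually.of_forall fun u => by
      rw [hGn 1 u one_pos, Real.norm_of_nonneg (by positivity)])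
  have his : Integrable (G s) := by
    rw [funext hscale]
    exact (hi1.comp_div hs.1.ne').const_mul _
  have hfull : ∫ u, G s u = ((s ^ ((E : ℝ) / m + 1) : ℝ) : ℂ) * leadCoeff m 0 a b := by
    rw [integral_congr_ae (Eventually.of_forall hscale), integral_const_mul,
      Measure.integral_comp_div (G 1), abs_of_pos hs.1, ← integral_om_one hm hab,
      Real.rpow_add hs.1, Real.rpow_one, Complex.real_smul]
    push_cast
    ring
  have hPhi : Phi m a b (fun _ => 1) s = ∫ u in Set.Ioc (-1) 1, G s u := by
    rw [Phi, intervalIntegral.integral_of_le (by norm_num)]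
    simp only [integrand, mul_one, hG]
  have hsplit := integral_add_compl (measurableSet_Ioc (a := (-1 : ℝ)) (b := 1)) his
  rw [hPhi, ← hfull, ← hsplit, sub_add_cancel_left, norm_neg]
  refine (norm_integral_le_integral_norm _).trans ?_
  rw [← integral_const_mul]
  refine (setIntegral_mono_on his.norm.integrableOn (hi.const_mul _).integrableOn
    measurableSet_Ioc.compl fun u hu => ?_).trans
    (setIntegral_le_integral (hi.const_mul _) (Eventually.of_forall fun u => by positivity))
  rw [hGn s u hs.1]
  refine norm_om_tail_le (by omega) ?_
  rw [Set.mem_compl_iff, Set.mem_Ioc, not_and_or, not_lt, not_le] at hu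
  rcases hu with h | h
  · rw [abs_of_nonpos (by linarith)]; linarith
  · rw [abs_of_pos (by linarith)]; exact h.le

/-- The condition on a + b asks for convergence on the line only after all N derivatives. Since the
derivatives and `leadCoeff` satisfy the same recurrence, everything reduces to N = 0. -/
lemma norm_iteratedDerivWithin_Phi_one_sub_le {m : ℕ} (hm : 1 ≤ m) (N : ℕ) {a b : ℤ}
    (hab : a + b < m * N - m) :
    ∃ C : ℝ, 0 ≤ C ∧ ∀ s ∈ Set.Ioc (0 : ℝ) 1,
      ‖iteratedDerivWithin N (Phi m a b fun _ => 1) (Set.Ioc 0 1) s -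
        ((s ^ (((a + b : ℤ) : ℝ) / m + 1 - N) : ℝ) : ℂ) * leadCoeff m N a b‖ ≤ C := by
  induction N generalizing a b with
  | zero => simpa using norm_Phi_one_sub_le hm (a := a) (b := b) (by simpa using hab)
  | succ N ih =>
    have hm' : (m : ℝ) ≠ 0 := by exact_mod_cast (by omega : m ≠ 0)
    push_cast at hab
    obtain ⟨C1, h1, k1⟩ := ih (a := a - m) (b := b) (by linarith)
    obtain ⟨C2, h2, k2⟩ := ih (a := a) (b := b - m) (by linarith)
    refine ⟨|(a : ℝ)| * C1 + |(b : ℝ)| * C2, by positivity, fun s hs => ?_⟩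
    rw [iteratedDerivWithin_succ_Phi_one hm N a b hs, leadCoeff_succ hm]
    have e : ((a + b : ℤ) : ℝ) / m + 1 - (N + 1 : ℕ) = ((a + b - m : ℤ) : ℝ) / m + 1 - N := by
      push_cast; field_simp; ring
    have g1 := k1 s hs
    have g2 := k2 s hs
    rw [show a - m + b = a + b - m by ring] at g1
    rw [show a + (b - m) = a + b - m by ring] at g2
    rw [e]
    generalize ((s ^ (((a + b - m : ℤ) : ℝ) / m + 1 - N) : ℝ) : ℂ) = S at g1 g2 ⊢
    generalize iteratedDerivWithin N (Phi m (a - m) b fun _ => 1) (Set.Ioc 0 1) s = X at g1 ⊢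
    generalize iteratedDerivWithin N (Phi m a (b - m) fun _ => 1) (Set.Ioc 0 1) s = Y at g2 ⊢
    have hI : ‖Complex.I / (m : ℂ)‖ ≤ 1 := by
      rw [norm_div, Complex.norm_I, Complex.norm_natCast]
      exact div_le_one_of_le₀ (by exact_mod_cast hm) (by positivity)
    rw [show Complex.I / m * (a * X - b * Y) - S * (Complex.I / m *
      (a * leadCoeff m N (a - m) b - b * leadCoeff m N a (b - m))) = Complex.I / m *
      (a * (X - S * leadCoeff m N (a - m) b) - b * (Y - S * leadCoeff m N a (b - m))) by ring,
      norm_mul]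
    refine (mul_le_of_le_one_left (norm_nonneg _) hI).trans ((norm_sub_le _ _).trans ?_)
    rw [norm_mul, norm_mul, Complex.norm_intCast, Complex.norm_intCast]
    gcongr


/-! ### Generalised binomial coefficients and the Gamma function -/

lemma factorial_mul_ring_choose (r : ℝ) (q : ℕ) :
    (q ! : ℝ) * Ring.choose r q = ∏ t ∈ Finset.range q, (r - t) := by
  have h1 : (descPochhammer ℤ q).smeval r = (q ! : ℝ) * Ring.choose r q := by
    rw [Ring.descPochhammer_eq_factorial_smul_choose, nsmul_eq_mul]
  rw [← h1]
  induction q with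
  | zero => simp
  | succ q ih =>
    have h2 : (descPochhammer ℤ q).smeval r = (q ! : ℝ) * Ring.choose r q := by
      rw [Ring.descPochhammer_eq_factorial_smul_choose, nsmul_eq_mul]
    rw [descPochhammer_succ_right, Polynomial.smeval_mul, Finset.prod_range_succ, ih h2,
      Polynomial.smeval_sub, Polynomial.smeval_X, Polynomial.smeval_natCast]
    simp

lemma Gamma_inv_sub_nat (x : ℝ) (q : ℕ) :
    (Real.Gamma (x - q))⁻¹ = (Real.Gamma x)⁻¹ * ∏ t ∈ Finset.range q, (x - 1 - t) := by
  induction q with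
  | zero => simp
  | succ q ih =>
    rw [Gamma_inv_succ, show x - ((q + 1 : ℕ) : ℝ) + 1 = x - q by push_cast; ring, ih,
      Finset.prod_range_succ]
    push_cast
    ring

lemma Gamma_inv_eq_mul_add_nat (y : ℝ) (q : ℕ) :
    (Real.Gamma y)⁻¹ = (∏ t ∈ Finset.range q, (y + t)) * (Real.Gamma (y + q))⁻¹ := by
  induction q with
  | zero => simp
  | succ q ih =>
    rw [ih, Finset.prod_range_succ, Gamma_inv_succ (y + q)]
    push_cast
    ring_nf

lemma prod_neg_sub (y : ℝ) (q : ℕ) :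
    ∏ t ∈ Finset.range q, (-y - (t : ℝ)) = (-1) ^ q * ∏ t ∈ Finset.range q, (y + t) := by
  rw [← Finset.card_range q, ← Finset.prod_const, Finset.card_range, ← Finset.prod_mul_distrib]
  exact Finset.prod_congr rfl fun t _ => by ring

lemma extGamma_of_ne {x : ℝ} (h : ¬ ∃ q : ℕ, x = -(q : ℝ)) : extGamma x = Real.Gamma x := by
  rw [extGamma, if_neg h]

lemma extGamma_neg_nat (q : ℕ) : extGamma (-(q : ℝ)) = (-1) ^ q / (q ! : ℝ) := by
  rw [extGamma, if_pos ⟨q, rfl⟩]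
  simp

lemma extGamma_ne_zero (x : ℝ) : extGamma x ≠ 0 := by
  by_cases h : ∃ q : ℕ, x = -(q : ℝ)
  · obtain ⟨q, rfl⟩ := h
    rw [extGamma_neg_nat]
    have : (q ! : ℝ) ≠ 0 := by exact_mod_cast q.factorial_ne_zero
    positivity
  · rw [extGamma_of_ne h]
    exact Real.Gamma_ne_zero fun m hm => h ⟨m, hm⟩

/-- The factor relating the leading singular coefficient to the functional `Cfun`. -/
noncomputable def gaugeFactor (m N j : ℕ) : ℝ :=
  (-1) ^ N * Real.Gamma (-ord m j + N) / ((j ! : ℝ) * extGamma (-ord m j))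

/-! ### Regrouping the Taylor coefficients -/

/-- The contribution of the monomial `ω^p ω̄^{j-p}` to the leading singular coefficient. -/
noncomputable def leadTerm (m N j : ℕ) (g : ℂ → ℂ) (p : ℕ) : ℂ :=
  wirtingerAtZero p (j - p) g / (p ! * (j - p)!) *
    leadCoeff m N (1 - m + p) (1 - m + ((j - p : ℕ) : ℤ))

lemma leadCoeff_eq_zero_left {m N : ℕ} {a b : ℤ} (h : Real.Gamma (-(a : ℝ) / m) = 0) :
    leadCoeff m N a b = 0 := by
  simp [leadCoeff, h]

lemma leadCoeff_eq_zero_right {m N : ℕ} {a b : ℤ} (h : Real.Gamma (-(b : ℝ) / m) = 0) :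
    leadCoeff m N a b = 0 := by
  simp [leadCoeff, h]

lemma Gamma_eq_zero_of_mod {m p : ℕ} (hm : 1 ≤ m) (h : p % m = m - 1) :
    Real.Gamma (-((1 - m + p : ℤ) : ℝ) / m) = 0 := by
  have hm' : (m : ℝ) ≠ 0 := by exact_mod_cast (by omega : m ≠ 0)
  rw [Real.Gamma_eq_zero_iff]
  refine ⟨p / m, ?_⟩
  have h1 : p = m - 1 + m * (p / m) := by
    conv_lhs => rw [← Nat.mod_add_div p m, h]
  have h2 : (p : ℝ) = m - 1 + m * ((p / m : ℕ) : ℝ) := by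
    have : ((m - 1 : ℕ) : ℝ) = m - 1 := by push_cast [hm]; ring
    rw [← this]; exact_mod_cast h1
  push_cast
  rw [h2]
  field_simp
  ring

/-- The term of `Cfun m j 0 g` with indices `i` and `q`. -/
noncomputable def cfunTerm (m j : ℕ) (g : ℂ → ℂ) (i q : ℕ) : ℂ :=
  betaLike ((((m : ℝ) - 1) - i) / m) ((((m : ℝ) - 1) - ((j : ℝ) - i)) / m) *
    ((((j.choose (i + q * m) : ℝ) * Ring.choose ((((m : ℝ) - 1) - i) / m - 1) q /
        Ring.choose ((((j : ℝ) - i) - ((m : ℝ) - 1)) / m) q : ℝ) : ℂ) *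
      wirtingerAtZero (i + q * m) (j - i - q * m) g)

lemma ne_neg_nat_of_not_modEq {m i j : ℕ} (hm : 1 ≤ m)
    (h : ¬ (i : ℤ) ≡ (j : ℤ) - ((m : ℤ) - 1) [ZMOD (m : ℤ)]) (z : ℤ) :
    (((m : ℝ) - 1) - ((j : ℝ) - i)) / m ≠ z := by
  have hm' : (m : ℝ) ≠ 0 := by exact_mod_cast (by omega : m ≠ 0)
  intro h2
  rw [div_eq_iff hm'] at h2
  apply h
  have h3 : (m : ℤ) - 1 - (j - i) = z * m := by exact_mod_cast h2
  refine (Int.modEq_iff_dvd.2 ⟨-z, ?_⟩)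
  linarith

/-- Passing from i to i + qm replaces (x, y) by (x - q, y + q) and leaves x + y - 1 = -𝔬(j)
unchanged. The shift rules of 1/Γ become the two generalised binomials, the factorials become the
ordinary one, and the sign (-1)^q of the phase cancels that of the falling product. The congruence
condition keeps y off the integers, so no denominator vanishes. -/
lemma leadTerm_eq {m N j : ℕ} (hm : 2 ≤ m) (g : ℂ → ℂ) {i q : ℕ} (hi : i ≤ m - 2)
    (hq : i + q * m ≤ j) (h : ¬ (i : ℤ) ≡ (j : ℤ) - ((m : ℤ) - 1) [ZMOD (m : ℤ)]) :
    leadTerm m N j g (i + q * m) = (gaugeFactor m N j : ℂ) * cfunTerm m j g i q := by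
  have hm0 : (0 : ℝ) < m := by exact_mod_cast (by omega : 0 < m)
  have hm' : (m : ℝ) ≠ 0 := hm0.ne'
  set x : ℝ := (((m : ℝ) - 1) - i) / m with hx
  set y : ℝ := (((m : ℝ) - 1) - ((j : ℝ) - i)) / m with hy
  have hsub : ((j - (i + q * m) : ℕ) : ℝ) = j - (i + q * m) := by
    rw [Nat.cast_sub hq]; push_cast; ring
  have hX : -((1 - m + (i + q * m : ℕ) : ℤ) : ℝ) / m = x - q := by
    rw [hx]; push_cast; field_simp; ring
  have hY : -((1 - m + ((j - (i + q * m) : ℕ) : ℤ) : ℤ) : ℝ) / m = y + q := by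
    rw [hy]; push_cast; rw [hsub]; field_simp; ring
  have hord : x + y - 1 = -ord m j := by
    rw [hx, hy, ord]; field_simp; ring
  have hx0 : 0 < x := by
    have : (i : ℝ) ≤ m - 2 := by
      have h2 : ((m - 2 : ℕ) : ℝ) = m - 2 := by push_cast [hm]; ring
      rw [← h2]; exact_mod_cast hi
    rw [hx]
    apply div_pos _ hm0
    linarith
  have hyne : ∀ z : ℤ, y ≠ z := ne_neg_nat_of_not_modEq (by omega) h
  have hxn : ¬ ∃ q : ℕ, x = -(q : ℝ) := by
    rintro ⟨q, hq⟩
    have : (0 : ℝ) ≤ q := q.cast_nonneg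
    linarith
  have hyn : ¬ ∃ q : ℕ, y = -(q : ℝ) := by
    rintro ⟨q, hq⟩
    exact hyne (-(q : ℤ)) (by rw [hq]; push_cast; ring)
  have hneg : (((j : ℝ) - i) - ((m : ℝ) - 1)) / m = -y := by rw [hy]; field_simp; ring
  have hqf : (q ! : ℝ) ≠ 0 := by exact_mod_cast q.factorial_ne_zero
  have hprod : ∏ t ∈ Finset.range q, (y + (t : ℝ)) ≠ 0 := by
    rw [Finset.prod_ne_zero_iff]
    intro t _ h0
    exact hyne (-(t : ℤ)) (by push_cast; linarith)
  have hc1 := factorial_mul_ring_choose (x - 1) q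
  have hc2 := factorial_mul_ring_choose (-y) q
  rw [prod_neg_sub] at hc2
  have hR2 : Ring.choose (-y) q ≠ 0 := by
    intro h0
    rw [h0, mul_zero] at hc2
    exact mul_ne_zero (pow_ne_zero _ (by norm_num)) hprod hc2.symm
  have gX := Gamma_inv_sub_nat x q
  have gY := Gamma_inv_eq_mul_add_nat y q
  rw [← hc1] at gX
  have hsq : ((-1 : ℝ) ^ q) * (-1) ^ q = 1 := by rw [← mul_pow]; norm_num
  have gY' : (Real.Gamma (y + q))⁻¹ =
      (-1) ^ q * (Real.Gamma y)⁻¹ / ((q ! : ℝ) * Ring.choose (-y) q) := by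
    rw [gY, hc2]
    field_simp
  have hphase : phase m (1 - m + (i + q * m : ℕ)) (1 - m + ((j - (i + q * m) : ℕ) : ℤ)) =
      (-1) ^ q * Complex.exp (Complex.I * ((Real.pi / 2 * (y - x) : ℝ) : ℂ)) := by
    rw [phase, hX, hY, ← Complex.exp_pi_mul_I, ← Complex.exp_nat_mul, ← Complex.exp_add]
    congr 1
    push_cast
    ring
  have hchoose : (j.choose (i + q * m) : ℝ) =
      (j ! : ℝ) / (((i + q * m)! : ℝ) * ((j - (i + q * m))! : ℝ)) := Nat.cast_choose ℝ hq
  have hpow : (2 : ℝ) * Real.pi * 2 ^ (1 - x - y) = Real.pi / 2 ^ (x + y - 2) := by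
    rw [show 1 - x - y = -(x + y - 2) - 1 by ring, Real.rpow_sub two_pos, Real.rpow_neg two_pos.le,
      Real.rpow_one]
    field_simp
  simp only [leadTerm, leadCoeff, cfunTerm, betaLike]
  rw [← hx, ← hy, if_neg (not_or.2 ⟨hxn, hyn⟩), hphase, hX, hY, hneg, gX, gY',
    extGamma_of_ne hxn, extGamma_of_ne hyn, gaugeFactor, hchoose,
    show x - ↑q + (y + ↑q) - 1 + (N : ℝ) = x + y - 1 + N by ring, hord,
    show 1 - (x - ↑q) - (y + ↑q) = 1 - x - y by ring, hpow, ← Nat.sub_sub]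
  have f1 : ((i + q * m)! : ℂ) ≠ 0 := by exact_mod_cast Nat.factorial_ne_zero _
  have f2 : ((j - i - q * m)! : ℂ) ≠ 0 := by exact_mod_cast Nat.factorial_ne_zero _
  have f3 : (j ! : ℂ) ≠ 0 := by exact_mod_cast Nat.factorial_ne_zero _
  have f4 : (extGamma (-ord m j) : ℂ) ≠ 0 := by exact_mod_cast extGamma_ne_zero _
  have f5 : (q ! : ℂ) ≠ 0 := by exact_mod_cast q.factorial_ne_zero
  have f6 : (Ring.choose (-y) q : ℂ) ≠ 0 := by exact_mod_cast hR2
  have f7 : (Real.Gamma x : ℂ) ≠ 0 := by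
    exact_mod_cast Real.Gamma_ne_zero fun q h => hxn ⟨q, h⟩
  have f8 : (Real.Gamma y : ℂ) ≠ 0 := by
    exact_mod_cast Real.Gamma_ne_zero fun q h => hyn ⟨q, h⟩
  have f9 : (((2 : ℝ) ^ (x + y - 2) : ℝ) : ℂ) ≠ 0 := by
    exact_mod_cast (Real.rpow_pos_of_pos two_pos _).ne'
  have hsqc : ((-1 : ℂ) ^ q) * (-1) ^ q = 1 := by rw [← mul_pow]; norm_num
  generalize (2 : ℝ) ^ (x + y - 2) = T at f9 ⊢
  generalize Complex.exp (Complex.I * ((Real.pi / 2 * (y - x) : ℝ) : ℂ)) = e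
  push_cast
  field_simp
  have : ((-1 : ℂ) ^ q) ^ 2 = 1 := by rw [sq]; exact hsqc
  simp only [this]
  ring

lemma Cfun_zero_eq (m j : ℕ) (g : ℂ → ℂ) :
    Cfun m j 0 g = ∑ i ∈ (Finset.range (min j (m - 2) + 1)).filter
      (fun i : ℕ => ¬ (i : ℤ) ≡ (j : ℤ) - ((m : ℤ) - 1) [ZMOD (m : ℤ)]),
      ∑ q ∈ Finset.range ((j - i) / m + 1), cfunTerm m j g i q := by
  rw [Cfun]
  refine Finset.sum_congr rfl fun i _ => ?_
  simp only [Nat.cast_zero, zero_mul, zpow_zero, one_mul]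
  rw [partialFunctional, Finset.mul_sum]
  rfl

/-- If p ≡ m - 1 or j - p ≡ m - 1 modulo m, then 1/Γ(x) or 1/Γ(y) is zero and the monomial
contributes nothing. The remaining p correspond to pairs (i, q) by Euclidean division, with i ≤ m -
2. -/
lemma sum_leadTerm {m N j : ℕ} (hm : 2 ≤ m) (g : ℂ → ℂ) :
    ∑ p ∈ Finset.range (j + 1), leadTerm m N j g p =
      (gaugeFactor m N j : ℂ) * Cfun m j 0 g := by
  classical
  rw [Cfun_zero_eq, Finset.mul_sum]
  simp_rw [Finset.mul_sum]
  rw [Finset.sum_sigma']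
  symm
  set P : Finset ℕ := (Finset.range (j + 1)).filter fun p => p % m ≠ m - 1 ∧
    ¬ (p : ℤ) ≡ (j : ℤ) - ((m : ℤ) - 1) [ZMOD (m : ℤ)] with hP
  have hmod : ∀ i q : ℕ, ((i + q * m : ℕ) : ℤ) ≡ i [ZMOD (m : ℤ)] := fun i q => by
    refine Int.modEq_iff_dvd.2 ⟨-q, ?_⟩
    push_cast; ring
  have h1 : ∑ p ∈ P, leadTerm m N j g p = ∑ p ∈ Finset.range (j + 1), leadTerm m N j g p := by
    refine Finset.sum_subset (Finset.filter_subset _ _) fun p hp hp2 => ?_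
    have hpj : p ≤ j := by have := Finset.mem_range.1 hp; omega
    rw [hP, Finset.mem_filter, not_and, not_and_or, not_not, not_not] at hp2
    rcases hp2 hp with h | h
    · rw [leadTerm, leadCoeff_eq_zero_left (Gamma_eq_zero_of_mod (by omega) h), mul_zero]
    · have h2 : (j - p) % m = m - 1 := by
        have h3 : ((j - p : ℕ) : ℤ) ≡ ((m - 1 : ℕ) : ℤ) [ZMOD (m : ℤ)] := by
          obtain ⟨c, hc⟩ := Int.modEq_iff_dvd.1 h
          refine Int.modEq_iff_dvd.2 ⟨-c, ?_⟩
          push_cast [hpj, (by omega : 1 ≤ m)]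
          linarith
        have h4 : (j - p) ≡ (m - 1) [MOD m] := (Int.natCast_modEq_iff).1 h3
        rw [h4, Nat.mod_eq_of_lt (by omega)]
      rw [leadTerm, leadCoeff_eq_zero_right (Gamma_eq_zero_of_mod (by omega) h2), mul_zero]
  rw [← h1]
  refine Finset.sum_bij' (fun s _ => s.1 + s.2 * m) (fun p _ => ⟨p % m, p / m⟩) ?_ ?_ ?_ ?_ ?_
  · rintro ⟨i, q⟩ hs
    simp only [Finset.mem_sigma, Finset.mem_filter, Finset.mem_range] at hs
    obtain ⟨⟨hi, hne⟩, hq⟩ := hs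
    have h2 : q * m ≤ j - i := (Nat.mul_le_mul_right m (by omega)).trans (Nat.div_mul_le_self _ _)
    simp only [hP, Finset.mem_filter, Finset.mem_range]
    refine ⟨by omega, ?_, fun h => hne ((hmod i q).symm.trans h)⟩
    rw [Nat.add_mul_mod_self_right, Nat.mod_eq_of_lt (by omega)]
    omega
  · intro p hp
    simp only [hP, Finset.mem_filter, Finset.mem_range] at hp
    obtain ⟨hpj, hp1, hp2⟩ := hp
    have hlt := Nat.mod_lt p (by omega : 0 < m)
    have hle := Nat.mod_le p m
    have hdiv := Nat.mod_add_div p m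
    simp only [Finset.mem_sigma, Finset.mem_filter, Finset.mem_range]
    refine ⟨⟨by omega, fun h => hp2 ?_⟩, ?_⟩
    · have := hmod (p % m) (p / m)
      rw [mul_comm (p / m) m, hdiv] at this
      exact this.trans h
    · rw [Nat.lt_succ_iff, Nat.le_div_iff_mul_le (by omega), mul_comm]
      omega
  · rintro ⟨i, q⟩ hs
    simp only [Finset.mem_sigma, Finset.mem_filter, Finset.mem_range] at hs
    obtain ⟨⟨hi, hne⟩, hq⟩ := hs
    have him : i < m := by omega
    simp only [Nat.add_mul_mod_self_right, Nat.mod_eq_of_lt him,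
      Nat.add_mul_div_right _ _ (by omega : 0 < m), Nat.div_eq_of_lt him, zero_add]
  · intro p hp
    simp only
    rw [mul_comm]; exact Nat.mod_add_div p m
  · rintro ⟨i, q⟩ hs
    simp only [Finset.mem_sigma, Finset.mem_filter, Finset.mem_range] at hs
    obtain ⟨⟨hi, hne⟩, hq⟩ := hs
    have h2 : q * m ≤ j - i := (Nat.mul_le_mul_right m (by omega)).trans (Nat.div_mul_le_self _ _)
    have h3 : i + q * m ≤ j := by omega
    exact (leadTerm_eq hm g (by omega) h3 hne).symm


/-! ### Asymptotics of the derivatives of `Φ` -/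

lemma norm_wirtingerAtZero_le {m : ℕ} (hm : 1 ≤ m) {S : ℝ} (p q : ℕ) {g : ℂ → ℂ}
    (hg : ContDiffOn ℝ (p + q : ℕ) g (D m))
    (hS : ∀ w : List Bool, w.length ≤ p + q → ∀ ω ∈ D m, ‖wd m w g ω‖ ≤ S) :
    ‖wirtingerAtZero p q g‖ ≤ S := by
  induction q generalizing g with
  | zero =>
    induction p generalizing g with
    | zero => exact hS [] (by simp) 0 (zero_mem_D hm)
    | succ p ih =>
      rw [wirtingerAtZero_succ_left hm (hg.of_le (by norm_cast; omega))]
      exact ih (contDiffOn_dd hm hg true)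
        fun w hw ω hω => hS (true :: w) (by simp at hw ⊢; omega) ω hω
  | succ q ih =>
    rw [wirtingerAtZero_succ_right hm]
    exact ih (contDiffOn_dd hm hg false)
      fun w hw ω hω => hS (false :: w) (by simp at hw ⊢; omega) ω hω

/-- Continuity at 0 gives δ inside a small disc; outside it the sup bound is dominated by a multiple
of ‖ω‖. The linear form of the majorant is what the homogeneous estimates can use. M is summed over
the finitely many words of length k. -/
lemma exists_modulus {m : ℕ} (hm : 1 ≤ m) {k : ℕ} {g : ℂ → ℂ} (hg : ContDiffOn ℝ k g (D m))
    {δ : ℝ} (hδ : 0 < δ) : ∃ M : ℝ, 0 ≤ M ∧ ∀ w : List Bool, w.length = k → ∀ ω ∈ D m,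
      ‖wd m w g ω - wd m w g 0‖ ≤ δ + M * ‖ω‖ := by
  have h1 : ∀ w : List Bool, w.length = k → ∃ M : ℝ, 0 ≤ M ∧ ∀ ω ∈ D m,
      ‖wd m w g ω - wd m w g 0‖ ≤ δ + M * ‖ω‖ := by
    intro w hw
    have hc : ContinuousOn (wd m w g) (D m) :=
      (contDiffOn_wd hm w (n := 0) (by simpa [hw] using hg)).continuousOn
    obtain ⟨B, hB⟩ := (isCompact_D hm).exists_bound_of_continuousOn hc
    have hc0 := (hc 0 (zero_mem_D hm)).continuousAt (D_mem_nhds_zero hm)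
    obtain ⟨r, hr, hr2⟩ := Metric.continuousAt_iff.1 hc0 δ hδ
    have hB0 : 0 ≤ B := (norm_nonneg _).trans (hB 0 (zero_mem_D hm))
    refine ⟨2 * B / r, by positivity, fun ω hω => ?_⟩
    by_cases h : ‖ω‖ < r
    · have := hr2 (x := ω) (by simpa using h)
      rw [dist_eq_norm] at this
      have : 0 ≤ 2 * B / r * ‖ω‖ := by positivity
      linarith
    · have h2 := norm_sub_le (wd m w g ω) (wd m w g 0)
      have h3 := hB ω hω
      have h4 := hB 0 (zero_mem_D hm)
      have h5 : 2 * B ≤ 2 * B / r * ‖ω‖ := by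
        rw [div_mul_eq_mul_div, le_div_iff₀ hr]
        exact mul_le_mul_of_nonneg_left (not_lt.1 h) (by positivity)
      linarith
  choose! M hM0 hM using h1
  have hfin : {w : List Bool | w.length = k}.Finite := List.finite_length_eq Bool k
  refine ⟨∑ w ∈ hfin.toFinset, M w, Finset.sum_nonneg fun w hw => hM0 w (by simpa using hw),
    fun w hw ω hω => (hM w hw ω hω).trans ?_⟩
  gcongr
  exact Finset.single_le_sum (f := M) (fun w hw => hM0 w (by simpa using hw)) (by simpa using hw)

lemma Phi_add {m : ℕ} (hm : 1 ≤ m) (a b : ℤ) {f g : ℂ → ℂ} (hf : ContinuousOn f (D m))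
    (hg : ContinuousOn g (D m)) {s : ℝ} (hs : s ∈ Set.Ioc (0 : ℝ) 1) :
    Phi m a b (fun ω => f ω + g ω) s = Phi m a b f s + Phi m a b g s := by
  simp only [Phi]
  rw [← intervalIntegral.integral_add
    (intervalIntegrable_slice (continuousOn_integrand hm a b hf) hs)
    (intervalIntegrable_slice (continuousOn_integrand hm a b hg) hs)]
  refine intervalIntegral.integral_congr fun u _ => ?_
  simp only [integrand]; ring

lemma Phi_const_mul (m : ℕ) (a b : ℤ) (c : ℂ) (f : ℂ → ℂ) (s : ℝ) :
    Phi m a b (fun ω => c * f ω) s = c * Phi m a b f s := by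
  simp only [Phi]
  rw [← intervalIntegral.integral_const_mul]
  refine intervalIntegral.integral_congr fun u _ => ?_
  simp only [integrand]; ring

lemma Phi_sum {ι : Type*} {m : ℕ} (hm : 1 ≤ m) (a b : ℤ) (A : Finset ι) {f : ι → ℂ → ℂ}
    (hf : ∀ i, ContinuousOn (f i) (D m)) {s : ℝ} (hs : s ∈ Set.Ioc (0 : ℝ) 1) :
    Phi m a b (fun ω => ∑ i ∈ A, f i ω) s = ∑ i ∈ A, Phi m a b (f i) s := by
  classical
  induction A using Finset.induction_on with
  | empty => simp [Phi, integrand]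
  | insert i A hi ih =>
    simp only [Finset.sum_insert hi]
    rw [Phi_add hm a b (hf i) (continuousOn_finsetSum _ fun i _ => hf i) hs, ih]

lemma Phi_tay {m : ℕ} (hm : 1 ≤ m) (a b : ℤ) (j : ℕ) (g : ℂ → ℂ) {s : ℝ}
    (hs : s ∈ Set.Ioc (0 : ℝ) 1) :
    Phi m a b (tay j g) s = ∑ p ∈ Finset.range (j + 1),
      wirtingerAtZero p (j - p) g / (p ! * (j - p)!) *
        Phi m (a + p) (b + ((j - p : ℕ) : ℤ)) (fun _ => 1) s := by
  have e : tay j g = fun ω => ∑ p ∈ Finset.range (j + 1),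
      wirtingerAtZero p (j - p) g / (p ! * (j - p)!) * (ω ^ p * (starRingEnd ℂ) ω ^ (j - p)) := by
    funext ω
    exact Finset.Nat.sum_antidiagonal_eq_sum_range_succ_mk _ j
  rw [e, Phi_sum hm a b _ (fun p => Continuous.continuousOn (by fun_prop)) hs]
  refine Finset.sum_congr rfl fun p _ => ?_
  rw [Phi_const_mul, Phi_monomial _ _ _ _ hs.1]

lemma iteratedDerivWithin_Phi_expansion {m : ℕ} (hm : 1 ≤ m) (a b : ℤ) (k : ℕ) {N : ℕ}
    {g : ℂ → ℂ} (hg : ContDiffOn ℝ N g (D m)) {s : ℝ} (hs : s ∈ Set.Ioc (0 : ℝ) 1) :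
    iteratedDerivWithin N (Phi m a b g) (Set.Ioc 0 1) s =
      iteratedDerivWithin N (Phi m a b (rem k g)) (Set.Ioc 0 1) s +
      ∑ j ∈ Finset.range k, ∑ p ∈ Finset.range (j + 1),
        wirtingerAtZero p (j - p) g / (p ! * (j - p)!) *
        iteratedDerivWithin N (Phi m (a + p) (b + ((j - p : ℕ) : ℤ)) fun _ => 1)
          (Set.Ioc 0 1) s := by
  have hu := uniqueDiffOn_Ioc01
  have hr := contDiffOn_rem k hg
  have ht : ∀ j, ContDiffOn ℝ N (tay j g) (D m) := fun j => (contDiff_tay j g).contDiffOn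
  have e : Set.EqOn (Phi m a b g) (Phi m a b (rem k g) + fun s => ∑ j ∈ Finset.range k,
      ∑ p ∈ Finset.range (j + 1), wirtingerAtZero p (j - p) g / (p ! * (j - p)!) *
        Phi m (a + p) (b + ((j - p : ℕ) : ℤ)) (fun _ => 1) s) (Set.Ioc 0 1) := by
    intro s hs
    rw [Pi.add_apply]
    simp_rw [← Phi_tay hm a b _ g hs]
    rw [← Phi_sum hm a b _ (fun j => (ht j).continuousOn) hs,
      ← Phi_add hm a b hr.continuousOn (continuousOn_finsetSum _ fun j _ => (ht j).continuousOn) hs]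
    congr 1
    funext ω
    simp [rem]
  have h1 : ∀ a b, ContDiffWithinAt ℝ N (Phi m a b fun _ => 1) (Set.Ioc 0 1) s := fun a b =>
    contDiffOn_Phi hm a b contDiffOn_const s hs
  rw [iteratedDerivWithin_congr e hs, iteratedDerivWithin_add hs hu (contDiffOn_Phi hm a b hr s hs)
    (ContDiffWithinAt.sum fun j _ => ContDiffWithinAt.sum fun p _ =>
      contDiffWithinAt_const.mul (h1 _ _)),
    iteratedDerivWithin_fun_sum hs hu fun j _ => ContDiffWithinAt.sum fun p _ =>
      contDiffWithinAt_const.mul (h1 _ _)]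
  congr 1
  refine Finset.sum_congr rfl fun j _ => ?_
  rw [iteratedDerivWithin_fun_sum hs hu fun p _ => contDiffWithinAt_const.mul (h1 _ _)]
  refine Finset.sum_congr rfl fun p _ => ?_
  rw [iteratedDerivWithin_const_mul_field]

lemma norm_coeff_le {m : ℕ} (hm : 1 ≤ m) {S : ℝ} {k j p : ℕ} {g : ℂ → ℂ}
    (hg : ContDiffOn ℝ k g (D m)) (hj : j ≤ k) (hp : p ≤ j)
    (hS : ∀ w : List Bool, w.length ≤ k → ∀ ω ∈ D m, ‖wd m w g ω‖ ≤ S) :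
    ‖wirtingerAtZero p (j - p) g / (p ! * (j - p)!)‖ ≤ S := by
  have h1 := norm_wirtingerAtZero_le hm (S := S) p (j - p) (hg.of_le (by norm_cast; omega))
    fun w hw => hS w (by omega)
  rw [norm_div]
  refine div_le_of_le_mul₀ (norm_nonneg _) ((norm_nonneg _).trans h1) (h1.trans ?_)
  refine le_mul_of_one_le_right ((norm_nonneg _).trans h1) ?_
  rw [norm_mul, Complex.norm_natCast, Complex.norm_natCast]
  exact_mod_cast Nat.one_le_iff_ne_zero.2
    (mul_ne_zero p.factorial_ne_zero (j - p).factorial_ne_zero)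

/-- The `N`-th derivative of the Taylor part of degree `j`. -/
lemma norm_tay_part_sub_le {m : ℕ} (hm : 2 ≤ m) {N j : ℕ} (hN : (j : ℤ) + 2 - m < m * N) :
    ∃ C : ℝ, 0 ≤ C ∧ ∀ (k : ℕ) (S : ℝ) (g : ℂ → ℂ), ContDiffOn ℝ k g (D m) → j ≤ k →
      (∀ w : List Bool, w.length ≤ k → ∀ ω ∈ D m, ‖wd m w g ω‖ ≤ S) →
      ∀ s ∈ Set.Ioc (0 : ℝ) 1,
      ‖∑ p ∈ Finset.range (j + 1), wirtingerAtZero p (j - p) g / (p ! * (j - p)!) *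
        iteratedDerivWithin N (Phi m (1 - m + p) (1 - m + ((j - p : ℕ) : ℤ)) fun _ => 1)
          (Set.Ioc 0 1) s - ((s ^ (ord m j - N) : ℝ) : ℂ) *
            ((gaugeFactor m N j : ℂ) * Cfun m j 0 g)‖ ≤ C * S := by
  have hm0 : (m : ℝ) ≠ 0 := by exact_mod_cast (by omega : m ≠ 0)
  have h1 : ∀ p : ℕ, p ≤ j → ∃ C : ℝ, 0 ≤ C ∧ ∀ s ∈ Set.Ioc (0 : ℝ) 1,
      ‖iteratedDerivWithin N (Phi m (1 - m + p) (1 - m + ((j - p : ℕ) : ℤ)) fun _ => 1)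
        (Set.Ioc 0 1) s - ((s ^ (ord m j - N) : ℝ) : ℂ) *
          leadCoeff m N (1 - m + p) (1 - m + ((j - p : ℕ) : ℤ))‖ ≤ C := by
    intro p hp
    have e : (1 - m + p : ℤ) + (1 - m + ((j - p : ℕ) : ℤ)) = j + 2 - 2 * m := by
      push_cast [hp]; ring
    obtain ⟨C, hC, hC2⟩ := norm_iteratedDerivWithin_Phi_one_sub_le (m := m) (by omega) N
      (a := 1 - m + p) (b := 1 - m + ((j - p : ℕ) : ℤ)) (by rw [e]; linarith)
    refine ⟨C, hC, fun s hs => ?_⟩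
    have := hC2 s hs
    rw [e] at this
    convert this using 6
    rw [ord]; push_cast; field_simp; ring
  choose! C hC0 hC using h1
  refine ⟨∑ p ∈ Finset.range (j + 1), C p, Finset.sum_nonneg fun p hp =>
    hC0 p (by have := Finset.mem_range.1 hp; omega), fun k S g hg hjk hS s hs => ?_⟩
  rw [← sum_leadTerm hm, Finset.mul_sum, ← Finset.sum_sub_distrib, Finset.sum_mul]
  refine (norm_sum_le _ _).trans (Finset.sum_le_sum fun p hp => ?_)
  have hpj : p ≤ j := by have := Finset.mem_range.1 hp; omega
  rw [leadTerm, mul_left_comm, ← mul_sub, norm_mul, mul_comm]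
  exact mul_le_mul (hC p hpj s hs) (norm_coeff_le (by omega) hg hjk hpj hS) (norm_nonneg _)
    (hC0 p hpj)

/-- The function `φ_{f,0}` on the upper half-interval. -/
noncomputable def phi0 (m : ℕ) (g : ℂ → ℂ) : ℝ → ℂ := Phi m (1 - m) (1 - m) g

/-- The remainder past degree k contributes δ at the leading power and M + S at a power better by
s^{1/m}; each Taylor part is its singular term up to O(S). The vanishing of the lower functionals
removes the more singular powers. C is independent of g, δ, M and S, which later allows two
different choices of δ and M. -/
lemma norm_iteratedDerivWithin_phi0_sub_le {m : ℕ} (hm : 2 ≤ m) {N k : ℕ}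
    (hN : (k : ℤ) + 2 ≤ m * N) :
    ∃ C : ℝ, 0 ≤ C ∧ ∀ (δ M S : ℝ) (g : ℂ → ℂ), 0 ≤ δ → 0 ≤ M →
      ContDiffOn ℝ (max k N : ℕ) g (D m) →
      (∀ w : List Bool, w.length ≤ max k N → ∀ ω ∈ D m, ‖wd m w g ω‖ ≤ S) →
      (∀ w : List Bool, w.length = k → ∀ ω ∈ D m, ‖wd m w g ω - wd m w g 0‖ ≤ δ + M * ‖ω‖) →
      (∀ j < k, Cfun m j 0 g = 0) → ∀ s ∈ Set.Ioc (0 : ℝ) 1,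
      ‖iteratedDerivWithin N (phi0 m g) (Set.Ioc 0 1) s - ((s ^ (ord m k - N) : ℝ) : ℂ) *
        ((gaugeFactor m N k : ℂ) * Cfun m k 0 g)‖ ≤
      C * (δ * s ^ (ord m k - N) + (M + S) * s ^ (ord m k + 1 / m - N) + S) := by
  have hm1 : 1 ≤ m := by omega
  have hm0 : (m : ℝ) ≠ 0 := by exact_mod_cast (by omega : m ≠ 0)
  have hmZ : (2 : ℤ) ≤ m := by exact_mod_cast hm
  obtain ⟨C1, hC1, hC1'⟩ := norm_iteratedDerivWithin_Phi_le hm1 N (1 - m) (1 - m)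
  set E : ℤ := k + (1 - m) + (1 - m) - m * N with hE
  -- The hypothesis on N says 𝔬(k) ≤ N - 1; with m ≥ 2 it puts even the degree E + 1 below -m.
  obtain ⟨C2, hC2, hC2'⟩ := majorant_le hm1 (E := E) (by rw [hE]; linarith)
  have h3 : ∀ j : ℕ, j ≤ k → _ := fun j hj =>
    norm_tay_part_sub_le hm (N := N) (j := j) (by
      have : (j : ℤ) ≤ k := by exact_mod_cast hj
      linarith)
  choose! C3 hC3 hC3' using h3
  set C4 := ∑ j ∈ Finset.range (k + 1), C3 j with hC4
  have hC40 : 0 ≤ C4 := Finset.sum_nonneg fun j hj =>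
    hC3 j (by have := Finset.mem_range.1 hj; omega)
  refine ⟨C1 * C2 * (2 ^ k + 2 ^ N) + C4, by positivity,
    fun δ M S g hδ hM hg hS hb hC s hs => ?_⟩
  have hS0 : 0 ≤ S := (norm_nonneg _).trans (hS [] (by simp) 0 (zero_mem_D hm1))
  have hk : ContDiffOn ℝ k g (D m) := hg.of_le (by norm_cast; exact le_max_left _ _)
  have hgN : ContDiffOn ℝ N g (D m) := hg.of_le (by norm_cast; exact le_max_right _ _)
  have hjet := jetBound_rem hm1 (k := k) (N := N) hg hδ hM
    (fun w hw => hS w (hw.trans (le_max_right _ _))) hb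
  have hR := hC1' _ _ _ _ hjet s hs
  have hR2 := hC2' (2 ^ k * δ) (2 ^ k * M + 2 ^ N * S) s (by positivity) (by positivity) hs.1
  have e1 : (E : ℝ) / m + 1 = ord m k - N := by
    rw [hE, ord]; push_cast; field_simp; ring
  have e2 : ((E : ℝ) + 1) / m + 1 = ord m k + 1 / m - N := by
    rw [hE, ord]; push_cast; field_simp; ring
  rw [e1, e2] at hR2
  set T : ℕ → ℂ := fun j => ∑ p ∈ Finset.range (j + 1),
    wirtingerAtZero p (j - p) g / (p ! * (j - p)!) *
      iteratedDerivWithin N (Phi m (1 - m + p) (1 - m + ((j - p : ℕ) : ℤ)) fun _ => 1)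
        (Set.Ioc 0 1) s with hT
  set L : ℂ := ((s ^ (ord m k - N) : ℝ) : ℂ) * ((gaugeFactor m N k : ℂ) * Cfun m k 0 g) with hL
  have hsum : ‖∑ j ∈ Finset.range (k + 1), T j - L‖ ≤ C4 * S := by
    rw [hC4, Finset.sum_range_succ, Finset.sum_range_succ, add_sub_assoc, add_mul, Finset.sum_mul]
    refine (norm_add_le _ _).trans (add_le_add ?_ ?_)
    · refine (norm_sum_le _ _).trans (Finset.sum_le_sum fun j hj => ?_)
      have hjk := Finset.mem_range.1 hj
      have := hC3' j hjk.le k S g hk hjk.le (fun w hw => hS w (hw.trans (le_max_left _ _))) s hs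
      rwa [hC j hjk, mul_zero, mul_zero, sub_zero] at this
    · exact hC3' k le_rfl k S g hk le_rfl (fun w hw => hS w (hw.trans (le_max_left _ _))) s hs
  rw [phi0, iteratedDerivWithin_Phi_expansion hm1 _ _ (k + 1) hgN hs, add_sub_assoc]
  refine (norm_add_le _ _).trans ((add_le_add (hR.trans (mul_le_mul_of_nonneg_left hR2 hC1))
    hsum).trans ?_)
  have p1 : 0 ≤ s ^ (ord m k - N) := Real.rpow_nonneg hs.1.le _
  have p2 : 0 ≤ s ^ (ord m k + 1 / m - N) := Real.rpow_nonneg hs.1.le _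
  generalize s ^ (ord m k - N) = X at p1 ⊢
  generalize s ^ (ord m k + 1 / m - N) = Y at p2 ⊢
  have q1 : 0 ≤ C1 * C2 := by positivity
  have t1 : 0 ≤ δ * X := by positivity
  have t2 : 0 ≤ (M + S) * Y := by positivity
  have t3 : 2 ^ k * δ * X + (2 ^ k * M + 2 ^ N * S) * Y ≤
      (2 ^ k + 2 ^ N) * (δ * X + (M + S) * Y + S) := by
    have : (0 : ℝ) ≤ 2 ^ N * (δ * X) + 2 ^ N * (M * Y) + 2 ^ k * (S * Y) + (2 ^ k + 2 ^ N) * S := by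
      positivity
    linarith
  have t4 := mul_le_mul_of_nonneg_left t3 q1
  have t5 : C4 * S ≤ C4 * (δ * X + (M + S) * Y + S) :=
    mul_le_mul_of_nonneg_left (by linarith) hC40
  calc _ = C1 * C2 * (2 ^ k * δ * X + (2 ^ k * M + 2 ^ N * S) * Y) + C4 * S := by ring
    _ ≤ _ := by linarith


/-! ### Orders -/

lemma neg_one_lt_ord {m : ℕ} (hm : 1 ≤ m) (k : ℕ) : -1 < ord m k := by
  have hm0 : (0 : ℝ) < m := by exact_mod_cast hm
  rw [ord, lt_div_iff₀ hm0]
  have : (0 : ℝ) ≤ k := k.cast_nonneg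
  linarith

lemma bIdx_nonneg (m k : ℕ) : 0 ≤ bIdx m k := sub_nonneg.2 (Nat.le_ceil _)

lemma bIdx_lt_one {m : ℕ} (hm : 1 ≤ m) (k : ℕ) : bIdx m k < 1 := by
  rw [bIdx, nIdx]
  rcases le_or_gt 0 (ord m k) with h | h
  · have := Nat.ceil_lt_add_one h
    linarith
  · rw [Nat.ceil_eq_zero.2 h.le]
    have := neg_one_lt_ord hm k
    simp; linarith

lemma add_two_le_mul_nIdx {m : ℕ} (hm : 1 ≤ m) (k : ℕ) :
    (k : ℤ) + 2 ≤ m * ((nIdx m k + 1 : ℕ) : ℤ) := by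
  have hm0 : (0 : ℝ) < m := by exact_mod_cast hm
  have h : ord m k ≤ nIdx m k := Nat.le_ceil _
  rw [ord, div_le_iff₀ hm0] at h
  have h2 : ((k : ℝ) + 2) ≤ m * ((nIdx m k + 1 : ℕ) : ℝ) := by push_cast; linarith
  exact_mod_cast h2

lemma ord_mono {m j k : ℕ} (h : j ≤ k) : ord m j ≤ ord m k := by
  have : (j : ℝ) ≤ k := by exact_mod_cast h
  unfold ord
  gcongr

lemma nIdx_mono {m j k : ℕ} (h : j ≤ k) : nIdx m j ≤ nIdx m k := Nat.ceil_mono (ord_mono h)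

/-- Here -𝔬(k) = b - n, and Γ(b + 1)/Γ(b - n) is a falling product, i.e. a factorial times a
binomial. When b = 0, `extGamma` gives (-1)^n/n! at -n, and this matches the convention of
`binomConv` at 0. -/
lemma gaugeFactor_eq {m : ℕ} (hm : 1 ≤ m) (k : ℕ) :
    gaugeFactor m (nIdx m k + 1) k =
      (-1) ^ (nIdx m k + 1) * (((nIdx m k + 1)! : ℝ) / (k ! : ℝ)) *
        binomConv (bIdx m k) (nIdx m k + 1) := by
  set n := nIdx m k
  set b := bIdx m k with hb
  have hb0 : 0 ≤ b := bIdx_nonneg m k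
  have ho : -ord m k = b - n := by rw [hb, bIdx]; ring
  have hk : (k ! : ℝ) ≠ 0 := by exact_mod_cast k.factorial_ne_zero
  have hn : (n ! : ℝ) ≠ 0 := by exact_mod_cast n.factorial_ne_zero
  rw [gaugeFactor, ho, show b - n + ((n + 1 : ℕ) : ℝ) = b + 1 by push_cast; ring, binomConv]
  by_cases h0 : b = 0
  · have hs : ((-1 : ℝ) ^ n) ≠ 0 := pow_ne_zero _ (by norm_num)
    have hs2 : ((-1 : ℝ) ^ n) * (-1) ^ n = 1 := by rw [← mul_pow]; norm_num
    rw [if_pos h0, h0, zero_sub, zero_add, extGamma_neg_nat, Real.Gamma_one, Nat.add_sub_cancel,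
      Nat.factorial_succ]
    push_cast
    have : (n : ℝ) + 1 ≠ 0 := by positivity
    field_simp
    rw [pow_succ]
    linear_combination (-1 : ℝ) * hs2
  · have hbpos : 0 < b := lt_of_le_of_ne hb0 (Ne.symm h0)
    have hb1 : b < 1 := bIdx_lt_one hm k
    rw [if_neg h0]
    have hg := Gamma_inv_sub_nat (b + 1) (n + 1)
    rw [add_sub_cancel_right, ← factorial_mul_ring_choose,
      show b + 1 - ((n + 1 : ℕ) : ℝ) = b - n by push_cast; ring] at hg
    have hG1 : Real.Gamma (b + 1) ≠ 0 := (Real.Gamma_pos_of_pos (by linarith)).ne'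
    have hne : ¬ ∃ q : ℕ, b - n = -(q : ℝ) := by
      rintro ⟨q, hq⟩
      have h1 : b = ((n - q : ℤ) : ℝ) := by push_cast; linarith
      rw [h1] at hbpos hb1
      have h2 : (0 : ℤ) < n - q := by exact_mod_cast hbpos
      have h3 : (n : ℤ) - q < 1 := by exact_mod_cast hb1
      omega
    rw [extGamma_of_ne hne, div_eq_mul_inv, mul_inv, hg]
    field_simp

lemma ord_sub_eq (m k : ℕ) : ord m k - ((nIdx m k + 1 : ℕ) : ℝ) = -(1 + bIdx m k) := by
  rw [bIdx]; push_cast; ring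

/-- Bounds for the derivatives of `φ_{g,0}`. -/
lemma phi0_bounds {m : ℕ} (hm : 2 ≤ m) (k : ℕ) :
    ∃ C : ℝ, 0 ≤ C ∧ ∀ (S : ℝ) (g : ℂ → ℂ),
      ContDiffOn ℝ (max k (nIdx m k + 1) : ℕ) g (D m) →
      (∀ w : List Bool, w.length ≤ max k (nIdx m k + 1) → ∀ ω ∈ D m, ‖wd m w g ω‖ ≤ S) →
      (∀ j < k, Cfun m j 0 g = 0) →
      (∀ s ∈ Set.Ioc (0 : ℝ) 1, ‖iteratedDerivWithin (nIdx m k + 1) (phi0 m g) (Set.Ioc 0 1) s‖ ≤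
        C * S * s ^ (-(1 + bIdx m k))) ∧
      ∀ i ≤ nIdx m k, ‖iteratedDerivWithin i (phi0 m g) (Set.Ioc 0 1) 1‖ ≤ C * S := by
  have hm1 : 1 ≤ m := by omega
  have hm0 : (0 : ℝ) < m := by exact_mod_cast hm1
  set N := nIdx m k + 1 with hN
  obtain ⟨C1, hC1, hC1'⟩ := norm_iteratedDerivWithin_phi0_sub_le hm (add_two_le_mul_nIdx hm1 k)
  obtain ⟨C2, hC2, hC2'⟩ := norm_tay_part_sub_le hm (N := N) (j := k) (by
    have := add_two_le_mul_nIdx hm1 k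
    have : (2 : ℤ) ≤ m := by exact_mod_cast hm
    linarith)
  have h3 := fun i => norm_iteratedDerivWithin_Phi_le hm1 i (1 - m) (1 - m)
  choose C3 hC3 hC3' using h3
  set B : ℕ → ℝ := fun i => C3 i * (2 ^ i * |majorant m 1 0 (0 + (1 - m) + (1 - m) - m * i) 1|)
    with hB
  have hB0 : ∀ i, 0 ≤ B i := fun i => mul_nonneg (hC3 i) (by positivity)
  set C4 := ∑ p ∈ Finset.range (k + 1), ‖leadCoeff m N (1 - m + p) (1 - m + ((k - p : ℕ) : ℤ))‖
    with hC4
  have hC40 : 0 ≤ C4 := Finset.sum_nonneg fun _ _ => norm_nonneg _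
  have hBs : 0 ≤ ∑ i ∈ Finset.range N, B i := Finset.sum_nonneg fun i _ => hB0 i
  refine ⟨C1 * 4 + C4 + ∑ i ∈ Finset.range N, B i, by positivity, fun S g hg hS hC => ⟨?_, ?_⟩⟩
  all_goals have hS0 : 0 ≤ S := (norm_nonneg _).trans (hS [] (by simp) 0 (zero_mem_D hm1))
  · intro s hs
    -- For a bound rather than a limit no smallness is needed: δ = 2S and M = 0 keep the constant
    -- independent of g.
    have hb : ∀ w : List Bool, w.length = k → ∀ ω ∈ D m,
        ‖wd m w g ω - wd m w g 0‖ ≤ 2 * S + 0 * ‖ω‖ := by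
      intro w hw ω hω
      have h1 := hS w (by rw [hw]; exact le_max_left _ _) ω hω
      have h2 := hS w (by rw [hw]; exact le_max_left _ _) 0 (zero_mem_D hm1)
      have h3 := norm_sub_le (wd m w g ω) (wd m w g 0)
      linarith
    have key := hC1' (2 * S) 0 S g (by positivity) le_rfl hg hS hb hC s hs
    rw [ord_sub_eq] at key
    set X := s ^ (-(1 + bIdx m k)) with hX
    have hX1 : 1 ≤ X :=
      Real.one_le_rpow_of_pos_of_le_one_of_nonpos hs.1 hs.2 (by linarith [bIdx_nonneg m k])
    have hY : s ^ (ord m k + 1 / m - N) ≤ X := by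
      refine Real.rpow_le_rpow_of_exponent_ge hs.1 hs.2 ?_
      rw [← ord_sub_eq]
      have : 0 < 1 / (m : ℝ) := by positivity
      linarith
    have hL : ‖((X : ℝ) : ℂ) * ((gaugeFactor m N k : ℂ) * Cfun m k 0 g)‖ ≤ C4 * S * X := by
      rw [← sum_leadTerm hm, norm_mul, Complex.norm_real, Real.norm_of_nonneg (by linarith),
        mul_comm]
      gcongr
      rw [hC4, Finset.sum_mul]
      refine (norm_sum_le _ _).trans (Finset.sum_le_sum fun p hp => ?_)
      rw [leadTerm, norm_mul, mul_comm]
      gcongr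
      exact norm_coeff_le hm1 (hg.of_le (by norm_cast; exact le_max_left _ _)) le_rfl
        (by have := Finset.mem_range.1 hp; omega)
        fun w hw => hS w (hw.trans (le_max_left _ _))
    have h1 := norm_le_norm_add_norm_sub'
      (iteratedDerivWithin N (phi0 m g) (Set.Ioc 0 1) s)
      (((X : ℝ) : ℂ) * ((gaugeFactor m N k : ℂ) * Cfun m k 0 g))
    have h2 : C1 * (2 * S * X + (0 + S) * s ^ (ord m k + 1 / m - N) + S) ≤ C1 * (4 * S * X) := by
      gcongr
      have h3 := mul_le_mul_of_nonneg_left hY hS0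
      have h4 := mul_le_mul_of_nonneg_left hX1 hS0
      linarith
    have h5 : 0 ≤ (∑ i ∈ Finset.range N, B i) * S * X := by positivity
    calc _ ≤ C4 * S * X + C1 * (4 * S * X) := h1.trans (add_le_add hL (key.trans h2))
      _ ≤ _ := by linarith
  · intro i hi
    -- At s = 1 there is no singularity, so no Taylor expansion is made: degree 0 is imposed on g
    -- itself, at the price of 2 ^ i because ‖ω‖ ≤ 2.
    have hjet : JetBound m i 0 (2 ^ i * S) 0 g := by
      refine ⟨hg.of_le (by norm_cast; omega), fun w hw ω hω h0 => ?_⟩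
      refine (hS w (by omega) ω hω).trans ?_
      have hpos : 0 < ‖ω‖ := norm_pos_iff.2 h0
      have h2 : ‖ω‖ ^ w.length ≤ 2 ^ i :=
        (pow_le_pow_left₀ hpos.le (norm_le_two_of_mem_D hm1 hω) _).trans
          (pow_le_pow_right₀ (by norm_num) hw)
      rw [zero_mul, add_zero, zero_sub, zpow_neg, zpow_natCast, ← div_eq_mul_inv,
        le_div_iff₀ (by positivity), mul_comm]
      gcongr
    have h1 := hC3' i _ _ _ g hjet 1 ⟨one_pos, le_rfl⟩
    have h2 : ∀ E, majorant m (2 ^ i * S) 0 E 1 = 2 ^ i * S * majorant m 1 0 E 1 := by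
      intro E
      simp only [majorant]
      rw [← intervalIntegral.integral_const_mul]
      refine intervalIntegral.integral_congr fun u _ => ?_
      ring
    rw [h2] at h1
    refine h1.trans ?_
    have h3 : B i ≤ ∑ i ∈ Finset.range N, B i :=
      Finset.single_le_sum (fun i _ => hB0 i) (Finset.mem_range.2 (by omega))
    have h4 : C3 i * (2 ^ i * S * majorant m 1 0 (0 + (1 - m) + (1 - m) - m * i) 1) ≤ B i * S := by
      simp only [hB]
      have := le_abs_self (majorant m 1 0 (0 + (1 - m) + (1 - m) - m * i) 1)
      calc _ ≤ C3 i * (2 ^ i * S * |majorant m 1 0 (0 + (1 - m) + (1 - m) - m * i) 1|) := by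
            have := hC3 i
            gcongr
        _ = _ := by ring
    refine h4.trans (mul_le_mul_of_nonneg_right ?_ hS0)
    have : 0 ≤ C1 * 4 := by positivity
    linarith

/-- Given the tolerance, δ is fixed first; the constant M it requires may be large but only
multiplies s^{1/m}, which tends to 0. -/
lemma tendsto_phi0 {m : ℕ} (hm : 2 ≤ m) (k : ℕ) {S : ℝ} {g : ℂ → ℂ}
    (hg : ContDiffOn ℝ (max k (nIdx m k + 1) : ℕ) g (D m))
    (hS : ∀ w : List Bool, w.length ≤ max k (nIdx m k + 1) → ∀ ω ∈ D m, ‖wd m w g ω‖ ≤ S)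
    (hC : ∀ j < k, Cfun m j 0 g = 0) :
    Tendsto (fun s : ℝ => ((s ^ (bIdx m k + 1) : ℝ) : ℂ) *
      iteratedDerivWithin (nIdx m k + 1) (phi0 m g) (Set.Ioc 0 1) s) (𝓝[Set.Ioc 0 1] 0)
      (𝓝 ((gaugeFactor m (nIdx m k + 1) k : ℂ) * Cfun m k 0 g)) := by
  have hm1 : 1 ≤ m := by omega
  have hm0 : (0 : ℝ) < m := by exact_mod_cast hm1
  have hS0 : 0 ≤ S := (norm_nonneg _).trans (hS [] (by simp) 0 (zero_mem_D hm1))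
  set N := nIdx m k + 1 with hN
  set b := bIdx m k with hb
  have hb0 : 0 ≤ b := bIdx_nonneg m k
  obtain ⟨C, hC0, hC'⟩ := norm_iteratedDerivWithin_phi0_sub_le hm (add_two_le_mul_nIdx hm1 k)
  rw [Metric.tendsto_nhds]
  intro ε hε
  -- This makes C * δ ≤ ε / 2; the + 1 avoids dividing by zero when C = 0.
  have hδ : 0 < ε / (2 * (C + 1)) := by positivity
  have hgk : ContDiffOn ℝ k g (D m) := hg.of_le (by norm_cast; exact le_max_left _ _)
  obtain ⟨M, hM, hM'⟩ := exists_modulus hm1 hgk hδ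
  have hlim : Tendsto (fun s : ℝ => C * ((M + S) * s ^ (1 / (m : ℝ)) + S * s ^ (b + 1)))
      (𝓝[Set.Ioc 0 1] 0) (𝓝 0) := by
    have h1 : ∀ e : ℝ, 0 < e → Tendsto (fun s : ℝ => s ^ e) (𝓝[Set.Ioc 0 1] 0) (𝓝 0) := by
      intro e he
      have := (Real.continuousAt_rpow_const 0 e (Or.inr he.le)).tendsto
      rw [Real.zero_rpow he.ne'] at this
      exact this.mono_left nhdsWithin_le_nhds
    have := (((h1 (1 / (m : ℝ)) (by positivity)).const_mul (M + S)).add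
      ((h1 (b + 1) (by linarith)).const_mul S)).const_mul C
    simpa using this
  filter_upwards [hlim.eventually (gt_mem_nhds (half_pos hε)), self_mem_nhdsWithin] with s h1 hs
  have key := hC' _ M S g hδ.le hM hg hS hM' hC s hs
  rw [ord_sub_eq, ← hb] at key
  have hX : s ^ (b + 1) * s ^ (-(1 + b)) = 1 := by
    rw [← Real.rpow_add hs.1, show b + 1 + -(1 + b) = 0 by ring, Real.rpow_zero]
  have hY : s ^ (b + 1) * s ^ (ord m k + 1 / m - N) = s ^ (1 / (m : ℝ)) := by
    rw [← Real.rpow_add hs.1]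
    congr 1
    have := ord_sub_eq m k
    rw [← hb, ← hN] at this
    linarith
  have hP : 0 < s ^ (b + 1) := Real.rpow_pos_of_pos hs.1 _
  rw [dist_eq_norm]
  set I := iteratedDerivWithin N (phi0 m g) (Set.Ioc 0 1) s
  set Z := (gaugeFactor m N k : ℂ) * Cfun m k 0 g
  have e : ((s ^ (b + 1) : ℝ) : ℂ) * I - Z =
      ((s ^ (b + 1) : ℝ) : ℂ) * (I - ((s ^ (-(1 + b)) : ℝ) : ℂ) * Z) := by
    have : ((s ^ (b + 1) : ℝ) : ℂ) * ((s ^ (-(1 + b)) : ℝ) : ℂ) = 1 := by exact_mod_cast hX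
    linear_combination Z * this
  rw [e, norm_mul, Complex.norm_real, Real.norm_of_nonneg hP.le]
  refine (mul_le_mul_of_nonneg_left key hP.le).trans_lt ?_
  calc s ^ (b + 1) * (C * (ε / (2 * (C + 1)) * s ^ (-(1 + b)) +
        (M + S) * s ^ (ord m k + 1 / m - N) + S))
      = C * (ε / (2 * (C + 1)) * (s ^ (b + 1) * s ^ (-(1 + b))) +
        (M + S) * (s ^ (b + 1) * s ^ (ord m k + 1 / m - N)) + S * s ^ (b + 1)) := by ring
    _ = C * (ε / (2 * (C + 1))) + C * ((M + S) * s ^ (1 / (m : ℝ)) + S * s ^ (b + 1)) := by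
        rw [hX, hY]; ring
    _ < ε := by
        have : C * (ε / (2 * (C + 1))) ≤ ε / 2 := by
          rw [mul_div_assoc', div_le_div_iff₀ (by positivity) (by positivity)]
          nlinarith
        linarith

/-! ### Functions on the half-open unit interval with a controlled singularity -/

lemma hasDerivWithinAt_iteratedDerivWithin {ψ : ℝ → ℂ} {n i : ℕ}
    (hψ : ContDiffOn ℝ n ψ (Set.Ioc 0 1)) (hi : i < n) {t : ℝ} (ht : t ∈ Set.Ioc (0 : ℝ) 1) :
    HasDerivWithinAt (iteratedDerivWithin i ψ (Set.Ioc 0 1))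
      (iteratedDerivWithin (i + 1) ψ (Set.Ioc 0 1) t) (Set.Ioc 0 1) t := by
  rw [iteratedDerivWithin_succ]
  exact (hψ.differentiableOn_iteratedDerivWithin (by exact_mod_cast hi) uniqueDiffOn_Ioc01 t
    ht).hasDerivWithinAt

lemma norm_sub_le_of_deriv_le {g g' : ℝ → ℂ} {P P' : ℝ → ℝ}
    (hg : ∀ t ∈ Set.Ioc (0 : ℝ) 1, HasDerivWithinAt g (g' t) (Set.Ioc 0 1) t)
    (hP : ∀ t ∈ Set.Ioc (0 : ℝ) 1, HasDerivAt P (P' t) t)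
    (hle : ∀ t ∈ Set.Ioc (0 : ℝ) 1, ‖g' t‖ ≤ P' t) {x y : ℝ} (hx : 0 < x) (hxy : x ≤ y)
    (hy : y ≤ 1) : ‖g y - g x‖ ≤ P y - P x := by
  have hsub : Set.Icc x y ⊆ Set.Ioc 0 1 := fun t ht => ⟨hx.trans_le ht.1, ht.2.trans hy⟩
  refine image_norm_le_of_norm_deriv_right_le_deriv_boundary' (f := fun t => g t - g x)
    (f' := g') (B := fun t => P t - P x) (B' := P') (a := x) (b := y) ?_ ?_ (by simp) ?_ ?_ ?_
    ⟨hxy, le_rfl⟩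
  · exact fun t ht => (((hg t (hsub ht)).continuousWithinAt).mono hsub).sub continuousWithinAt_const
  · intro t ht
    have h1 := hsub ⟨ht.1, ht.2.le⟩
    have h2 : Set.Ioc (0 : ℝ) 1 ∈ 𝓝 t := Ioc_mem_nhds h1.1 (ht.2.trans_le hy)
    exact (((hg t h1).hasDerivAt h2).sub_const _).hasDerivWithinAt
  · exact fun t ht => ((hP t (hsub ht)).continuousAt.continuousWithinAt).sub
      continuousWithinAt_const
  · exact fun t ht => ((hP t (hsub ⟨ht.1, ht.2.le⟩)).sub_const _).hasDerivWithinAt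
  · exact fun t ht => hle t (hsub ⟨ht.1, ht.2.le⟩)

lemma norm_le_of_deriv_le_rpow {g g' : ℝ → ℂ} {A B β : ℝ} (hβ : 0 < β) (hA : 0 ≤ A)
    (hg : ∀ t ∈ Set.Ioc (0 : ℝ) 1, HasDerivWithinAt g (g' t) (Set.Ioc 0 1) t)
    (hg' : ∀ t ∈ Set.Ioc (0 : ℝ) 1, ‖g' t‖ ≤ B * t ^ (-(1 + β))) (h1 : ‖g 1‖ ≤ A) :
    ∀ t ∈ Set.Ioc (0 : ℝ) 1, ‖g t‖ ≤ (A + B / β) * t ^ (-β) := by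
  intro t ht
  have hB : 0 ≤ B := by simpa using (norm_nonneg _).trans (hg' 1 ⟨one_pos, le_rfl⟩)
  have hP : ∀ t ∈ Set.Ioc (0 : ℝ) 1,
      HasDerivAt (fun t : ℝ => -(B / β) * t ^ (-β)) (B * t ^ (-(1 + β))) t := by
    intro t ht
    refine ((Real.hasDerivAt_rpow_const (p := -β) (Or.inl ht.1.ne')).const_mul
      (-(B / β))).congr_deriv ?_
    rw [show -β - 1 = -(1 + β) by ring]
    field_simp
  have h := norm_sub_le_of_deriv_le hg hP hg' ht.1 ht.2 le_rfl
  have h2 := norm_le_norm_add_norm_sub (g 1) (g t)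
  have hX : 1 ≤ t ^ (-β) := Real.one_le_rpow_of_pos_of_le_one_of_nonpos ht.1 ht.2 (by linarith)
  have hBβ : 0 ≤ B / β := by positivity
  simp only [Real.one_rpow] at h
  nlinarith

lemma norm_le_of_deriv_le_inv {g g' : ℝ → ℂ} {A : ℝ}
    (hg : ∀ t ∈ Set.Ioc (0 : ℝ) 1, HasDerivWithinAt g (g' t) (Set.Ioc 0 1) t)
    (hg' : ∀ t ∈ Set.Ioc (0 : ℝ) 1, ‖g' t‖ ≤ A * t ^ (-(1 : ℝ))) (h1 : ‖g 1‖ ≤ A) :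
    ∀ t ∈ Set.Ioc (0 : ℝ) 1, ‖g t‖ ≤ A * (1 - Real.log t) := by
  intro t ht
  have hP : ∀ t ∈ Set.Ioc (0 : ℝ) 1,
      HasDerivAt (fun t : ℝ => A * Real.log t) (A * t ^ (-(1 : ℝ))) t := by
    intro t ht
    rw [Real.rpow_neg_one]
    exact (Real.hasDerivAt_log ht.1.ne').const_mul A
  have h := norm_sub_le_of_deriv_le hg hP hg' ht.1 ht.2 le_rfl
  have h2 := norm_le_norm_add_norm_sub (g 1) (g t)
  simp only [Real.log_one] at h
  linarith

/-- `ψ` is of class `C^N` on `(0, 1]`, its derivatives of lower order are bounded by `A` at `1` and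
the one of order `N` is bounded by `A * s ^ (-(1 + b))`. -/
structure PowerBound (N : ℕ) (b A : ℝ) (ψ : ℝ → ℂ) : Prop where
  contDiffOn : ContDiffOn ℝ N ψ (Set.Ioc 0 1)
  norm_top_le : ∀ s ∈ Set.Ioc (0 : ℝ) 1,
    ‖iteratedDerivWithin N ψ (Set.Ioc 0 1) s‖ ≤ A * s ^ (-(1 + b))
  norm_one_le : ∀ i < N, ‖iteratedDerivWithin i ψ (Set.Ioc 0 1) 1‖ ≤ A

section PowerBound

variable {N : ℕ} {b A : ℝ} {ψ : ℝ → ℂ}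

lemma PowerBound.nonneg (h : PowerBound N b A ψ) : 0 ≤ A := by
  simpa using (norm_nonneg _).trans (h.norm_top_le 1 ⟨one_pos, le_rfl⟩)

lemma PowerBound.mono {b' : ℝ} (h : PowerBound N b A ψ) (hb : b ≤ b') : PowerBound N b' A ψ :=
  ⟨h.contDiffOn, fun s hs => (h.norm_top_le s hs).trans (mul_le_mul_of_nonneg_left
    (Real.rpow_le_rpow_of_exponent_ge hs.1 hs.2 (by linarith)) h.nonneg), h.norm_one_le⟩

/-- Each integration from 1 turns a bound B s^{-(1+b)} into (A + 2B) s^{-b}, using 1/b ≤ 2. The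
result is then weakened back to s^{-(1+b)}: wasteful, but s^{-b} suffices for integrability. The
recursion B ↦ A + 2B started at A produces (2^{j+2} - 1) A. -/
lemma PowerBound.norm_iteratedDerivWithin_le (hb : 1 / 2 ≤ b) (h : PowerBound N b A ψ) :
    ∀ j i : ℕ, i + j + 1 = N → ∀ s ∈ Set.Ioc (0 : ℝ) 1,
      ‖iteratedDerivWithin i ψ (Set.Ioc 0 1) s‖ ≤ (2 ^ (j + 2) - 1) * A * s ^ (-b) := by
  have hA := h.nonneg
  have step : ∀ (i : ℕ) (B : ℝ), i < N → (∀ s ∈ Set.Ioc (0 : ℝ) 1,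
      ‖iteratedDerivWithin (i + 1) ψ (Set.Ioc 0 1) s‖ ≤ B * s ^ (-(1 + b))) →
      ∀ s ∈ Set.Ioc (0 : ℝ) 1,
      ‖iteratedDerivWithin i ψ (Set.Ioc 0 1) s‖ ≤ (A + 2 * B) * s ^ (-b) := by
    intro i B hi hB s hs
    have hB0 : 0 ≤ B := by simpa using (norm_nonneg _).trans (hB 1 ⟨one_pos, le_rfl⟩)
    refine (norm_le_of_deriv_le_rpow (by linarith) hA
      (fun t ht => hasDerivWithinAt_iteratedDerivWithin h.contDiffOn hi ht) hB
      (h.norm_one_le i hi) s hs).trans (mul_le_mul_of_nonneg_right ?_ (Real.rpow_nonneg hs.1.le _))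
    have : B / b ≤ 2 * B := by
      rw [div_le_iff₀ (by linarith)]
      nlinarith
    linarith
  intro j
  induction j with
  | zero =>
    intro i hi s hs
    refine (step i A (by omega) (by simpa [← hi] using h.norm_top_le) s hs).trans_eq ?_
    ring
  | succ j ih =>
    intro i hi s hs
    refine (step i ((2 ^ (j + 2) - 1) * A) (by omega) (fun t ht =>
      (ih (i + 1) (by omega) t ht).trans (mul_le_mul_of_nonneg_left
        (Real.rpow_le_rpow_of_exponent_ge ht.1 ht.2 (by linarith)) ?_)) s hs).trans_eq ?_
    · have : (1 : ℝ) ≤ 2 ^ (j + 2) := one_le_pow₀ (by norm_num)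
      exact mul_nonneg (by linarith) hA
    · ring

/-! ### Norms derived from a power bound -/

lemma lintegral_rpow_neg_lt_top (hb : b < 1) :
    ∫⁻ s in Set.Ioc (0 : ℝ) 1, ENNReal.ofReal (s ^ (-b)) < ∞ := by
  have h : IntegrableOn (fun s : ℝ => s ^ (-b)) (Set.Ioc 0 1) :=
    (intervalIntegrable_iff_integrableOn_Ioc_of_le zero_le_one).1
      (intervalIntegral.intervalIntegrable_rpow' (by linarith))
  exact h.lintegral_lt_top

lemma exists_sumL1_le (N : ℕ) (hb : b < 1) : ∃ C : ℝ≥0, ∀ (ψ : ℝ → ℂ) (A : ℝ),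
    PowerBound N b A ψ → ∀ p < N, sumL1 (Set.Ioc 0 1) p ψ ≤ C * ENNReal.ofReal A := by
  -- Raising b to at least 1/2 keeps the power integrable and avoids a separate logarithmic argument
  -- at b = 0.
  set W := ∫⁻ s in Set.Ioc (0 : ℝ) 1, ENNReal.ofReal (s ^ (-max b (1 / 2))) with hW
  have hWt : W ≠ ∞ := (lintegral_rpow_neg_lt_top (max_lt hb (by norm_num))).ne
  refine ⟨N * 2 ^ (N + 1) * W.toNNReal, fun ψ A h p hp => ?_⟩
  have hA := h.nonneg
  have hi : ∀ i ∈ Finset.range (p + 1),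
      ∫⁻ s in Set.Ioc (0 : ℝ) 1, ‖iteratedDerivWithin i ψ (Set.Ioc 0 1) s‖ₑ ≤
        ENNReal.ofReal (2 ^ (N + 1) * A) * W := by
    intro i hi
    have hi' := Finset.mem_range.1 hi
    rw [hW, ← lintegral_const_mul' _ _ ENNReal.ofReal_ne_top]
    refine setLIntegral_mono' measurableSet_Ioc fun s hs => ?_
    rw [← ENNReal.ofReal_mul (by positivity), ← ofReal_norm]
    refine ENNReal.ofReal_le_ofReal (((h.mono (le_max_left b (1 / 2))).norm_iteratedDerivWithin_le
      (le_max_right _ _) (N - 1 - i) i (by omega) s hs).trans ?_)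
    have := Real.rpow_nonneg hs.1.le (-max b (1 / 2))
    gcongr
    have h2 : (2 : ℝ) ^ (N - 1 - i + 2) ≤ 2 ^ (N + 1) :=
      pow_le_pow_right₀ (by norm_num) (by omega)
    linarith
  refine (Finset.sum_le_card_nsmul _ _ _ hi).trans ?_
  rw [Finset.card_range, nsmul_eq_mul, ENNReal.ofReal_mul (by positivity)]
  have e : ENNReal.ofReal (2 ^ (N + 1)) = 2 ^ (N + 1) := by
    rw [ENNReal.ofReal_pow (by norm_num)]; norm_num
  rw [e]
  push_cast
  rw [ENNReal.coe_toNNReal hWt]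
  calc ((p : ℝ≥0∞) + 1) * (2 ^ (N + 1) * ENNReal.ofReal A * W)
      ≤ N * (2 ^ (N + 1) * ENNReal.ofReal A * W) := by
        gcongr
        exact_mod_cast hp
    _ = _ := by ring

lemma PowerBound.pSeminorm_le {n : ℕ} (h : PowerBound (n + 1) b A ψ) :
    pSeminorm (Set.Ioc 0 1) n b ψ ≤ ENNReal.ofReal A := by
  refine iSup₂_le fun s hs => ENNReal.ofReal_le_ofReal ?_
  have hs0 : (0 : ℝ) < s := hs.1
  rw [abs_of_pos hs0]
  have h1 := mul_le_mul_of_nonneg_left (h.norm_top_le s hs) (Real.rpow_nonneg hs0.le (1 + b))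
  have h2 : s ^ (1 + b) * s ^ (-(1 + b)) = 1 := by
    rw [← Real.rpow_add hs0, add_neg_cancel, Real.rpow_zero]
  calc _ ≤ _ := h1
    _ = A * (s ^ (1 + b) * s ^ (-(1 + b))) := by ring
    _ = A := by rw [h2, mul_one]

lemma modSeminorm_le_of_forall_lt {J : Set ℝ} {ω : ℝ → ℝ} {g : ℝ → ℂ} {C : ℝ}
    (h : ∀ x ∈ J, ∀ y ∈ J, x < y → ‖g y - g x‖ / ω (y - x) ≤ C) :
    modSeminorm J ω g ≤ ENNReal.ofReal C := by
  refine iSup₂_le fun x hx => iSup₂_le fun y hy => iSup_le fun hxy =>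
    ENNReal.ofReal_le_ofReal ?_
  rcases lt_or_gt_of_ne hxy with hlt | hlt
  · rw [norm_sub_rev, abs_sub_comm, abs_of_pos (sub_pos.2 hlt)]
    exact h x hx y hy hlt
  · rw [abs_of_pos (sub_pos.2 hlt)]
    exact h y hy x hx hlt

/-- One integration bounds the derivative of order n + 1 by a multiple of t^{-b}; a second bounds
the increment by y^{1-b} - x^{1-b} ≤ (y - x)^{1-b}, since t ↦ t^{1-b} is subadditive. -/
lemma PowerBound.modSeminorm_rpow_le {n : ℕ} (h : PowerBound (n + 2) b A ψ) (hb0 : 0 < b)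
    (hb : b < 1) :
    modSeminorm (Set.Ioc 0 1) (fun t => t ^ (1 - b)) (iteratedDerivWithin n ψ (Set.Ioc 0 1)) ≤
      ENNReal.ofReal ((1 + 1 / b) / (1 - b) * A) := by
  have hA := h.nonneg
  have hb1 : 0 < 1 - b := by linarith
  refine modSeminorm_le_of_forall_lt fun x hx y hy hxy => ?_
  have hd : 0 < y - x := sub_pos.2 hxy
  have h1 := norm_le_of_deriv_le_rpow hb0 hA
    (fun t ht => hasDerivWithinAt_iteratedDerivWithin (i := n + 1) h.contDiffOn (by omega) ht)
    h.norm_top_le (h.norm_one_le _ (by omega))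
  set B := A + A / b with hB
  have hB0 : 0 ≤ B := by positivity
  have hP : ∀ t ∈ Set.Ioc (0 : ℝ) 1,
      HasDerivAt (fun t : ℝ => B / (1 - b) * t ^ (1 - b)) (B * t ^ (-b)) t := by
    intro t ht
    refine ((Real.hasDerivAt_rpow_const (p := 1 - b) (Or.inl ht.1.ne')).const_mul
      (B / (1 - b))).congr_deriv ?_
    rw [show 1 - b - 1 = -b by ring]
    field_simp
  have h2 := norm_sub_le_of_deriv_le
    (fun t ht => hasDerivWithinAt_iteratedDerivWithin (i := n) h.contDiffOn (by omega) ht)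
    hP h1 hx.1 hxy.le hy.2
  rw [div_le_iff₀ (Real.rpow_pos_of_pos hd _)]
  have h3 := Real.rpow_add_le_add_rpow hx.1.le hd.le hb1.le (by linarith)
  rw [add_sub_cancel] at h3
  have h4 : 0 ≤ B / (1 - b) := by positivity
  calc _ ≤ _ := h2
    _ = B / (1 - b) * (y ^ (1 - b) - x ^ (1 - b)) := by ring
    _ ≤ B / (1 - b) * (y - x) ^ (1 - b) := by gcongr; linarith
    _ = _ := by rw [hB]; ring

/-- Below e⁻¹ the logarithm is at most -1, so the left side is at most 3η(d). Above e⁻¹ it is at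
most d + 1 ≤ 2, and 2 ≤ 6e⁻¹ because e < 3; hence the constant 6. -/
lemma two_mul_sub_mul_log_le_etaFun {d : ℝ} (h0 : 0 < d) (h1 : d ≤ 1) :
    2 * d - d * Real.log d ≤ 6 * etaFun d := by
  rw [etaFun]
  split_ifs with h
  · have h2 : Real.log d ≤ -1 := by
      rw [← Real.log_exp (-1)]; exact Real.log_le_log h0 h
    nlinarith
  · have h2 := Real.one_sub_inv_le_log_of_pos h0
    have h3 : d * (1 - d⁻¹) = d - 1 := by field_simp
    have h4 := mul_le_mul_of_nonneg_left h2 h0.le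
    have h5 : 1 / 3 ≤ Real.exp (-1) := by
      rw [Real.exp_neg, one_div]
      gcongr
      linarith [Real.exp_one_lt_d9]
    linarith

lemma etaFun_pos {d : ℝ} (h0 : 0 < d) (h1 : d ≤ 1) : 0 < etaFun d := by
  have h2 := two_mul_sub_mul_log_le_etaFun h0 h1
  have h3 := Real.log_nonpos h0.le h1
  nlinarith

/-- For b = 0 the first integration gives A(1 - log t), with primitive A(2t - t log t). Its
increment is at most its expression at y - x, because log x and log(y - x) are both at most log y.
-/
lemma PowerBound.modSeminorm_etaFun_le {n : ℕ} (h : PowerBound (n + 2) 0 A ψ) :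
    modSeminorm (Set.Ioc 0 1) etaFun (iteratedDerivWithin n ψ (Set.Ioc 0 1)) ≤
      ENNReal.ofReal (6 * A) := by
  have hA := h.nonneg
  refine modSeminorm_le_of_forall_lt fun x hx y hy hxy => ?_
  have hd : 0 < y - x := sub_pos.2 hxy
  have hd1 : y - x ≤ 1 := by linarith [hx.1, hy.2]
  have hy0 : 0 < y := hx.1.trans hxy
  have h1 := norm_le_of_deriv_le_inv
    (fun t ht => hasDerivWithinAt_iteratedDerivWithin (i := n + 1) h.contDiffOn (by omega) ht)
    (by simpa using h.norm_top_le) (h.norm_one_le _ (by omega))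
  have hP : ∀ t ∈ Set.Ioc (0 : ℝ) 1,
      HasDerivAt (fun t : ℝ => A * (2 * t - t * Real.log t)) (A * (1 - Real.log t)) t := by
    intro t ht
    refine ((((hasDerivAt_id t).const_mul 2).sub (Real.hasDerivAt_mul_log ht.1.ne')).const_mul
      A).congr_deriv ?_
    ring
  have h2 := norm_sub_le_of_deriv_le
    (fun t ht => hasDerivWithinAt_iteratedDerivWithin (i := n) h.contDiffOn (by omega) ht)
    hP h1 hx.1 hxy.le hy.2
  rw [div_le_iff₀ (etaFun_pos hd hd1)]
  have h3 := two_mul_sub_mul_log_le_etaFun hd hd1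
  have h4 := mul_le_mul_of_nonneg_left (Real.log_le_log hx.1 hxy.le) hx.1.le
  have h5 := mul_le_mul_of_nonneg_left
    (Real.log_le_log hd (show y - x ≤ y by linarith [hx.1])) hd.le
  have h6 : 2 * y - y * Real.log y - (2 * x - x * Real.log x) ≤ 6 * etaFun (y - x) := by
    nlinarith
  calc _ ≤ _ := h2
    _ = A * (2 * y - y * Real.log y - (2 * x - x * Real.log x)) := by ring
    _ ≤ A * (6 * etaFun (y - x)) := by gcongr
    _ = _ := by ring

end PowerBound

lemma ord_eq_nIdx_sub (m k : ℕ) : ord m k = nIdx m k - bIdx m k := by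
  rw [bIdx]; ring

lemma one_le_nIdx {m k : ℕ} (hm : 2 ≤ m) (hk : m - 1 ≤ k) : 1 ≤ nIdx m k := by
  rw [nIdx, Nat.one_le_ceil_iff, ord]
  have : (m : ℝ) ≤ k + 1 := by exact_mod_cast (by omega : m ≤ k + 1)
  exact div_pos (by linarith) (by positivity)

/-- The exponent `𝔢(k)` in terms of `n` and `b`. -/
lemma expo_cases {m k : ℕ} (hm : 2 ≤ m) (hk : m - 1 ≤ k) :
    (expo m k).order + 1 = nIdx m k ∧
      ((bIdx m k = 0 ∧ (expo m k).modulus = etaFun) ∨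
        (0 < bIdx m k ∧ (expo m k).modulus = fun t => t ^ (1 - bIdx m k))) := by
  have hn := one_le_nIdx hm hk
  have hm0 : (0 : ℝ) < m := by positivity
  have hb1 := bIdx_lt_one (m := m) (by omega) k
  have hb0 := bIdx_nonneg m k
  rw [expo]
  split_ifs with hd
  · obtain ⟨q, hq⟩ := hd
    have ho : ord m k = q := by
      rw [ord, div_eq_iff hm0.ne']
      have : ((k : ℤ) : ℝ) - ((m : ℤ) - 2) = ((m : ℤ) : ℝ) * q := by exact_mod_cast hq
      push_cast at this
      linarith
    have h1 : (nIdx m k : ℤ) = q := by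
      have e := ord_eq_nIdx_sub m k
      rw [ho] at e
      have h2 : ((nIdx m k : ℤ) : ℝ) < (q : ℝ) + 1 := by push_cast; linarith
      have h3 : (q : ℝ) ≤ ((nIdx m k : ℤ) : ℝ) := by push_cast; linarith
      have h2' : (nIdx m k : ℤ) < q + 1 := by exact_mod_cast h2
      have h3' : q ≤ (nIdx m k : ℤ) := by exact_mod_cast h3
      omega
    have h2 : ((k : ℤ) - 2 * ((m : ℤ) - 1)) / (m : ℤ) = q - 1 := by
      rw [show (k : ℤ) - 2 * ((m : ℤ) - 1) = m * (q - 1) by linarith]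
      exact Int.mul_ediv_cancel_left _ (by omega)
    refine ⟨?_, Or.inl ⟨?_, rfl⟩⟩
    · simp only [RegExp.order, h2]
      omega
    · rw [bIdx, ho, ← h1]; simp
  · have hb : 0 < bIdx m k := by
      refine lt_of_le_of_ne hb0 fun h => hd ?_
      have e := ord_eq_nIdx_sub m k
      rw [← h, sub_zero, ord, div_eq_iff hm0.ne'] at e
      refine ⟨nIdx m k, ?_⟩
      have : ((k : ℤ) : ℝ) - ((m : ℤ) - 2) = ((m : ℤ) : ℝ) * (nIdx m k : ℤ) := by
        push_cast; linarith
      exact_mod_cast this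
    have e := ord_eq_nIdx_sub m k
    have hn' : (1 : ℝ) ≤ nIdx m k := by exact_mod_cast hn
    have hf : ⌊ord m k⌋ = (nIdx m k : ℤ) - 1 := by
      rw [Int.floor_eq_iff]
      push_cast
      constructor <;> linarith
    refine ⟨?_, Or.inr ⟨hb, ?_⟩⟩
    · simp only [RegExp.order]
      have : ⌊ord m k⌋₊ = nIdx m k - 1 := by
        rw [← Int.floor_toNat, hf]; omega
      omega
    · simp only [RegExp.modulus, Int.fract, hf]
      push_cast
      rw [show ord m k - (nIdx m k - 1) = 1 - bIdx m k by linarith]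

/-! ### Regularity excludes singular top derivatives -/

lemma exists_norm_sub_le_of_modSeminorm_lt_top {ω : ℝ → ℝ} {g : ℝ → ℂ}
    (h : modSeminorm (Set.Ioc 0 1) ω g < ∞) (hω : ∀ t, 0 < t → t ≤ 1 → 0 < ω t) :
    ∃ M : ℝ, 0 ≤ M ∧ ∀ x y : ℝ, 0 < x → x < y → y ≤ 1 → ‖g y - g x‖ ≤ M * ω (y - x) := by
  refine ⟨(modSeminorm (Set.Ioc 0 1) ω g).toReal, ENNReal.toReal_nonneg, fun x y hx hxy hy => ?_⟩
  have hd : 0 < ω (y - x) := hω _ (sub_pos.2 hxy) (by linarith)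
  rw [← div_le_iff₀ hd]
  have h1 : ENNReal.ofReal (‖g y - g x‖ / ω |y - x|) ≤ modSeminorm (Set.Ioc 0 1) ω g :=
    le_iSup₂_of_le y ⟨hx.trans hxy, hy⟩ (le_iSup₂_of_le x ⟨hx, hxy.le.trans hy⟩
      (le_iSup_of_le hxy.ne' le_rfl))
  rw [abs_of_pos (sub_pos.2 hxy)] at h1
  have h2 := ENNReal.toReal_mono h.ne h1
  rwa [ENNReal.toReal_ofReal (by positivity)] at h2

/-- Pairing with the conjugate of c turns a complex asymptotic into a one-sided lower bound on a
real function, to which the mean value theorem with an intermediate point applies. -/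
lemma exists_le_re_of_tendsto {Φ : ℝ → ℂ} {c : ℂ} {b : ℝ} (hc : c ≠ 0)
    (hlim : Tendsto (fun s : ℝ => ((s ^ (b + 1) : ℝ) : ℂ) * Φ s) (𝓝[Set.Ioc 0 1] 0) (𝓝 c)) :
    ∃ δ : ℝ, 0 < δ ∧ δ ≤ 1 ∧ ∀ s, 0 < s → s < δ →
      ‖c‖ ^ 2 / 2 * s ^ (-(1 + b)) ≤ (star c * Φ s).re := by
  have hc0 : 0 < ‖c‖ := norm_pos_iff.2 hc
  rw [Metric.tendsto_nhdsWithin_nhds] at hlim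
  obtain ⟨δ, hδ, h⟩ := hlim (‖c‖ / 2) (half_pos hc0)
  refine ⟨min δ 1, lt_min hδ one_pos, min_le_right _ _, fun s hs hsδ => ?_⟩
  have h1 := (h ⟨hs, (hsδ.trans_le (min_le_right _ _)).le⟩
    (by rw [Real.dist_0_eq_abs, abs_of_pos hs]; exact hsδ.trans_le (min_le_left _ _))).le
  rw [dist_eq_norm] at h1
  have hX : s ^ (-(1 + b)) * s ^ (b + 1) = 1 := by
    rw [← Real.rpow_add hs, show -(1 + b) + (b + 1) = 0 by ring, Real.rpow_zero]
  set y := s ^ (b + 1) with hy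
  have h2 : ‖c‖ ^ 2 / 2 ≤ y * (star c * Φ s).re := by
    have e : star c * (((y : ℝ) : ℂ) * Φ s) = star c * c + star c * (((y : ℝ) : ℂ) * Φ s - c) := by
      ring
    have e2 : y * (star c * Φ s).re = (star c * (((y : ℝ) : ℂ) * Φ s)).re := by
      rw [mul_left_comm, Complex.re_ofReal_mul]
    have e3 : (star c * c).re = ‖c‖ ^ 2 := by
      rw [Complex.star_def, mul_comm, Complex.mul_conj, Complex.normSq_eq_norm_sq,
        Complex.ofReal_re]
    have h3 := (abs_le.1 (Complex.abs_re_le_norm (star c * (((y : ℝ) : ℂ) * Φ s - c)))).1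
    rw [norm_mul, norm_star] at h3
    have h4 := mul_le_mul_of_nonneg_left h1 hc0.le
    rw [e2, e, Complex.add_re, e3]
    nlinarith
  have h5 := mul_le_mul_of_nonneg_left h2 (Real.rpow_nonneg hs.le (-(1 + b)))
  calc _ = s ^ (-(1 + b)) * (‖c‖ ^ 2 / 2) := mul_comm _ _
    _ ≤ _ := h5
    _ = (s ^ (-(1 + b)) * y) * (star c * Φ s).re := by ring
    _ = _ := by rw [hX, one_mul]

/-- On [s, 2s] the intermediate point is at most 2s, so the increment is at least κ (2s)^{-(1+b)} s,
which stays away from 0 because b ≥ 0 and s ≤ 1. -/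
lemma le_sub_of_le_deriv {h h' : ℝ → ℝ} {κ b δ : ℝ} (hκ : 0 ≤ κ) (hb : 0 ≤ b)
    (hd : ∀ t, 0 < t → t < δ → HasDerivAt h (h' t) t)
    (hle : ∀ t, 0 < t → t < δ → κ * t ^ (-(1 + b)) ≤ h' t) {s : ℝ} (hs : 0 < s) (hs1 : s ≤ 1)
    (hsδ : 2 * s < δ) : κ * 2 ^ (-(1 + b)) ≤ h (2 * s) - h s := by
  obtain ⟨ξ, hξ, e⟩ := exists_hasDerivAt_eq_slope h h' (show s < 2 * s by linarith)
    (fun t ht => (hd t (hs.trans_le ht.1) (ht.2.trans_lt hsδ)).continuousAt.continuousWithinAt)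
    (fun t ht => hd t (hs.trans ht.1) (ht.2.trans hsδ))
  rw [show 2 * s - s = s by ring, eq_div_iff hs.ne'] at e
  rw [← e]
  have hξ0 := hs.trans hξ.1
  have h1 := hle ξ hξ0 (hξ.2.trans hsδ)
  have h2 : (2 * s) ^ (-(1 + b)) ≤ ξ ^ (-(1 + b)) :=
    Real.rpow_le_rpow_of_nonpos hξ0 hξ.2.le (by linarith)
  have h3 : 1 ≤ s ^ (-(1 + b)) * s := by
    nth_rewrite 2 [← Real.rpow_one s]
    rw [← Real.rpow_add hs]
    exact Real.one_le_rpow_of_pos_of_le_one_of_nonpos hs hs1 (by linarith)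
  rw [Real.mul_rpow (by norm_num) hs.le] at h2
  have h4 : (0 : ℝ) ≤ κ * 2 ^ (-(1 + b)) := by positivity
  calc κ * 2 ^ (-(1 + b)) ≤ κ * 2 ^ (-(1 + b)) * (s ^ (-(1 + b)) * s) :=
        le_mul_of_one_le_right h4 h3
    _ = κ * (2 ^ (-(1 + b)) * s ^ (-(1 + b))) * s := by ring
    _ ≤ h' ξ * s := by
      gcongr
      exact (mul_le_mul_of_nonneg_left h2 hκ).trans h1

/-- Two applications of the mean value theorem with step s inside [s, 3s] give κ (3s)^{-(1+b)} s². A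
second difference is used because only h'' is bounded below: h' could have either sign. -/
lemma le_second_difference_of_le_deriv {h h' h'' : ℝ → ℝ} {κ b δ : ℝ} (hκ : 0 ≤ κ) (hb : 0 ≤ b)
    (hd : ∀ t, 0 < t → t < δ → HasDerivAt h (h' t) t)
    (hd' : ∀ t, 0 < t → t < δ → HasDerivAt h' (h'' t) t)
    (hle : ∀ t, 0 < t → t < δ → κ * t ^ (-(1 + b)) ≤ h'' t) {s : ℝ} (hs : 0 < s)
    (hsδ : 3 * s < δ) :
    κ * 3 ^ (-(1 + b)) * s ^ (1 - b) ≤ (h (3 * s) - h (2 * s)) - (h (2 * s) - h s) := by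
  have hF : ∀ t, 0 < t → t ≤ 2 * s →
      HasDerivAt (fun t => h (t + s) - h t) (h' (t + s) - h' t) t := fun t ht ht2 =>
    ((hd (t + s) (by linarith) (by linarith)).comp_add_const t s).sub (hd t ht (by linarith))
  obtain ⟨ξ, hξ, e⟩ := exists_hasDerivAt_eq_slope (fun t => h (t + s) - h t)
    (fun t => h' (t + s) - h' t) (show s < 2 * s by linarith)
    (fun t ht => (hF t (hs.trans_le ht.1) ht.2).continuousAt.continuousWithinAt)
    (fun t ht => hF t (hs.trans ht.1) ht.2.le)
  have hξ0 := hs.trans hξ.1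
  obtain ⟨ζ, hζ, e2⟩ := exists_hasDerivAt_eq_slope h' h'' (show ξ < ξ + s by linarith)
    (fun t ht => (hd' t (by linarith [ht.1])
      (by linarith [ht.2, hξ.2])).continuousAt.continuousWithinAt)
    (fun t ht => hd' t (by linarith [ht.1]) (by linarith [ht.2, hξ.2]))
  have hζ0 := hξ0.trans hζ.1
  rw [show 2 * s - s = s by ring, eq_div_iff hs.ne', show 2 * s + s = 3 * s by ring,
    show s + s = 2 * s by ring] at e
  rw [add_sub_cancel_left, eq_div_iff hs.ne'] at e2
  rw [← e, ← e2]
  have h1 := hle ζ hζ0 (by linarith [hζ.2, hξ.2])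
  have h2 : (3 * s) ^ (-(1 + b)) ≤ ζ ^ (-(1 + b)) :=
    Real.rpow_le_rpow_of_nonpos hζ0 (by linarith [hζ.2, hξ.2]) (by linarith)
  have h3 : s ^ (-(1 + b)) * s * s = s ^ (1 - b) := by
    rw [mul_assoc, ← pow_two, ← Real.rpow_natCast s 2, ← Real.rpow_add hs]
    congr 1
    push_cast
    ring
  rw [Real.mul_rpow (by norm_num) hs.le] at h2
  rw [← h3]
  calc _ = κ * (3 ^ (-(1 + b)) * s ^ (-(1 + b))) * s * s := by ring
    _ ≤ _ := by
      gcongr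
      exact (mul_le_mul_of_nonneg_left h2 hκ).trans h1

lemma hasDerivAt_re_iteratedDerivWithin {ψ : ℝ → ℂ} {n i : ℕ} (c : ℂ)
    (hψ : ContDiffOn ℝ n ψ (Set.Ioc 0 1)) (hi : i < n) {t : ℝ} (ht : 0 < t) (ht1 : t < 1) :
    HasDerivAt (fun t => (c * iteratedDerivWithin i ψ (Set.Ioc 0 1) t).re)
      (c * iteratedDerivWithin (i + 1) ψ (Set.Ioc 0 1) t).re t :=
  Complex.reCLM.hasFDerivAt.comp_hasDerivAt t
    (((hasDerivWithinAt_iteratedDerivWithin hψ hi ⟨ht, ht1.le⟩).hasDerivAt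
      (Ioc_mem_nhds ht ht1)).const_mul c)

lemma re_star_mul_sub_le (c x y : ℂ) : (star c * x).re - (star c * y).re ≤ ‖c‖ * ‖x - y‖ := by
  rw [← Complex.sub_re, ← mul_sub]
  refine (Complex.re_le_norm _).trans_eq ?_
  rw [norm_mul, norm_star]

/-- A non-zero limit would keep the increments over [s, 2s] of the derivative one order lower away
from 0, whereas its modulus of continuity tends to 0. -/
lemma limit_eq_zero_of_modulus_tendsto {ψ : ℝ → ℂ} {n : ℕ} {b : ℝ} {c : ℂ} {ω : ℝ → ℝ}
    (hb : 0 ≤ b) (hψ : ContDiffOn ℝ (n + 1 : ℕ) ψ (Set.Ioc 0 1))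
    (hlim : Tendsto (fun s : ℝ => ((s ^ (b + 1) : ℝ) : ℂ) *
      iteratedDerivWithin (n + 1) ψ (Set.Ioc 0 1) s) (𝓝[Set.Ioc 0 1] 0) (𝓝 c))
    (hω : ∀ t, 0 < t → t ≤ 1 → 0 < ω t) (hω0 : Tendsto ω (𝓝[>] 0) (𝓝 0))
    (hmod : modSeminorm (Set.Ioc 0 1) ω (iteratedDerivWithin n ψ (Set.Ioc 0 1)) < ∞) : c = 0 := by
  by_contra hc
  have hc0 : 0 < ‖c‖ := norm_pos_iff.2 hc
  obtain ⟨M, hM, hM'⟩ := exists_norm_sub_le_of_modSeminorm_lt_top hmod hω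
  obtain ⟨δ, hδ, hδ1, hle⟩ := exists_le_re_of_tendsto hc hlim
  set κ := ‖c‖ ^ 2 / 2 * 2 ^ (-(1 + b)) with hκ
  have hκ0 : 0 < κ := by positivity
  have hev : ∀ᶠ s in 𝓝[>] (0 : ℝ), κ ≤ ‖c‖ * (M * ω s) := by
    filter_upwards [Ioo_mem_nhdsGT (show (0 : ℝ) < δ / 2 by linarith)] with s hs
    refine (le_sub_of_le_deriv (by positivity) hb (fun t ht htδ =>
      hasDerivAt_re_iteratedDerivWithin (star c) hψ (Nat.lt_succ_self n) ht (by linarith)) hle hs.1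
      (by linarith [hs.2]) (by linarith [hs.2])).trans ((re_star_mul_sub_le _ _ _).trans ?_)
    gcongr
    simpa [two_mul] using hM' s (2 * s) hs.1 (by linarith [hs.1]) (by linarith [hs.2])
  have := ge_of_tendsto ((hω0.const_mul M).const_mul ‖c‖) hev
  simp only [mul_zero] at this
  linarith

/-- Two orders below the singular derivative, a non-zero limit forces second differences of size
s^{1-b}, while the modulus allows only o(s^{1-b}). -/
lemma limit_eq_zero_of_modulus_isLittleO {ψ : ℝ → ℂ} {n : ℕ} {b : ℝ} {c : ℂ} {ω : ℝ → ℝ}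
    (hb : 0 ≤ b) (hψ : ContDiffOn ℝ (n + 2 : ℕ) ψ (Set.Ioc 0 1))
    (hlim : Tendsto (fun s : ℝ => ((s ^ (b + 1) : ℝ) : ℂ) *
      iteratedDerivWithin (n + 2) ψ (Set.Ioc 0 1) s) (𝓝[Set.Ioc 0 1] 0) (𝓝 c))
    (hω : ∀ t, 0 < t → t ≤ 1 → 0 < ω t)
    (hω0 : Tendsto (fun t => ω t * t ^ (b - 1)) (𝓝[>] 0) (𝓝 0))
    (hmod : modSeminorm (Set.Ioc 0 1) ω (iteratedDerivWithin n ψ (Set.Ioc 0 1)) < ∞) : c = 0 := by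
  by_contra hc
  have hc0 : 0 < ‖c‖ := norm_pos_iff.2 hc
  obtain ⟨M, hM, hM'⟩ := exists_norm_sub_le_of_modSeminorm_lt_top hmod hω
  obtain ⟨δ, hδ, hδ1, hle⟩ := exists_le_re_of_tendsto hc hlim
  set κ := ‖c‖ ^ 2 / 2 * 3 ^ (-(1 + b)) with hκ
  have hκ0 : 0 < κ := by positivity
  have hev : ∀ᶠ s in 𝓝[>] (0 : ℝ), κ ≤ 2 * ‖c‖ * M * (ω s * s ^ (b - 1)) := by
    filter_upwards [Ioo_mem_nhdsGT (show (0 : ℝ) < δ / 3 by linarith)] with s hs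
    have h1 := le_second_difference_of_le_deriv (by positivity) hb (fun t ht htδ =>
      hasDerivAt_re_iteratedDerivWithin (i := n) (star c) hψ (by omega) ht (by linarith))
      (fun t ht htδ => hasDerivAt_re_iteratedDerivWithin (i := n + 1) (star c) hψ (by omega) ht
        (by linarith)) hle hs.1 (by linarith [hs.2])
    rw [← hκ] at h1
    have h2 := re_star_mul_sub_le c (iteratedDerivWithin n ψ (Set.Ioc 0 1) (3 * s))
      (iteratedDerivWithin n ψ (Set.Ioc 0 1) (2 * s))
    have h3 := re_star_mul_sub_le c (iteratedDerivWithin n ψ (Set.Ioc 0 1) s)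
      (iteratedDerivWithin n ψ (Set.Ioc 0 1) (2 * s))
    have h4 := hM' (2 * s) (3 * s) (by linarith [hs.1]) (by linarith [hs.1]) (by linarith [hs.2])
    have h5 := hM' s (2 * s) hs.1 (by linarith [hs.1]) (by linarith [hs.2])
    rw [show 3 * s - 2 * s = s by ring] at h4
    rw [show 2 * s - s = s by ring, norm_sub_rev] at h5
    have h6 := mul_le_mul_of_nonneg_left h4 hc0.le
    have h7 := mul_le_mul_of_nonneg_left h5 hc0.le
    have h8 : κ * s ^ (1 - b) ≤ 2 * ‖c‖ * M * ω s := by linarith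
    have h9 : s ^ (1 - b) * s ^ (b - 1) = 1 := by
      rw [← Real.rpow_add hs.1, show 1 - b + (b - 1) = 0 by ring, Real.rpow_zero]
    have h10 := mul_le_mul_of_nonneg_right h8 (Real.rpow_nonneg hs.1.le (b - 1))
    rw [mul_assoc, h9, mul_one] at h10
    linarith
  have := ge_of_tendsto (hω0.const_mul (2 * ‖c‖ * M)) hev
  simp only [mul_zero] at this
  linarith

lemma limit_eq_zero_of_bounded {Φ : ℝ → ℂ} {b M : ℝ} {c : ℂ} (hb : 0 ≤ b)
    (hlim : Tendsto (fun s : ℝ => ((s ^ (b + 1) : ℝ) : ℂ) * Φ s) (𝓝[Set.Ioc 0 1] 0) (𝓝 c))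
    (hM : ∀ s ∈ Set.Ioc (0 : ℝ) 1, ‖Φ s‖ ≤ M) : c = 0 := by
  have hne : (𝓝[Set.Ioc (0 : ℝ) 1] 0).NeBot := by
    rw [nhdsWithin_Ioc_eq_nhdsGT one_pos]; infer_instance
  have h0 : Tendsto (fun s : ℝ => s ^ (b + 1) * M) (𝓝[Set.Ioc 0 1] 0) (𝓝 0) := by
    have := (Real.continuousAt_rpow_const 0 (b + 1) (Or.inr (by linarith))).tendsto
    rw [Real.zero_rpow (by linarith)] at this
    simpa using (this.mono_left nhdsWithin_le_nhds).mul_const M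
  refine tendsto_nhds_unique hlim (squeeze_zero_norm' ?_ h0)
  filter_upwards [self_mem_nhdsWithin] with s hs
  rw [norm_mul, Complex.norm_real, Real.norm_of_nonneg (Real.rpow_nonneg hs.1.le _)]
  exact mul_le_mul_of_nonneg_left (hM s hs) (Real.rpow_nonneg hs.1.le _)

/-- The modulus bounds the oscillation of the top derivative on (0, 1]; integrating from 1 then
bounds every lower one. -/
lemma exists_norm_le_of_modSeminorm_lt_top {ψ : ℝ → ℂ} {q : ℕ} {ω : ℝ → ℝ}
    (hψ : ContDiffOn ℝ q ψ (Set.Ioc 0 1)) (hω : ∀ t, 0 < t → t ≤ 1 → 0 < ω t)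
    (hω1 : ∀ t, 0 < t → t ≤ 1 → ω t ≤ 1)
    (hmod : modSeminorm (Set.Ioc 0 1) ω (iteratedDerivWithin q ψ (Set.Ioc 0 1)) < ∞) :
    ∀ d i, i + d = q → ∃ M, ∀ s ∈ Set.Ioc (0 : ℝ) 1,
      ‖iteratedDerivWithin i ψ (Set.Ioc 0 1) s‖ ≤ M := by
  intro d
  induction d with
  | zero =>
    intro i hi
    obtain rfl : i = q := by omega
    obtain ⟨M, hM, hM'⟩ := exists_norm_sub_le_of_modSeminorm_lt_top hmod hω
    refine ⟨‖iteratedDerivWithin i ψ (Set.Ioc 0 1) 1‖ + M, fun s hs => ?_⟩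
    rcases hs.2.eq_or_lt with rfl | hs1
    · linarith
    · have h1 := hM' s 1 hs.1 hs1 le_rfl
      have h2 := mul_le_mul_of_nonneg_left (hω1 (1 - s) (by linarith) (by linarith [hs.1])) hM
      have h3 := norm_le_norm_add_norm_sub (iteratedDerivWithin i ψ (Set.Ioc 0 1) 1)
        (iteratedDerivWithin i ψ (Set.Ioc 0 1) s)
      linarith
  | succ d ih =>
    intro i hi
    obtain ⟨M, hM⟩ := ih (i + 1) (by omega)
    have hM0 : 0 ≤ M := (norm_nonneg _).trans (hM 1 ⟨one_pos, le_rfl⟩)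
    refine ⟨‖iteratedDerivWithin i ψ (Set.Ioc 0 1) 1‖ + M, fun s hs => ?_⟩
    have h1 := norm_sub_le_of_deriv_le (P := fun t => M * t) (P' := fun _ => M)
      (fun t ht => hasDerivWithinAt_iteratedDerivWithin (i := i) hψ (by omega) ht)
      (fun t _ => by simpa using (hasDerivAt_id t).const_mul M) hM hs.1 hs.2 le_rfl
    have h3 := norm_le_norm_add_norm_sub (iteratedDerivWithin i ψ (Set.Ioc 0 1) 1)
      (iteratedDerivWithin i ψ (Set.Ioc 0 1) s)
    have h4 := mul_nonneg hM0 hs.1.le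
    linarith

/-! ### The modulus η near zero, and the exclusion of singular derivatives -/

lemma tendsto_etaFun_mul_rpow {a : ℝ} (ha : -1 < a) :
    Tendsto (fun t => etaFun t * t ^ a) (𝓝[>] 0) (𝓝 0) := by
  have h := (tendsto_log_mul_rpow_nhdsGT_zero (show 0 < 1 + a by linarith)).neg
  rw [neg_zero] at h
  refine h.congr' ?_
  filter_upwards [Ioo_mem_nhdsGT (Real.exp_pos (-1))] with t ht
  rw [etaFun, if_pos ht.2.le, Real.rpow_add ht.1, Real.rpow_one]
  ring

lemma etaFun_le_one {t : ℝ} (h0 : 0 < t) : etaFun t ≤ 1 := by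
  rw [etaFun]
  split_ifs with h
  · have h2 := Real.one_sub_inv_le_log_of_pos h0
    have h3 : t * (1 - t⁻¹) = t - 1 := by field_simp
    have h4 := mul_le_mul_of_nonneg_left h2 h0.le
    linarith
  · exact Real.exp_le_one_iff.2 (by norm_num)

/-- If the regularity exponent `r` exceeds `n - b`, a function of class `C^r` cannot have a
derivative of order `n + 1` that is asymptotic to a non-zero multiple of `s ^ (-(1 + b))`. -/
lemma limit_eq_zero_of_memCr {ψ : ℝ → ℂ} {n : ℕ} {b : ℝ} {c : ℂ} {r : RegExp} (hb : 0 ≤ b)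
    (hb1 : b < 1) (hr : r.InReta) (hv : 0 < r.v) (hnv : n - b < r.v)
    (hψ : ContDiffOn ℝ (n + 1 : ℕ) ψ (Set.Ioc 0 1))
    (hlim : Tendsto (fun s : ℝ => ((s ^ (b + 1) : ℝ) : ℂ) *
      iteratedDerivWithin (n + 1) ψ (Set.Ioc 0 1) s) (𝓝[Set.Ioc 0 1] 0) (𝓝 c))
    (hmem : MemCr (Set.Ioc 0 1) r ψ) : c = 0 := by
  have key : n ≤ r.order + 1 ∧ (∀ t, 0 < t → t ≤ 1 → 0 < r.modulus t) ∧
      (∀ t, 0 < t → t ≤ 1 → r.modulus t ≤ 1) ∧ Tendsto r.modulus (𝓝[>] 0) (𝓝 0) ∧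
      (r.order + 1 = n → Tendsto (fun t => r.modulus t * t ^ (b - 1)) (𝓝[>] 0) (𝓝 0)) := by
    have hpow : ∀ e : ℝ, 0 < e → Tendsto (fun t : ℝ => t ^ e) (𝓝[>] 0) (𝓝 0) := by
      intro e he
      have := (Real.continuousAt_rpow_const 0 e (Or.inr he.le)).tendsto
      rw [Real.zero_rpow he.ne'] at this
      exact this.mono_left nhdsWithin_le_nhds
    cases r with
    | holder r =>
      simp only [RegExp.v, RegExp.order, RegExp.modulus] at *
      have hα : 0 < Int.fract r :=
        -- A non-integer r makes the Hölder exponent positive; otherwise the modulus would not tend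
        -- to 0.
        lt_of_le_of_ne (Int.fract_nonneg r) fun h => hr.2 ⌊r⌋ (by
          have := Int.floor_add_fract r
          rw [← h, add_zero] at this
          exact this.symm)
      have hα1 := Int.fract_lt_one r
      have e : (⌊r⌋₊ : ℝ) + Int.fract r = r := by
        rw [natCast_floor_eq_intCast_floor hv.le, Int.floor_add_fract]
      refine ⟨?_, fun t h0 _ => Real.rpow_pos_of_pos h0 _,
        fun t h0 h1 => Real.rpow_le_one h0.le h1 hα.le, hpow _ hα, fun h => ?_⟩
      · have : (n : ℝ) < ((⌊r⌋₊ + 2 : ℕ) : ℝ) := by push_cast; linarith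
        have : n < ⌊r⌋₊ + 2 := by exact_mod_cast this
        omega
      · have h' : (⌊r⌋₊ : ℝ) + 1 = n := by exact_mod_cast h
        refine (hpow (Int.fract r + (b - 1)) (by linarith)).congr' ?_
        filter_upwards [self_mem_nhdsWithin] with t ht
        exact Real.rpow_add ht _ _
    | eta z =>
      simp only [RegExp.v, RegExp.order, RegExp.modulus] at *
      -- Positivity of v = z + 1 forces z ≥ 0, so `Int.toNat` loses nothing.
      have hz : 0 ≤ z := by
        have : (-1 : ℝ) < z := by linarith
        have : -1 < z := by exact_mod_cast this
        omega
      obtain ⟨q, rfl⟩ := Int.eq_ofNat_of_zero_le hz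
      simp only [Int.toNat_natCast, Int.cast_natCast] at *
      refine ⟨?_, fun t h0 h1 => etaFun_pos h0 h1, fun t h0 _ => etaFun_le_one h0, ?_, fun h => ?_⟩
      · have : (n : ℝ) < ((q + 2 : ℕ) : ℝ) := by push_cast; linarith
        have : n < q + 2 := by exact_mod_cast this
        omega
      · simpa using tendsto_etaFun_mul_rpow (a := 0) (by norm_num)
      · have h' : (q : ℝ) + 1 = n := by exact_mod_cast h
        exact tendsto_etaFun_mul_rpow (by linarith)
  obtain ⟨hn, hω, hω1, hω0, hω2⟩ := key
  -- The singular derivative has order n + 1. If `r.order` is n - 1, second differences give the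
  -- contradiction; if it is n, first differences do; if it exceeds n, the derivative of order n + 1
  -- is itself bounded.
  rcases lt_trichotomy r.order n with h | h | h
  · have hn' : r.order + 1 = n := by omega
    have h2 := hω2 hn'
    subst hn'
    exact limit_eq_zero_of_modulus_isLittleO hb hψ hlim hω h2 hmem.2
  · have h2 := hmem.2
    rw [h] at h2
    exact limit_eq_zero_of_modulus_tendsto hb hψ hlim hω hω0 h2
  · obtain ⟨M, hM⟩ := exists_norm_le_of_modSeminorm_lt_top hmem.1 hω hω1 hmem.2
      (r.order - (n + 1)) (n + 1) (by omega)
    exact limit_eq_zero_of_bounded hb hlim hM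

/-- The polynomial binom(x, n + 1) vanishes only at 0, …, n. For b < 1 this leaves b = 0, where the
convention substitutes a non-zero value. -/
lemma binomConv_ne_zero {b : ℝ} (hb1 : b < 1) (n : ℕ) : binomConv b (n + 1) ≠ 0 := by
  rw [binomConv]
  split_ifs with h
  · exact div_ne_zero (pow_ne_zero _ (by norm_num)) (by positivity)
  · intro h0
    have h1 := factorial_mul_ring_choose b (n + 1)
    rw [h0, mul_zero] at h1
    obtain ⟨t, -, ht⟩ := Finset.prod_eq_zero_iff.1 h1.symm
    have hbt : b = t := by linarith
    rcases Nat.eq_zero_or_pos t with rfl | ht0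
    · exact h (by simpa using hbt)
    · have : (1 : ℝ) ≤ t := by exact_mod_cast ht0
      linarith

/-! ### Rotating the sector -/

lemma fderiv_comp_rotation (a : Circle) (f : ℂ → ℂ) (w v : ℂ) :
    fderiv ℝ (fun z => f (a * z)) w v = fderiv ℝ f (a * w) (a * v) := by
  have h := (rotation a).toContinuousLinearEquiv.comp_right_fderiv (f := f) (x := w)
  have e : (f ∘ (rotation a).toContinuousLinearEquiv) = fun z => f (a * z) := by
    ext z; simp [rotation_apply]
  rw [e] at h
  rw [h]
  simp [rotation_apply]

lemma clm_apply_eq (T : ℂ →L[ℝ] ℂ) (z : ℂ) : T z = z.re * T 1 + z.im * T Complex.I := by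
  conv_lhs => rw [← Complex.re_add_im z]
  have h1 : ((z.re : ℂ)) = z.re • (1 : ℂ) := by simp
  have h2 : ((z.im : ℂ)) * Complex.I = z.im • Complex.I := by simp
  rw [h1, h2, map_add, map_smul, map_smul]
  simp

lemma dz_comp_rotation (a : Circle) (f : ℂ → ℂ) :
    dz (fun z => f (a * z)) = fun z => (a : ℂ) * dz f (a * z) := by
  ext w
  simp only [dz, fderiv_comp_rotation]
  rw [clm_apply_eq _ ((a : ℂ) * 1), clm_apply_eq _ ((a : ℂ) * Complex.I)]
  have h := Complex.re_add_im (a : ℂ)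
  simp only [mul_one, Complex.mul_re, Complex.mul_im, Complex.I_re, Complex.I_im, mul_zero,
    zero_sub, add_zero, Complex.ofReal_neg]
  linear_combination (norm := skip) (1 / 2 * (fderiv ℝ f (a * w) 1 -
    Complex.I * fderiv ℝ f (a * w) Complex.I)) * h
  ring_nf
  simp only [Complex.I_sq]
  ring

lemma dzbar_comp_rotation (a : Circle) (f : ℂ → ℂ) :
    dzbar (fun z => f (a * z)) = fun z => star (a : ℂ) * dzbar f (a * z) := by
  ext w
  simp only [dzbar, fderiv_comp_rotation]
  rw [clm_apply_eq _ ((a : ℂ) * 1), clm_apply_eq _ ((a : ℂ) * Complex.I)]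
  have h : ((a : ℂ).re : ℂ) - (a : ℂ).im * Complex.I = star (a : ℂ) := by
    apply Complex.ext <;> simp
  simp only [mul_one, Complex.mul_re, Complex.mul_im, Complex.I_re, Complex.I_im, mul_zero,
    zero_sub, add_zero, Complex.ofReal_neg]
  linear_combination (norm := skip) (1 / 2 * (fderiv ℝ f (a * w) 1 +
    Complex.I * fderiv ℝ f (a * w) Complex.I)) * h
  ring_nf
  simp only [Complex.I_sq]
  ring

lemma dz_const_mul (c : ℂ) (f : ℂ → ℂ) : dz (fun z => c * f z) = fun z => c * dz f z := by
  ext w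
  have h : fderiv ℝ (fun z => c * f z) = c • fderiv ℝ f := fderiv_const_smul_field c
  simp only [dz, h, Pi.smul_apply, _root_.smul_apply, smul_eq_mul]
  ring

lemma dzbar_const_mul (c : ℂ) (f : ℂ → ℂ) :
    dzbar (fun z => c * f z) = fun z => c * dzbar f z := by
  ext w
  have h : fderiv ℝ (fun z => c * f z) = c • fderiv ℝ f := fderiv_const_smul_field c
  simp only [dzbar, h, Pi.smul_apply, _root_.smul_apply, smul_eq_mul]
  ring

lemma iterate_dz_comp_rotation (a : Circle) (p : ℕ) : ∀ f : ℂ → ℂ,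
    dz^[p] (fun z => f (a * z)) = fun z => (a : ℂ) ^ p * dz^[p] f (a * z) := by
  induction p with
  | zero => intro f; simp
  | succ p ih =>
    intro f
    rw [Function.iterate_succ_apply', ih, dz_const_mul, dz_comp_rotation,
      Function.iterate_succ_apply']
    ext z
    ring

lemma iterate_dz_const_mul (c : ℂ) (p : ℕ) (f : ℂ → ℂ) :
    dz^[p] (fun z => c * f z) = fun z => c * dz^[p] f z := by
  induction p with
  | zero => simp
  | succ p ih => rw [Function.iterate_succ_apply', ih, dz_const_mul, Function.iterate_succ_apply']

lemma iterate_dzbar_comp_rotation (a : Circle) (q : ℕ) : ∀ f : ℂ → ℂ,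
    dzbar^[q] (fun z => f (a * z)) = fun z => star (a : ℂ) ^ q * dzbar^[q] f (a * z) := by
  induction q with
  | zero => intro f; simp
  | succ q ih =>
    intro f
    rw [Function.iterate_succ_apply', ih, dzbar_const_mul, dzbar_comp_rotation,
      Function.iterate_succ_apply']
    ext z
    ring

/-- Each ∂ brings a factor a and each ∂̄ a factor ā = a⁻¹, so the weight is p - q. -/
lemma wirtingerAtZero_comp_rotation (a : Circle) (p q : ℕ) (f : ℂ → ℂ) :
    wirtingerAtZero p q (fun z => f (a * z)) =
      (a : ℂ) ^ ((p : ℤ) - q) * wirtingerAtZero p q f := by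
  have ha : (a : ℂ) ≠ 0 := a.coe_ne_zero
  have hs : star (a : ℂ) = (a : ℂ)⁻¹ := by
    rw [Complex.star_def, ← Circle.coe_inv_eq_conj, Circle.coe_inv]
  rw [wirtingerAtZero, iterate_dzbar_comp_rotation, iterate_dz_const_mul,
    iterate_dz_comp_rotation, hs, zpow_sub₀ ha, zpow_natCast, zpow_natCast, wirtingerAtZero]
  simp only [mul_zero]
  rw [inv_pow, div_eq_mul_inv]
  ring

/-! ### Rotations by multiples of π/m and their action on the functionals -/

lemma rootOfUnity_pow_self {n : ℕ} (hn : n ≠ 0) : rootOfUnity n ^ n = 1 := by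
  have : (n : ℂ) ≠ 0 := by exact_mod_cast hn
  rw [rootOfUnity, ← Complex.exp_nat_mul, mul_div_cancel₀ _ this, Complex.exp_two_pi_mul_I]

lemma rootOfUnity_two_mul_pow {m : ℕ} (hm : m ≠ 0) : rootOfUnity (2 * m) ^ m = -1 := by
  have : (m : ℂ) ≠ 0 := by exact_mod_cast hm
  rw [rootOfUnity, ← Complex.exp_nat_mul, ← Complex.exp_pi_mul_I]
  congr 1
  push_cast
  field_simp

/-- The rotation by the `L`-th power of `e^{πi/m}`, as a point of the circle. -/
noncomputable def turn (m L : ℕ) : Circle :=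
  Circle.exp (2 * Real.pi / (2 * m : ℕ)) ^ L

lemma coe_turn (m L : ℕ) : (turn m L : ℂ) = rootOfUnity (2 * m) ^ L := by
  rw [turn, Circle.coe_pow, Circle.coe_exp, rootOfUnity]
  congr 2
  push_cast
  ring

/-- Shifting i by nm changes the exponent by a multiple of 2m, which is invisible to a 2m-th root of
unity. The factor is therefore common to all terms of `partialFunctional`. -/
lemma coe_turn_zpow {m : ℕ} (hm : m ≠ 0) (L : ℕ) (i k n : ℤ) :
    (turn m L : ℂ) ^ (2 * (i + n * m) - k) =
      rootOfUnity (2 * m) ^ ((L : ℤ) * (2 * i - k)) := by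
  have h0 : rootOfUnity (2 * m) ≠ 0 := Complex.exp_ne_zero _
  have h1 : rootOfUnity (2 * m) ^ ((2 * m : ℕ) : ℤ) = 1 := by
    rw [zpow_natCast, rootOfUnity_pow_self (by omega)]
  rw [coe_turn, ← zpow_natCast, ← zpow_mul,
    show (L : ℤ) * (2 * (i + n * m) - k) = L * (2 * i - k) + ((2 * m : ℕ) : ℤ) * (L * n) by
      push_cast; ring, zpow_add₀ h0, zpow_mul _ ((2 * m : ℕ) : ℤ), h1, one_zpow, mul_one]

lemma partialFunctional_comp_turn {m : ℕ} (hm : m ≠ 0) (L : ℕ) {k j : ℕ} (hj : j ≤ k)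
    (f : ℂ → ℂ) :
    partialFunctional m k j (fun z => f (turn m L * z)) =
      rootOfUnity (2 * m) ^ ((L : ℤ) * (2 * (j : ℤ) - (k : ℤ))) * partialFunctional m k j f := by
  rw [partialFunctional, partialFunctional, Finset.mul_sum]
  refine Finset.sum_congr rfl fun n hn => ?_
  have hn' : n * m ≤ k - j :=
    (Nat.le_div_iff_mul_le (Nat.pos_of_ne_zero hm)).1 (Nat.lt_succ_iff.1 (Finset.mem_range.1 hn))
  rw [wirtingerAtZero_comp_rotation,
    show ((j + n * m : ℕ) : ℤ) - ((k - j - n * m : ℕ) : ℤ) = 2 * ((j : ℤ) + n * m) - k by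
      rw [Nat.cast_sub hn', Nat.cast_sub hj]; push_cast; ring, coe_turn_zpow hm]
  ring

lemma Cfun_comp_turn {m : ℕ} (hm : m ≠ 0) (k L : ℕ) (f : ℂ → ℂ) :
    Cfun m k 0 (fun z => f (turn m L * z)) = Cfun m k L f := by
  rw [Cfun, Cfun]
  refine Finset.sum_congr rfl fun j hj => ?_
  have hj' := Finset.mem_range.1 (Finset.mem_filter.1 hj).1
  rw [partialFunctional_comp_turn hm L (by omega)]
  simp only [Nat.cast_zero, zero_mul, zpow_zero]
  ring

/-- The m-th power of the rotation is ±1, and the square is symmetric about 0. -/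
lemma turn_mul_mem_D {m : ℕ} (hm : m ≠ 0) (L : ℕ) {ω : ℂ} :
    (turn m L : ℂ) * ω ∈ D m ↔ ω ∈ D m := by
  have h : ((turn m L : ℂ) * ω) ^ m = (-1) ^ L * ω ^ m := by
    rw [mul_pow, coe_turn, ← pow_mul, mul_comm L m, pow_mul, rootOfUnity_two_mul_pow hm]
  simp only [D, Set.mem_ofPred_eq, h]
  rcases neg_one_pow_eq_or ℂ L with h | h <;> simp [h]

lemma contDiffOn_comp_turn {m : ℕ} (hm : m ≠ 0) (L : ℕ) {N : ℕ} {f : ℂ → ℂ}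
    (hf : ContDiffOn ℝ N f (D m)) : ContDiffOn ℝ N (fun z => f (turn m L * z)) (D m) :=
  hf.comp (contDiff_const.mul contDiff_id).contDiffOn fun _ hω => (turn_mul_mem_D hm L).2 hω

lemma norm_iteratedFDerivWithin_comp_turn {m : ℕ} (hm : 1 ≤ m) (L i : ℕ) (f : ℂ → ℂ) {ω : ℂ}
    (hω : ω ∈ D m) : ‖iteratedFDerivWithin ℝ i (fun z => f (turn m L * z)) (D m) ω‖ =
      ‖iteratedFDerivWithin ℝ i f (D m) (turn m L * ω)‖ := by
  have h := LinearIsometryEquiv.norm_iteratedFDerivWithin_comp_right (rotation (turn m L)) f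
    (uniqueDiffOn_D hm) (x := ω) (by
      rw [rotation_apply]; exact (turn_mul_mem_D (by omega) L).2 hω) i
  have e : (rotation (turn m L)) ⁻¹' D m = D m := by
    ext z
    rw [Set.mem_preimage, rotation_apply]
    exact turn_mul_mem_D (by omega) L
  rw [e, rotation_apply] at h
  rw [← h]
  congr 2

/-! ### Control of the Wirtinger derivatives by the norm of C^K(𝒟) -/

lemma normCD_lt_top {m : ℕ} (hm : 1 ≤ m) {K : ℕ} {f : ℂ → ℂ} (hf : ContDiffOn ℝ K f (D m)) :
    normCD m K f < ∞ := by
  refine ENNReal.sum_lt_top.2 fun i hi => ?_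
  obtain ⟨M, hM⟩ := (isCompact_D hm).exists_bound_of_continuousOn
    (hf.continuousOn_iteratedFDerivWithin
      (by exact_mod_cast Nat.lt_succ_iff.1 (Finset.mem_range.1 hi)) (uniqueDiffOn_D hm))
  refine lt_of_le_of_lt (iSup₂_le fun ω hω => ?_) (ENNReal.ofReal_lt_top (r := M))
  rw [← ofReal_norm]
  exact ENNReal.ofReal_le_ofReal (hM ω hω)

lemma norm_iteratedFDerivWithin_le_normCD {m : ℕ} (hm : 1 ≤ m) {K : ℕ} {f : ℂ → ℂ}
    (hf : ContDiffOn ℝ K f (D m)) {i : ℕ} (hi : i ≤ K) {ω : ℂ} (hω : ω ∈ D m) :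
    ‖iteratedFDerivWithin ℝ i f (D m) ω‖ ≤ (normCD m K f).toReal := by
  have h : ‖iteratedFDerivWithin ℝ i f (D m) ω‖ₑ ≤ normCD m K f :=
    (le_iSup₂_of_le ω hω le_rfl).trans (Finset.single_le_sum
      (f := fun i => ⨆ ω ∈ D m, ‖iteratedFDerivWithin ℝ i f (D m) ω‖ₑ) (fun _ _ => bot_le)
      (Finset.mem_range.2 (Nat.lt_succ_of_le hi)))
  have h2 := ENNReal.toReal_mono (normCD_lt_top hm hf).ne h
  rwa [toReal_enorm] at h2

lemma norm_wd_comp_turn_le {m : ℕ} (hm : 1 ≤ m) (L : ℕ) {K : ℕ} {f : ℂ → ℂ}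
    (hf : ContDiffOn ℝ K f (D m)) (w : List Bool) (hw : w.length ≤ K) (ω : ℂ) (hω : ω ∈ D m) :
    ‖wd m w (fun z => f (turn m L * z)) ω‖ ≤ (normCD m K f).toReal := by
  refine norm_wd_le hm w (contDiffOn_comp_turn (by omega) L hf) (fun i hi ω hω => ?_) hw hω
  rw [norm_iteratedFDerivWithin_comp_turn hm L i f hω]
  exact norm_iteratedFDerivWithin_le_normCD hm hf hi ((turn_mul_mem_D (by omega) L).2 hω)

/-! ### The branches of the root on the two half-planes -/

/-- The sign `(-1)^ε`. -/
def halfSign (ε : Fin 2) : ℝ := if ε = 0 then 1 else -1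

lemma halfSign_mul_self (ε : Fin 2) : halfSign ε * halfSign ε = 1 := by
  fin_cases ε <;> simp [halfSign]

lemma abs_halfSign (ε : Fin 2) : |halfSign ε| = 1 := by
  fin_cases ε <;> simp [halfSign]

lemma mem_half {ε : Fin 2} {s : ℝ} : s ∈ half ε ↔ halfSign ε * s ∈ Set.Ioc (0 : ℝ) 1 := by
  fin_cases ε
  · simp [half, halfSign]
  · simp only [half, halfSign, Fin.mk_one, Fin.isValue, one_ne_zero, if_false, Set.mem_Ico,
      Set.mem_Ioc]
    constructor <;> rintro ⟨h1, h2⟩ <;> constructor <;> linarith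

lemma norm_mul_exp_arg_div {m : ℕ} {z : ℂ} (hz : z ≠ 0) :
    ((‖z‖ ^ (1 / (m : ℝ)) : ℝ) : ℂ) * Complex.exp (Complex.I * ((z.arg / m : ℝ) : ℂ)) =
      z ^ ((m : ℂ)⁻¹) := by
  rw [Complex.cpow_def_of_ne_zero hz, Complex.log, add_mul, Complex.exp_add]
  congr 1
  · rw [Real.rpow_def_of_pos (norm_pos_iff.2 hz)]
    push_cast
    rw [one_div]
  · congr 1
    push_cast
    ring

lemma G0_of_im_pos (m : ℕ) {z : ℂ} (hz : 0 < z.im) : G0 m z = z ^ ((m : ℂ)⁻¹) := by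
  have h0 : z ≠ 0 := by rintro rfl; simp at hz
  rw [G0, arg0, if_pos (Complex.arg_nonneg_iff.2 hz.le), norm_mul_exp_arg_div h0]

/-- Moving from z to -z in the lower half-plane adds π to the argument normalised in [0, 2π), hence
π/m to that of the root. This half step is why the index is 2l + ε. -/
lemma G0_neg_of_im_pos (m : ℕ) {z : ℂ} (hz : 0 < z.im) :
    G0 m (-z) = rootOfUnity (2 * m) * z ^ ((m : ℂ)⁻¹) := by
  have h0 : z ≠ 0 := by rintro rfl; simp at hz
  have h1 : ¬ 0 ≤ (-z).arg := by
    rw [Complex.arg_nonneg_iff]; simpa using hz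
  rw [G0, arg0, if_neg h1, Complex.arg_neg_eq_arg_sub_pi_of_im_pos hz, norm_neg,
    ← norm_mul_exp_arg_div h0, rootOfUnity, mul_left_comm, ← Complex.exp_add]
  congr 2
  push_cast
  ring

lemma G_eq_turn_mul_om {m : ℕ} (l : ℕ) (ε : Fin 2) (u : ℝ) {s : ℝ} (hs : 0 < s) :
    G m l (halfSign ε * ((u : ℂ) + s * Complex.I)) = turn m (2 * l + ε) * om m u s := by
  have hz : 0 < ((u : ℂ) + s * Complex.I).im := by simpa using hs
  have hr : rootOfUnity m = rootOfUnity (2 * m) ^ 2 := by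
    rw [rootOfUnity, rootOfUnity, ← Complex.exp_nat_mul]
    congr 1
    push_cast
    ring
  rw [coe_turn, G, hr, ← pow_mul, pow_add, om, mul_assoc]
  congr 1
  fin_cases ε
  · simp [halfSign, G0_of_im_pos m hz]
  · simp only [halfSign, Fin.mk_one, Fin.isValue, one_ne_zero, if_false, Complex.ofReal_neg,
      Complex.ofReal_one, neg_one_mul, pow_one]
    exact G0_neg_of_im_pos m hz

lemma om_zpow_mul_conj_zpow {m : ℕ} (hm : 1 ≤ m) (u : ℝ) {s : ℝ} (hs : 0 < s) :
    om m u s ^ (1 - m : ℤ) * (starRingEnd ℂ) (om m u s) ^ (1 - m : ℤ) =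
      ((((u ^ 2 + s ^ 2) ^ (((m : ℝ) - 1) / m) : ℝ) : ℂ))⁻¹ := by
  have hm0 : (m : ℝ) ≠ 0 := by positivity
  have h1 : (u ^ 2 + s ^ 2) = ‖(u : ℂ) + s * Complex.I‖ ^ 2 := by
    rw [← Complex.normSq_eq_norm_sq, Complex.normSq_add_mul_I]
  have hp : 0 < ‖(u : ℂ) + s * Complex.I‖ := by
    rw [norm_pos_iff]
    intro h
    have := congrArg Complex.im h
    simp at this
    exact hs.ne' this
  rw [← mul_zpow, Complex.mul_conj, Complex.normSq_eq_norm_sq, norm_om, h1]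
  rw [← Complex.ofReal_zpow, ← Complex.ofReal_inv]
  congr 1
  rw [← Real.rpow_natCast (_ ^ _) 2, ← Real.rpow_natCast _ 2, ← Real.rpow_intCast,
    ← Real.rpow_mul hp.le, ← Real.rpow_mul hp.le, ← Real.rpow_mul hp.le, ← Real.rpow_neg hp.le]
  congr 1
  push_cast
  field_simp
  ring

/-- The product of the powers of ω and ω̄ is |ω|^{2(1-m)} = (u² + s²)^{-(m-1)/m}, so the weight of
`phi` is hidden in the exponents a = b = 1 - m. -/
lemma phi_eq_phi0 {m : ℕ} (hm : 1 ≤ m) (l : ℕ) (ε : Fin 2) (f : ℂ → ℂ) {s : ℝ}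
    (hs : s ∈ half ε) :
    phi m l f s = phi0 m (fun z => f (turn m (2 * l + ε) * z)) (halfSign ε * s) := by
  have hs' := (mem_half.1 hs).1
  have key : phi0 m (fun z => f (turn m (2 * l + ε) * z)) (halfSign ε * s) =
      ∫ u in (-1 : ℝ)..1, f (G m l (halfSign ε * ((u : ℂ) + (halfSign ε * s : ℝ) * Complex.I))) /
        (((u ^ 2 + s ^ 2) ^ (((m : ℝ) - 1) / m) : ℝ) : ℂ) := by
    rw [phi0, Phi]
    refine intervalIntegral.integral_congr fun u _ => ?_
    have e : (halfSign ε * s) ^ 2 = s ^ 2 := by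
      rw [mul_pow, pow_two (halfSign ε), halfSign_mul_self, one_mul]
    simp only [integrand]
    rw [om_zpow_mul_conj_zpow hm u hs', G_eq_turn_mul_om l ε u hs', e]
    exact inv_mul_eq_div _ _
  rw [key, phi]
  fin_cases ε
  · simp [halfSign]
  · simp only [halfSign, Fin.mk_one, Fin.isValue, one_ne_zero, if_false]
    -- For ε = 1 the root is taken at -(u + i|s|) = -u + is, so u has to be reflected.
    rw [← neg_neg (1 : ℝ), ← intervalIntegral.integral_comp_neg, neg_neg]
    refine intervalIntegral.integral_congr fun u _ => ?_
    simp only [neg_sq]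
    congr 3
    push_cast
    ring

/-! ### Transport between the two half-intervals -/

lemma halfSign_mul_mem_half {ε : Fin 2} {s : ℝ} :
    halfSign ε * s ∈ half ε ↔ s ∈ Set.Ioc (0 : ℝ) 1 := by
  rw [mem_half, ← mul_assoc, halfSign_mul_self, one_mul]

lemma iteratedDerivWithin_half {ε : Fin 2} {χ ψ : ℝ → ℂ}
    (h : ∀ s ∈ half ε, χ s = ψ (halfSign ε * s)) (i : ℕ) {s : ℝ} (hs : s ∈ half ε) :
    iteratedDerivWithin i χ (half ε) s =
      ((halfSign ε ^ i : ℝ) : ℂ) * iteratedDerivWithin i ψ (Set.Ioc 0 1) (halfSign ε * s) := by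
  rw [iteratedDerivWithin_congr h hs]
  fin_cases ε
  · simp [halfSign, half]
  · have e : -(Set.Ico (-1 : ℝ) 0) = Set.Ioc 0 1 := by ext; simp
    have h2 := iteratedDerivWithin_comp_neg (n := i) (s := Set.Ico (-1 : ℝ) 0) (f := ψ) s
    rw [e] at h2
    simpa [halfSign, half] using h2

lemma norm_iteratedDerivWithin_half {ε : Fin 2} {χ ψ : ℝ → ℂ}
    (h : ∀ s ∈ half ε, χ s = ψ (halfSign ε * s)) (i : ℕ) {s : ℝ} (hs : s ∈ half ε) :
    ‖iteratedDerivWithin i χ (half ε) s‖ =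
      ‖iteratedDerivWithin i ψ (Set.Ioc 0 1) (halfSign ε * s)‖ := by
  rw [iteratedDerivWithin_half h i hs, norm_mul, Complex.norm_real, norm_pow, Real.norm_eq_abs,
    abs_halfSign, one_pow, one_mul]

lemma contDiffOn_half {ε : Fin 2} {χ ψ : ℝ → ℂ} (h : ∀ s ∈ half ε, χ s = ψ (halfSign ε * s))
    {N : ℕ} : ContDiffOn ℝ N χ (half ε) ↔ ContDiffOn ℝ N ψ (Set.Ioc 0 1) := by
  constructor <;> intro H
  · have h2 : ContDiffOn ℝ N (fun s => χ (halfSign ε * s)) (Set.Ioc 0 1) :=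
      H.comp (contDiff_const.mul contDiff_id).contDiffOn fun _ hs => halfSign_mul_mem_half.2 hs
    refine h2.congr fun s hs => ?_
    rw [h _ (halfSign_mul_mem_half.2 hs), ← mul_assoc, halfSign_mul_self, one_mul]
  · exact (H.comp (contDiff_const.mul contDiff_id).contDiffOn
      fun _ hs => mem_half.1 hs : ContDiffOn ℝ N (fun s => ψ (halfSign ε * s)) (half ε)).congr h

lemma measurableSet_half (ε : Fin 2) : MeasurableSet (half ε) := by
  fin_cases ε
  · exact measurableSet_Ioc
  · exact measurableSet_Ico

lemma setLIntegral_half (ε : Fin 2) (F : ℝ → ℝ≥0∞) :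
    ∫⁻ s in half ε, F (halfSign ε * s) = ∫⁻ s in Set.Ioc 0 1, F s := by
  fin_cases ε
  · simp [half, halfSign]
  · have h := (Measure.measurePreserving_neg (volume : Measure ℝ)).setLIntegral_comp_preimage_emb
      (MeasurableEquiv.neg ℝ).measurableEmbedding F (Set.Ioc 0 1)
    have e : Neg.neg ⁻¹' Set.Ioc (0 : ℝ) 1 = Set.Ico (-1) 0 := by simp
    rw [e] at h
    simpa [half, halfSign] using h

lemma sumL1_half {ε : Fin 2} {χ ψ : ℝ → ℂ} (h : ∀ s ∈ half ε, χ s = ψ (halfSign ε * s)) (p : ℕ) :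
    sumL1 (half ε) p χ = sumL1 (Set.Ioc 0 1) p ψ := by
  refine Finset.sum_congr rfl fun i _ => ?_
  rw [← setLIntegral_half ε]
  refine setLIntegral_congr_fun (measurableSet_half ε) fun s hs => ?_
  simp only [← ofReal_norm, norm_iteratedDerivWithin_half h i hs]

lemma pSeminorm_half_le {ε : Fin 2} {χ ψ : ℝ → ℂ} (h : ∀ s ∈ half ε, χ s = ψ (halfSign ε * s))
    (n : ℕ) (b : ℝ) : pSeminorm (half ε) n b χ ≤ pSeminorm (Set.Ioc 0 1) n b ψ := by
  refine iSup₂_le fun s hs => le_iSup₂_of_le _ (mem_half.1 hs) ?_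
  rw [norm_iteratedDerivWithin_half h _ hs, abs_mul, abs_halfSign, one_mul]

lemma modSeminorm_le_of_isometry {J J' : Set ℝ} {ω : ℝ → ℝ} {g g' : ℝ → ℂ} {σ : ℝ} (hσ : |σ| = 1)
    (hJ : ∀ s ∈ J, σ * s ∈ J')
    (hg : ∀ x ∈ J, ∀ y ∈ J, ‖g x - g y‖ = ‖g' (σ * x) - g' (σ * y)‖) :
    modSeminorm J ω g ≤ modSeminorm J' ω g' := by
  have hσ0 : σ ≠ 0 := by rintro rfl; simp at hσ
  refine iSup₂_le fun x hx => iSup₂_le fun y hy => iSup_le fun hxy =>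
    le_iSup₂_of_le _ (hJ x hx) (le_iSup₂_of_le _ (hJ y hy)
      (le_iSup_of_le (fun e => hxy (mul_left_cancel₀ hσ0 e)) ?_))
  rw [hg x hx y hy, ← mul_sub, abs_mul, hσ, one_mul]

lemma modSeminorm_half {ε : Fin 2} {χ ψ : ℝ → ℂ} (h : ∀ s ∈ half ε, χ s = ψ (halfSign ε * s))
    (ω : ℝ → ℝ) (i : ℕ) : modSeminorm (half ε) ω (iteratedDerivWithin i χ (half ε)) =
      modSeminorm (Set.Ioc 0 1) ω (iteratedDerivWithin i ψ (Set.Ioc 0 1)) := by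
  have key : ∀ x ∈ half ε, ∀ y ∈ half ε,
      ‖iteratedDerivWithin i χ (half ε) x - iteratedDerivWithin i χ (half ε) y‖ =
        ‖iteratedDerivWithin i ψ (Set.Ioc 0 1) (halfSign ε * x) -
          iteratedDerivWithin i ψ (Set.Ioc 0 1) (halfSign ε * y)‖ := by
    intro x hx y hy
    rw [iteratedDerivWithin_half h i hx, iteratedDerivWithin_half h i hy, ← mul_sub, norm_mul,
      Complex.norm_real, norm_pow, Real.norm_eq_abs, abs_halfSign, one_pow, one_mul]
  refine le_antisymm (modSeminorm_le_of_isometry (abs_halfSign ε) (fun s hs => mem_half.1 hs) key)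
    (modSeminorm_le_of_isometry (abs_halfSign ε) (fun s hs => halfSign_mul_mem_half.2 hs)
      fun x hx y hy => ?_)
  rw [key _ (halfSign_mul_mem_half.2 hx) _ (halfSign_mul_mem_half.2 hy), ← mul_assoc, ← mul_assoc,
    halfSign_mul_self, one_mul, one_mul]

lemma memCr_half {ε : Fin 2} {χ ψ : ℝ → ℂ} (h : ∀ s ∈ half ε, χ s = ψ (halfSign ε * s))
    (r : RegExp) : MemCr (half ε) r χ ↔ MemCr (Set.Ioc 0 1) r ψ := by
  rw [MemCr, MemCr, contDiffOn_half h, modSeminorm_half h]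

lemma tendsto_half {ε : Fin 2} {χ ψ : ℝ → ℂ} (h : ∀ s ∈ half ε, χ s = ψ (halfSign ε * s))
    {N : ℕ} {b : ℝ} {c : ℂ}
    (hlim : Tendsto (fun s : ℝ => ((s ^ b : ℝ) : ℂ) * iteratedDerivWithin N ψ (Set.Ioc 0 1) s)
      (𝓝[Set.Ioc 0 1] 0) (𝓝 c)) :
    Tendsto (fun s : ℝ => ((|s| ^ b : ℝ) : ℂ) * iteratedDerivWithin N χ (half ε) s)
      (𝓝[half ε] 0) (𝓝 (((halfSign ε ^ N : ℝ) : ℂ) * c)) := by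
  have h0 : Tendsto (fun s => halfSign ε * s) (𝓝[half ε] 0) (𝓝[Set.Ioc 0 1] 0) := by
    refine tendsto_nhdsWithin_iff.2 ⟨?_, ?_⟩
    · have : ContinuousAt (fun s : ℝ => halfSign ε * s) 0 := by fun_prop
      simpa using this.tendsto.mono_left (nhdsWithin_le_nhds (s := half ε))
    · filter_upwards [self_mem_nhdsWithin] with s hs using mem_half.1 hs
  refine ((hlim.comp h0).const_mul _).congr' ?_
  filter_upwards [self_mem_nhdsWithin] with s hs
  have e : |s| = halfSign ε * s := by
    rw [← one_mul |s|, ← abs_halfSign ε, ← abs_mul, abs_of_pos (mem_half.1 hs).1]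
  rw [iteratedDerivWithin_half h N hs, Function.comp_apply, e]
  ring

/-! ### The main estimates -/

lemma exists_powerBound_phi0 {m : ℕ} (hm : 2 ≤ m) (k L : ℕ) : ∃ C : ℝ, 0 ≤ C ∧ ∀ f : ℂ → ℂ,
    ContDiffOn ℝ (max k (nIdx m k + 1) : ℕ) f (D m) → (∀ j < k, Cfun m j L f = 0) →
      PowerBound (nIdx m k + 1) (bIdx m k) (C * (normCD m (max k (nIdx m k + 1)) f).toReal)
        (phi0 m fun z => f (turn m L * z)) := by
  have hm1 : 1 ≤ m := by omega
  obtain ⟨C, hC, hC'⟩ := phi0_bounds hm k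
  refine ⟨C, hC, fun f hf h0 => ?_⟩
  have hg := contDiffOn_comp_turn (by omega : m ≠ 0) L hf
  obtain ⟨h1, h2⟩ := hC' _ _ hg (norm_wd_comp_turn_le hm1 L hf)
    fun j hj => by rw [Cfun_comp_turn (by omega)]; exact h0 j hj
  exact ⟨contDiffOn_Phi hm1 _ _ (hg.of_le (by exact_mod_cast le_max_right _ _)), h1,
    fun i hi => h2 i (by omega)⟩

lemma tendsto_phi0_comp_turn {m : ℕ} (hm : 2 ≤ m) (k L : ℕ) {f : ℂ → ℂ}
    (hf : ContDiffOn ℝ (max k (nIdx m k + 1) : ℕ) f (D m)) (h0 : ∀ j < k, Cfun m j L f = 0) :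
    Tendsto (fun s : ℝ => ((s ^ (bIdx m k + 1) : ℝ) : ℂ) *
      iteratedDerivWithin (nIdx m k + 1) (phi0 m fun z => f (turn m L * z)) (Set.Ioc 0 1) s)
      (𝓝[Set.Ioc 0 1] 0) (𝓝 ((((-1) ^ (nIdx m k + 1) * (((nIdx m k + 1) ! : ℝ) / (k ! : ℝ)) *
        binomConv (bIdx m k) (nIdx m k + 1) : ℝ) : ℂ) * Cfun m k L f)) := by
  have hm1 : 1 ≤ m := by omega
  have h := tendsto_phi0 hm k (contDiffOn_comp_turn (by omega : m ≠ 0) L hf)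
    (norm_wd_comp_turn_le hm1 L hf)
    fun j hj => by rw [Cfun_comp_turn (by omega)]; exact h0 j hj
  rwa [Cfun_comp_turn (by omega), gaugeFactor_eq hm1] at h

lemma ofReal_mul_normCD {m : ℕ} (hm : 1 ≤ m) {K : ℕ} {f : ℂ → ℂ} (hf : ContDiffOn ℝ K f (D m))
    {C : ℝ} (hC : 0 ≤ C) :
    ENNReal.ofReal (C * (normCD m K f).toReal) = C.toNNReal * normCD m K f := by
  rw [ENNReal.ofReal_mul hC, ENNReal.ofReal_toReal (normCD_lt_top hm hf).ne]
  rfl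

lemma exists_memCP_phi {m : ℕ} (hm : 2 ≤ m) (k l : ℕ) (ε : Fin 2) :
    ∃ C : ℝ≥0, 0 < C ∧ ∀ f : ℂ → ℂ, ContDiffOn ℝ (max k (nIdx m k + 1) : ℕ) f (D m) →
      (∀ j < k, Cfun m j (2 * l + ε) f = 0) →
        MemCP (half ε) (nIdx m k) (bIdx m k) (phi m l f) ∧
        Tendsto (fun s : ℝ => ((|s| ^ (bIdx m k + 1) : ℝ) : ℂ) *
            iteratedDerivWithin (nIdx m k + 1) (phi m l f) (half ε) s) (𝓝[half ε] 0)
          (𝓝 ((((-1) ^ ((1 - (ε : ℕ)) * (nIdx m k + 1)) *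
            (((nIdx m k + 1) ! : ℝ) / (k ! : ℝ)) *
            binomConv (bIdx m k) (nIdx m k + 1) : ℝ) : ℂ) * Cfun m k (2 * l + ε) f)) ∧
        normCP (half ε) (nIdx m k) (bIdx m k) (phi m l f) ≤
          C * normCD m (max k (nIdx m k + 1)) f := by
  have hm1 : 1 ≤ m := by omega
  obtain ⟨C, hC, hC'⟩ := exists_powerBound_phi0 hm k (2 * l + ε)
  obtain ⟨C1, hC1⟩ := exists_sumL1_le (nIdx m k + 1) (bIdx_lt_one hm1 k)
  -- C1 accounts for the L¹ norms and 1 for the weighted supremum; the final + 1 only makes the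
  -- constant positive.
  refine ⟨(C1 + 1) * C.toNNReal + 1, by positivity, fun f hf h0 => ?_⟩
  have hχ := fun s (hs : s ∈ half ε) => phi_eq_phi0 hm1 l ε f hs
  have hP := hC' f hf h0
  have hp := (pSeminorm_half_le hχ (nIdx m k) (bIdx m k)).trans hP.pSeminorm_le
  have hs := hC1 _ _ hP (nIdx m k) (Nat.lt_succ_self _)
  rw [← sumL1_half hχ] at hs
  rw [ofReal_mul_normCD hm1 hf hC] at hp hs
  have hlim : Tendsto (fun s : ℝ => ((|s| ^ (bIdx m k + 1) : ℝ) : ℂ) *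
            iteratedDerivWithin (nIdx m k + 1) (phi m l f) (half ε) s) (𝓝[half ε] 0)
          (𝓝 ((((-1) ^ ((1 - (ε : ℕ)) * (nIdx m k + 1)) *
            (((nIdx m k + 1) ! : ℝ) / (k ! : ℝ)) *
            binomConv (bIdx m k) (nIdx m k + 1) : ℝ) : ℂ) * Cfun m k (2 * l + ε) f)) := by
    convert tendsto_half hχ (tendsto_phi0_comp_turn hm k (2 * l + ε) hf h0) using 2
    rw [← mul_assoc]
    congr 1
    rw [← Complex.ofReal_mul]
    congr 1
    rw [← mul_assoc, ← mul_assoc]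
    congr 2
    -- For ε = 1 the sign from differentiating along the reflection s ↦ -s cancels the (-1)^{n+1} of
    -- the gauge factor; for ε = 0 it survives.
    fin_cases ε
    · simp [halfSign]
    · simp [halfSign, ← mul_pow]
  refine ⟨⟨(contDiffOn_half hχ).2 hP.contDiffOn, ?_, ?_⟩, hlim, ?_⟩
  · exact hp.trans_lt (ENNReal.mul_lt_top ENNReal.coe_lt_top (normCD_lt_top hm1 hf))
  · rw [add_comm 1 (bIdx m k)]
    exact ⟨_, hlim⟩
  · refine (add_le_add hs hp).trans ?_
    push_cast
    calc _ = ((C1 : ℝ≥0∞) + 1) * C.toNNReal * normCD m (max k (nIdx m k + 1)) f := by ring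
      _ ≤ _ := by gcongr; exact le_self_add

lemma exists_memCr_phi {m : ℕ} (hm : 2 ≤ m) {k : ℕ} (l : ℕ) (ε : Fin 2) (hk : m - 1 ≤ k) :
    ∃ C : ℝ≥0, 0 < C ∧ ∀ f : ℂ → ℂ, ContDiffOn ℝ (max k (nIdx m k + 1) : ℕ) f (D m) →
      (∀ j < k, Cfun m j (2 * l + ε) f = 0) →
        MemCr (half ε) (expo m k) (phi m l f) ∧
        normCr (half ε) (expo m k) (phi m l f) ≤
          C * normCD m (max k (nIdx m k + 1)) f := by
  have hm1 : 1 ≤ m := by omega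
  obtain ⟨C, hC, hC'⟩ := exists_powerBound_phi0 hm k (2 * l + ε)
  obtain ⟨C1, hC1⟩ := exists_sumL1_le (nIdx m k + 1) (bIdx_lt_one hm1 k)
  obtain ⟨hord, hmod⟩ := expo_cases hm hk
  obtain ⟨C2, hC2, hC2'⟩ : ∃ C2 : ℝ, 0 ≤ C2 ∧ ∀ ψ A, PowerBound (nIdx m k + 1) (bIdx m k) A ψ →
      modSeminorm (Set.Ioc 0 1) (expo m k).modulus
        (iteratedDerivWithin (expo m k).order ψ (Set.Ioc 0 1)) ≤ ENNReal.ofReal (C2 * A) := by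
    rw [← hord]
    rcases hmod with ⟨hb, hmod⟩ | ⟨hb, hmod⟩
    · refine ⟨6, by norm_num, fun ψ A h => ?_⟩
      rw [hb] at h
      rw [hmod]
      exact h.modSeminorm_etaFun_le
    · have hb1 := bIdx_lt_one hm1 k
      refine ⟨(1 + 1 / bIdx m k) / (1 - bIdx m k), div_nonneg (by positivity) (by linarith),
        fun ψ A h => ?_⟩
      rw [hmod]
      exact h.modSeminorm_rpow_le hb hb1
  refine ⟨(C1 + C2.toNNReal) * C.toNNReal + 1, by positivity, fun f hf h0 => ?_⟩
  have hχ := fun s (hs : s ∈ half ε) => phi_eq_phi0 hm1 l ε f hs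
  have hP := hC' f hf h0
  have hp := hC2' _ _ hP
  have hs := hC1 _ _ hP (expo m k).order (by omega)
  rw [← sumL1_half hχ] at hs
  rw [← modSeminorm_half hχ, ENNReal.ofReal_mul hC2] at hp
  rw [ofReal_mul_normCD hm1 hf hC] at hp hs
  refine ⟨⟨(contDiffOn_half hχ).2 (hP.contDiffOn.of_le (by exact_mod_cast by omega)), ?_⟩, ?_⟩
  · exact hp.trans_lt (ENNReal.mul_lt_top ENNReal.ofReal_lt_top
      (ENNReal.mul_lt_top ENNReal.coe_lt_top (normCD_lt_top hm1 hf)))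
  · refine (add_le_add hs hp).trans ?_
    push_cast
    rw [ENNReal.ofReal]
    calc _ = ((C1 : ℝ≥0∞) + C2.toNNReal) * C.toNNReal * normCD m (max k (nIdx m k + 1)) f := by ring
      _ ≤ _ := by gcongr; exact le_self_add

/-- Strong induction on j: once the lower functionals vanish, the asymptotics with j in place of k
hold, and 𝔬(j) < v(r) excludes a non-zero limit. The bound v(r) ≤ 𝔬(k) yields j ≤ k, so the
smoothness assumed for k suffices. -/
lemma Cfun_eq_zero_of_memCr {m : ℕ} (hm : 2 ≤ m) {k : ℕ} (l : ℕ) (ε : Fin 2) {f : ℂ → ℂ}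
    (hf : ContDiffOn ℝ (max k (nIdx m k + 1) : ℕ) f (D m)) {r : RegExp} (hr : r.InReta)
    (hv : 0 < r.v) (hvk : r.v ≤ ord m k) (hmem : MemCr (half ε) r (phi m l f)) :
    ∀ j : ℕ, ord m j < r.v → Cfun m j (2 * l + ε) f = 0 := by
  have hm1 : 1 ≤ m := by omega
  have hmem' := (memCr_half (fun s hs => phi_eq_phi0 hm1 l ε f hs) r).1 hmem
  intro j
  induction j using Nat.strong_induction_on with
  | _ j ih =>
    intro hj
    have hjk : j ≤ k := by
      by_contra h
      have := ord_mono (m := m) (not_le.1 h).le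
      linarith
    have hfj : ContDiffOn ℝ (max j (nIdx m j + 1) : ℕ) f (D m) := by
      refine hf.of_le ?_
      have := nIdx_mono (m := m) hjk
      exact_mod_cast max_le_max hjk (by omega)
    have hlim := tendsto_phi0_comp_turn hm j (2 * l + ε) hfj
      fun i hi => ih i hi ((ord_mono hi.le).trans_lt hj)
    have h0 := limit_eq_zero_of_memCr (bIdx_nonneg m j) (bIdx_lt_one hm1 j) hr hv
      (by rwa [← ord_eq_nIdx_sub]) (contDiffOn_Phi hm1 _ _
        ((contDiffOn_comp_turn (by omega) _ hfj).of_le (by exact_mod_cast le_max_right _ _)))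
      hlim hmem'
    refine (mul_eq_zero.1 h0).resolve_left ?_
    rw [Complex.ofReal_eq_zero]
    exact mul_ne_zero (mul_ne_zero (pow_ne_zero _ (by norm_num)) (by positivity))
      (binomConv_ne_zero (bIdx_lt_one hm1 j) _)

end SaddleSector

theorem mainTheorem6 (m k l : ℕ) (hm : 2 ≤ m) (hl : l < m) (ε : Fin 2) :
    (∃ C : ℝ≥0, 0 < C ∧ ∀ f : ℂ → ℂ,
      ContDiffOn ℝ (max k (nIdx m k + 1) : ℕ) f (D m) →
      (∀ j < k, Cfun m j (2 * l + ε) f = 0) →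
        MemCP (half ε) (nIdx m k) (bIdx m k) (phi m l f) ∧
        Filter.Tendsto
          (fun s : ℝ => ((|s| ^ (bIdx m k + 1) : ℝ) : ℂ) *
            iteratedDerivWithin (nIdx m k + 1) (phi m l f) (half ε) s)
          (𝓝[half ε] 0)
          (𝓝 ((((-1) ^ ((1 - (ε : ℕ)) * (nIdx m k + 1)) *
            (((nIdx m k + 1) ! : ℝ) / (k ! : ℝ)) *
            binomConv (bIdx m k) (nIdx m k + 1) : ℝ) : ℂ) * Cfun m k (2 * l + ε) f)) ∧
        normCP (half ε) (nIdx m k) (bIdx m k) (phi m l f) ≤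
          C * normCD m (max k (nIdx m k + 1)) f) ∧
    (m - 1 ≤ k → ∃ C : ℝ≥0, 0 < C ∧ ∀ f : ℂ → ℂ,
      ContDiffOn ℝ (max k (nIdx m k + 1) : ℕ) f (D m) →
      (∀ j < k, Cfun m j (2 * l + ε) f = 0) →
        MemCr (half ε) (expo m k) (phi m l f) ∧
        normCr (half ε) (expo m k) (phi m l f) ≤
          C * normCD m (max k (nIdx m k + 1)) f) ∧
    (∀ f : ℂ → ℂ, ContDiffOn ℝ (max k (nIdx m k + 1) : ℕ) f (D m) →
      ∀ r : RegExp, r.InReta → 0 < r.v → r.v ≤ ord m k →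
        MemCr (half ε) r (phi m l f) →
        ∀ j : ℕ, ord m j < r.v → Cfun m j (2 * l + ε) f = 0) :=
  ⟨exists_memCP_phi hm k l ε, exists_memCr_phi hm l ε, fun _ hf _ hr hv hvk hmem =>
    Cfun_eq_zero_of_memCr hm l ε hf hr hv hvk hmem⟩
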